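/- **Setting.** Let $J\in\mathbb N$ be the number of sunlight/eclipse periods. Let $a>0$, $B_{\max}>0$, $P_c>0$, $E^d_{e,j}\ge 0$ and $B_0,T_c,E^h_{s,j},E^d_{s,j}\in\mathbb R$ ($1\le j\le J$), and let $t_{s,1},t_{e,1},\dots,t_{s,J},t_{e,J},t_{s,J+1}\in\mathbb R$ be the period boundaries. Collect the variables $\tau_{s,j},\tau_{e,j},b_{e,j},b_{s,j+1},d_{e,j},\hat d_{e,j}$ ($1\le j\le J$) in a vector $\boldsymbol x\in\mathbb R^{6J}$, put $b_{s,1}=B_0$ and $\boldsymbol d=(d_{e,1},\dots,d_{e,J})$, and let $\mathcal X$ be the set of all $\boldsymbol x$ such that $\sum_{j=1}^J(\tau_{s,j}+\tau_{e,j})=T_c$ and, for all $j$, $$b_{s,j+1}=b_{e,j}-E^d_{e,j}-P_c\tau_{e,j},\qquad b_{e,j}\le\min\{b_{s,j}+E^h_{s,j}-E^d_{s,j}-P_c\tau_{s,j},\,B_{\max}\},\qquad E^h_{s,j}-E^d_{s,j}-P_c\tau_{s,j}\ge0,$$ $$d_{e,j}=\frac{B_{\max}-b_{e,j}}{B_{\max}},\qquad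 \hat d_{e,j}=\frac{B_{\max}-b_{s,j+1}}{B_{\max}},\qquad 0\le\tau_{s,j}\le t_{e,j}-t_{s,j},\qquad 0\le\tau_{e,j}\le t_{s,j+1}-t_{e,j},$$ $$0\le b_{s,j+1}\le B_{\max},\qquad 0\le b_{e,j}\le B_{\max}.$$ With $u(\boldsymbol x)=\sum_{j}10^{a(\hat d_{e,j}-1)}\hat d_{e,j}$ and $v(\boldsymbol d)=\sum_j 10^{a(d_{e,j}-1)}d_{e,j}$, consider the problem $$(\mathrm P)\qquad \min_{\boldsymbol x\in\mathcal X} f(\boldsymbol x)=u(\boldsymbol x)-v(\boldsymbol d).$$ A point $\boldsymbol x\in\mathcal X$ is a *stationary point* of $(\mathrm P)$ if $\nabla f(\boldsymbol x)^T(\boldsymbol y-\boldsymbol x)\ge0$ for all $\boldsymbol y\in\mathcal X$. Norms are Euclidean. **Algorithm (concave-convex procedure) with tolerance $\varepsilon\ge0$.** Start with any $\boldsymbol x^{(0)}\in\mathcal X$ and $l=0$. Repeat: let $\boldsymbol x^{(l+1)}$ be any element of $$\operatorname*{arg\,min}_{\boldsymbol x\in\mathcal X}\; u(\boldsymbol x)-\boldsymbol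 d^T\nabla v(\boldsymbol d^{(l)}),\qquad \boldsymbol d^T\nabla v(\boldsymbol d^{(l)})=\sum_{j}d_{e,j}\,10^{a(d^{(l)}_{e,j}-1)}\bigl(1+a\,d^{(l)}_{e,j}\ln 10\bigr),$$ and increase $l$ by one; until $\Vert\boldsymbol d^{(l)}-\boldsymbol d^{(l-1)}\Vert\le\varepsilon$. The generated sequence is finite if the stopping test is met at some point, in which case its limit is understood to be its last member, and infinite otherwise. **Theorem.** There is a function $\delta:\mathbb R\to\mathbb R$, depending only on the data of $(\mathrm P)$, with $\delta(\varepsilon)>\varepsilon$ for all $\varepsilon>0$ and $\delta(\varepsilon)\to0$ as $\varepsilon\downarrow0$, such that for every $\varepsilon\ge0$ and every sequence $\{\boldsymbol x^{(l)}\}_l$ generated by the algorithm with tolerance $\varepsilon$: 1. the sequence converges to a point $\bar{\boldsymbol x}$; 2. if $\varepsilon=0$, then $\bar{\boldsymbol x}$ is a stationary point of $(\mathrm P)$; 3. if $\varepsilon>0$, then the algorithm terminates after finitely many iterations and $\Vert\boldsymbol x^\star-\bar{\boldsymbol x}\Vert\le\delta(\varepsilon)$ for some stationary point $\boldsymbol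 x^\star$ of $(\mathrm P)$. -/

import Mathlib

open Filter Topology

noncomputable section

/-- Data of the scheduling problem with `J` sunlight/eclipse periods.  Index `j : Fin J` is the
`(j+1)`-st period. Only the sign conditions that are not already forced by feasibility are kept. -/
structure SatData (J : ℕ) where
  /-- battery constant of the cycle life model -/
  a : ℝ
  /-- battery capacity -/
  Bmax : ℝ
  /-- initial battery charge -/
  B0 : ℝ
  /-- power needed for training -/
  Pc : ℝ
  /-- total training time -/
  Tc : ℝ
  /-- starts of the sunlight periods; the last entry is the end of the last eclipse -/
  tS : Fin (J + 1) → ℝ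
  /-- starts of the eclipse periods -/
  tE : Fin J → ℝ
  /-- harvested energy in the sunlight periods -/
  EhS : Fin J → ℝ
  /-- non-training energy demand in the sunlight periods -/
  EdS : Fin J → ℝ
  /-- non-training energy demand in the eclipse periods -/
  EdE : Fin J → ℝ
  a_pos : 0 < a
  Bmax_pos : 0 < Bmax
  Pc_pos : 0 < Pc
  EdE_nonneg : ∀ j, 0 ≤ EdE j

/-- All optimization variables: six real vectors of length `J`, with the Euclidean norm. -/
abbrev SatVar (J : ℕ) : Type := EuclideanSpace ℝ (Fin 6 × Fin J)

namespace SatVar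

variable {J : ℕ}

/-- Training time in sunlight period `j`. -/
def tauS (x : SatVar J) (j : Fin J) : ℝ := x (0, j)

/-- Training time in eclipse period `j`. -/
def tauE (x : SatVar J) (j : Fin J) : ℝ := x (1, j)

/-- Battery level at the beginning of eclipse `j`. -/
def bE (x : SatVar J) (j : Fin J) : ℝ := x (2, j)

/-- Battery level at the end of eclipse `j` (`b_{s,j+1}`). -/
def bSnext (x : SatVar J) (j : Fin J) : ℝ := x (3, j)

/-- Depth of discharge at the beginning of eclipse `j`. -/
def dE (x : SatVar J) (j : Fin J) : ℝ := x (4, j)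

/-- Depth of discharge at the end of eclipse `j`. -/
def dHat (x : SatVar J) (j : Fin J) : ℝ := x (5, j)

/-- The vector of depths of discharge at the beginnings of the eclipses. -/
def dVec (x : SatVar J) : EuclideanSpace ℝ (Fin J) := WithLp.toLp 2 (fun j => x.dE j)

end SatVar

/-- `10^{a(d-1)} d`, the cycle life consumed by a discharge from depth `0` to depth `d`. -/
def cycleLife (a d : ℝ) : ℝ := (10 : ℝ) ^ (a * (d - 1)) * d

/-- The derivative of `cycleLife a` at `d` (see `hasDerivAt_cycleLife`). -/
def cycleLifeSlope (a d : ℝ) : ℝ := (10 : ℝ) ^ (a * (d - 1)) * (1 + a * d * Real.log 10)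

theorem hasDerivAt_cycleLife (a d : ℝ) :
    HasDerivAt (cycleLife a) (cycleLifeSlope a d) d := by
  have h1 : HasDerivAt (fun y : ℝ => a * (y - 1)) a d := by
    simpa using ((hasDerivAt_id d).sub_const 1).const_mul a
  have h2 := (h1.const_rpow (a := (10 : ℝ)) (by norm_num)).mul (hasDerivAt_id d)
  refine h2.congr_deriv ?_
  simp only [cycleLifeSlope, id]
  ring

namespace SatData

variable {J : ℕ}

/-- Battery level `b_{s,j}` at the beginning of sunlight period `j`: the initial charge for the
first period, the level at the end of the preceding eclipse otherwise. -/
def bS (p : SatData J) (x : SatVar J) (j : Fin J) : ℝ :=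
  if j.val = 0 then p.B0 else x.bSnext ⟨j.val - 1, lt_of_le_of_lt (Nat.sub_le _ _) j.isLt⟩

/-- The constraints of the relaxed problem. -/
structure IsFeasible (p : SatData J) (x : SatVar J) : Prop where
  eclipse : ∀ j, x.bSnext j = x.bE j - p.EdE j - p.Pc * x.tauE j
  sunlight : ∀ j, x.bE j ≤ min (p.bS x j + p.EhS j - p.EdS j - p.Pc * x.tauS j) p.Bmax
  no_discharge : ∀ j, 0 ≤ p.EhS j - p.EdS j - p.Pc * x.tauS j
  dod_start : ∀ j, x.dE j = (p.Bmax - x.bE j) / p.Bmax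
  dod_end : ∀ j, x.dHat j = (p.Bmax - x.bSnext j) / p.Bmax
  total_time : ∑ j, (x.tauS j + x.tauE j) = p.Tc
  time_sun : ∀ j, 0 ≤ x.tauS j ∧ x.tauS j ≤ p.tE j - p.tS j.castSucc
  time_ecl : ∀ j, 0 ≤ x.tauE j ∧ x.tauE j ≤ p.tS j.succ - p.tE j
  level_end : ∀ j, 0 ≤ x.bSnext j ∧ x.bSnext j ≤ p.Bmax
  level_start : ∀ j, 0 ≤ x.bE j ∧ x.bE j ≤ p.Bmax

/-- The feasible set of the relaxed problem. -/
def feasibleSet (p : SatData J) : Set (SatVar J) := {x | p.IsFeasible x}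

/-- The convex part of the objective. -/
def u (p : SatData J) (x : SatVar J) : ℝ := ∑ j, cycleLife p.a (x.dHat j)

/-- The convex function that is subtracted in the objective. -/
def v (p : SatData J) (x : SatVar J) : ℝ := ∑ j, cycleLife p.a (x.dE j)

/-- The objective of the relaxed problem, a difference of convex functions. -/
def objective (p : SatData J) (x : SatVar J) : ℝ := p.u x - p.v x

/-- The surrogate objective obtained from the iterate `z`: `u(x) - dᵀ ∇v(d_z)`. -/
def surrogate (p : SatData J) (z x : SatVar J) : ℝ :=
  p.u x - ∑ j, x.dE j * cycleLifeSlope p.a (z.dE j)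

/-- `x` is an optimal point of the surrogate problem built at `z`. -/
def IsSurrogateOptimal (p : SatData J) (z x : SatVar J) : Prop :=
  x ∈ p.feasibleSet ∧ ∀ y ∈ p.feasibleSet, p.surrogate z x ≤ p.surrogate z y

/-- First-order stationarity for minimizing the objective over the (convex) feasible set. -/
def IsStationary (p : SatData J) (x : SatVar J) : Prop :=
  x ∈ p.feasibleSet ∧ ∀ y ∈ p.feasibleSet, 0 ≤ fderiv ℝ p.objective x (y - x)

/-- `x 0, x 1, …` is a run of the concave-convex procedure with tolerance `ε` that performs exactly
`N` iterations (`N = ⊤` if it never stops): each iteration replaces the iterate by some optimal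
point of the surrogate problem, and an iteration is the last one exactly when the stopping test
holds after it. The entries `x l` with `l > N` play no role. -/
structure IsRun (p : SatData J) (ε : ℝ) (x : ℕ → SatVar J) (N : ℕ∞) : Prop where
  init : x 0 ∈ p.feasibleSet
  one_le : 1 ≤ N
  step : ∀ l : ℕ, (l : ℕ∞) < N → p.IsSurrogateOptimal (x l) (x (l + 1))
  stop_iff : ∀ l : ℕ, (l : ℕ∞) < N →
    (‖(x (l + 1)).dVec - (x l).dVec‖ ≤ ε ↔ N = ((l + 1 : ℕ) : ℕ∞))

end SatData

/-- Convergence of the sequence `x 0, …, x N`: to its last member if it is finite, in the usual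
sense if it is infinite. -/
def RunConvergesTo {J : ℕ} (x : ℕ → SatVar J) (N : ℕ∞) (xbar : SatVar J) : Prop :=
  (∃ L : ℕ, N = (L : ℕ∞) ∧ xbar = x L) ∨ (N = ⊤ ∧ Tendsto x atTop (𝓝 xbar))

end

/-!
Convexity of `cycleLife` makes every iteration decrease the objective by a multiple of
`‖d⁽ˡ⁺¹⁾ - d⁽ˡ⁾‖²`, while optimality for the surrogate problem makes `x⁽ˡ⁺¹⁾` a critical point of
the objective up to an error `O(‖d⁽ˡ⁺¹⁾ - d⁽ˡ⁾‖)`. If the objective satisfies a Łojasiewicz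
inequality with exponent `1/2` near a limit point, then the sequence of depths has finite length
and converges.

The Łojasiewicz inequality is where the shape of the problem enters. Listed in temporal order, the
depths form a chain whose increments lie between bounds linear in the training times, and a depth
moves freely only together with the block of neighbours linked to it by tight increments. Along such
a block the objective is a signed sum of translates of `cycleLife`; its derivative has the form
`10 ^ (a q) * (A + B q)`, which either vanishes identically or has a simple zero.

If the total training time can be reallocated at no cost, then an approximately critical chain is
already a global minimizer, so the algorithm stops. Otherwise the time constraint is active, and the
depths determine the training times. For positive tolerance, a compactness argument shows that an
approximate fixed point of the surrogate iteration is close to a stationary point.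
-/

/-! ### Calculus on the line -/

theorem mul_sub_le_image_sub_of_le_hasDerivAt {f f' : ℝ → ℝ} {D : Set ℝ} {c : ℝ}
    (hD : Convex ℝ D) (hf : ∀ x ∈ D, HasDerivAt f (f' x) x) (h : ∀ x ∈ D, c ≤ f' x) {x y : ℝ}
    (hx : x ∈ D) (hy : y ∈ D) (hxy : x ≤ y) : c * (y - x) ≤ f y - f x :=
  hD.mul_sub_le_image_sub_of_le_deriv (fun z hz => (hf z hz).continuousAt.continuousWithinAt)
    (fun z hz => (hf z (interior_subset hz)).differentiableAt.differentiableWithinAt)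
    (fun z hz => (hf z (interior_subset hz)).deriv ▸ h z (interior_subset hz)) x hx y hy hxy

theorem image_sub_le_mul_sub_of_hasDerivAt_le {f f' : ℝ → ℝ} {D : Set ℝ} {c : ℝ}
    (hD : Convex ℝ D) (hf : ∀ x ∈ D, HasDerivAt f (f' x) x) (h : ∀ x ∈ D, f' x ≤ c) {x y : ℝ}
    (hx : x ∈ D) (hy : y ∈ D) (hxy : x ≤ y) : f y - f x ≤ c * (y - x) :=
  hD.image_sub_le_mul_sub_of_deriv_le (fun z hz => (hf z hz).continuousAt.continuousWithinAt)
    (fun z hz => (hf z (interior_subset hz)).differentiableAt.differentiableWithinAt)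
    (fun z hz => (hf z (interior_subset hz)).deriv ▸ h z (interior_subset hz)) x hx y hy hxy

theorem tangent_add_sq_le {f f' : ℝ → ℝ} {D : Set ℝ} {c : ℝ} (hD : Convex ℝ D)
    (hf : ∀ x ∈ D, HasDerivAt f (f' x) x)
    (h : ∀ x ∈ D, ∀ y ∈ D, x ≤ y → c * (y - x) ≤ f' y - f' x) {x y : ℝ} (hx : x ∈ D) (hy : y ∈ D) :
    f x + f' x * (y - x) + c / 2 * (y - x) ^ 2 ≤ f y := by
  have hd : ∀ s ∈ D, HasDerivAt (fun s => f s - f' x * s - c / 2 * (s - x) ^ 2)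
      (f' s - f' x - c * (s - x)) s := by
    intro s hs
    have hlin : HasDerivAt (fun s : ℝ => f' x * s) (f' x) s := by
      simpa only [mul_one, id] using (hasDerivAt_id s).const_mul (f' x)
    have hsq : HasDerivAt (fun s : ℝ => c / 2 * (s - x) ^ 2) (c * (s - x)) s := by
      refine ((((hasDerivAt_id s).sub_const x).pow 2).const_mul (c / 2)).congr_deriv ?_
      simp only [id, Nat.cast_ofNat, mul_one]
      ring
    exact ((hf s hs).sub hlin).sub hsq
  rcases le_total x y with hxy | hyx
  · have := mul_sub_le_image_sub_of_le_hasDerivAt (c := 0) (hD.inter (convex_Ici x))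
      (fun s hs => hd s hs.1) (fun s hs => by linarith [h x hx s hs.1 hs.2])
      ⟨hx, Set.self_mem_Ici⟩ ⟨hy, hxy⟩ hxy
    simp only [sub_self] at this
    nlinarith
  · have := image_sub_le_mul_sub_of_hasDerivAt_le (c := 0) (hD.inter (convex_Iic x))
      (fun s hs => hd s hs.1) (fun s hs => by linarith [h s hs.1 x hx hs.2])
      ⟨hy, hyx⟩ ⟨hx, Set.self_mem_Iic⟩ hyx
    simp only [sub_self] at this
    nlinarith

theorem eventually_nhdsGT_forall_abs_le {P : ℝ → Prop} (hP : ∀ᶠ q in 𝓝 (0 : ℝ), P q) :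
    ∀ᶠ γ in 𝓝[>] (0 : ℝ), ∀ q, |q| ≤ γ → P q := by
  obtain ⟨r, hr, h⟩ := Metric.eventually_nhds_iff.1 hP
  filter_upwards [Ioo_mem_nhdsGT hr] with γ hγ q hq
  exact h (by rw [Real.dist_eq, sub_zero]; exact hq.trans_lt hγ.2)

theorem eventually_mul_le_sq_of_ne_zero {f f' : ℝ → ℝ} (hf : ContinuousAt f 0) (hf0 : f 0 = 0)
    (hf' : ContinuousAt f' 0) (hf'0 : f' 0 ≠ 0) :
    ∀ᶠ γ in 𝓝[>] (0 : ℝ), ∀ q, |q| ≤ γ → γ * f q ≤ f' q ^ 2 := by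
  have hpos : 0 < f' 0 ^ 2 / 2 := by positivity
  have hsq : ∀ᶠ q in 𝓝 (0 : ℝ), f' 0 ^ 2 / 2 < f' q ^ 2 :=
    (hf'.pow 2).eventually (lt_mem_nhds (half_lt_self (by positivity)))
  have hsmall : ∀ᶠ q in 𝓝 (0 : ℝ), f q < f' 0 ^ 2 / 2 :=
    hf.eventually (gt_mem_nhds (by rwa [hf0]))
  filter_upwards [eventually_nhdsGT_forall_abs_le (hsq.and hsmall),
    Ioo_mem_nhdsGT (zero_lt_one' ℝ)] with γ h hγ q hq
  obtain ⟨h1, h2⟩ := h q hq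
  nlinarith [hγ.1, hγ.2]

theorem eventually_mul_le_sq_of_abs_le {f f' : ℝ → ℝ} {c C : ℝ} (hf : ∀ x, HasDerivAt f (f' x) x)
    (hf0 : f 0 = 0) (hc : 0 < c) (hC : 0 ≤ C) (hlow : ∀ᶠ q in 𝓝 (0 : ℝ), c * |q| ≤ |f' q|)
    (hup : ∀ᶠ q in 𝓝 (0 : ℝ), |f' q| ≤ C * |q|) :
    ∀ᶠ γ in 𝓝[>] (0 : ℝ), ∀ q, |q| ≤ γ → γ * f q ≤ f' q ^ 2 := by
  have hγC : ∀ᶠ γ in 𝓝[>] (0 : ℝ), γ * C < c ^ 2 := by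
    refine nhdsWithin_le_nhds (((continuous_mul_const C).tendsto 0).eventually (gt_mem_nhds ?_))
    rw [zero_mul]
    positivity
  filter_upwards [eventually_nhdsGT_forall_abs_le (hlow.and hup), hγC, self_mem_nhdsWithin]
    with γ h hγC hγ q hq
  have hquad : |f q| ≤ C * |q| * |q| := by
    have := (convex_Icc (-|q|) |q|).norm_image_sub_le_of_norm_hasDerivWithin_le
      (fun x _ => (hf x).hasDerivWithinAt) (C := C * |q|) (fun x hx => ?_)
      (x := 0) (y := q) (by simp) (by simp [neg_abs_le, le_abs_self])
    · simpa only [hf0, sub_zero, Real.norm_eq_abs] using this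
    · have hxq : |x| ≤ |q| := abs_le.2 hx
      exact (h x (hxq.trans hq)).2.trans (by gcongr)
  calc γ * f q ≤ γ * (C * |q| * |q|) :=
        mul_le_mul_of_nonneg_left ((le_abs_self _).trans hquad) (le_of_lt hγ)
    _ = γ * C * |q| ^ 2 := by ring
    _ ≤ c ^ 2 * |q| ^ 2 := by gcongr
    _ = (c * |q|) ^ 2 := by ring
    _ ≤ |f' q| ^ 2 := by gcongr; exact (h q hq).1
    _ = f' q ^ 2 := sq_abs _

theorem eventually_mul_le_sq_of_eq_mul_add {f f' g : ℝ → ℝ} {A B : ℝ}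
    (hf : ∀ x, HasDerivAt f (f' x) x) (hf0 : f 0 = 0) (hg : ContinuousAt g 0) (hg0 : g 0 = 1)
    (hf' : ∀ q, f' q = g q * (A + B * q)) :
    ∀ᶠ γ in 𝓝[>] (0 : ℝ), ∀ q, |q| ≤ γ → γ * f q ≤ f' q ^ 2 := by
  by_cases hA : A = 0
  · by_cases hB : B = 0
    · have hf'_zero : ∀ q, f' q = 0 := fun q => by rw [hf', hA, hB]; ring
      have hf_zero : ∀ q, f q = 0 := fun q => hf0 ▸
        is_const_of_deriv_eq_zero (fun q => (hf q).differentiableAt)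
          (fun q => by rw [(hf q).deriv, hf'_zero]) q 0
      filter_upwards with γ q _
      rw [hf_zero, hf'_zero, mul_zero, sq, mul_zero]
    · have habs : ∀ q, |f' q| = |g q| * (|B| * |q|) := fun q => by
        rw [hf', hA, zero_add, abs_mul, abs_mul]
      have hgabs : Tendsto (fun q => |g q|) (𝓝 0) (𝓝 1) := by
        simpa only [hg0, abs_one] using hg.abs.tendsto
      have : 0 < |B| := abs_pos.2 hB
      refine eventually_mul_le_sq_of_abs_le (c := 1 / 2 * |B|) (C := 2 * |B|) hf hf0
        (by positivity) (by positivity) ?_ ?_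
      · filter_upwards [hgabs.eventually_const_lt one_half_lt_one] with q hq
        rw [habs, mul_assoc]
        gcongr
      · filter_upwards [hgabs.eventually_lt_const one_lt_two] with q hq
        rw [habs, mul_assoc]
        gcongr
  · have hf'_cont : ContinuousAt f' 0 :=
      (hg.mul (by fun_prop : ContinuousAt (fun q => A + B * q) 0)).congr
        (.of_forall fun q => (hf' q).symm)
    exact eventually_mul_le_sq_of_ne_zero (hf 0).continuousAt hf0 hf'_cont
      (by rwa [hf', hg0, mul_zero, add_zero, one_mul])

/-! ### Sequences with finite length -/

theorem tendsto_zero_of_add_le_add {A G : ℕ → ℝ} {ρ : ℝ} (hρ : 0 < ρ) (hA : ∀ l, 0 ≤ A l)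
    (hG : ∀ l, 0 ≤ G l) (hG0 : Tendsto G atTop (𝓝 0))
    (hdec : ∀ᶠ l in atTop, A l + G l ≤ ρ → A (l + 1) + G (l + 1) ≤ A l + G l)
    (hfreq : ∀ ε > 0, ∃ᶠ l in atTop, A l ≤ ε) : Tendsto A atTop (𝓝 0) := by
  rw [Metric.tendsto_atTop]
  intro ε hε
  set δ := min ρ (ε / 2)
  have hδ : 0 < δ := lt_min hρ (half_pos hε)
  obtain ⟨L, hL⟩ := eventually_atTop.1 hdec
  have hlate : ∀ᶠ l in atTop, L ≤ l ∧ G l < δ / 2 :=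
    (eventually_ge_atTop L).and (hG0.eventually_lt_const (half_pos hδ))
  obtain ⟨l₀, hA₀, hLl₀, hG₀⟩ := ((hfreq (δ / 2) (half_pos hδ)).and_eventually hlate).exists
  have htrap : ∀ l ≥ l₀, A l + G l ≤ δ := by
    intro l hl
    induction l, hl using Nat.le_induction with
    | base => linarith
    | succ l hl ih => exact (hL l (hLl₀.trans hl) (ih.trans (min_le_left _ _))).trans ih
  refine ⟨l₀, fun l hl => ?_⟩
  rw [Real.dist_eq, sub_zero, abs_of_nonneg (hA l)]
  linarith [htrap l hl, hG l, min_le_right ρ (ε / 2)]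

theorem tendsto_zero_of_descent {A b F : ℕ → ℝ} {α C ρ : ℝ} (hα : 0 < α) (hC : 0 ≤ C) (hρ : 0 < ρ)
    (hA : ∀ l, 0 ≤ A l) (hAb : ∀ l, A (l + 1) ≤ A l + b l) (hF : Tendsto F atTop (𝓝 0))
    (hF0 : ∀ l, 0 ≤ F l) (hdec : ∀ l, α * b l ^ 2 ≤ F l - F (l + 1))
    (hKL : ∀ᶠ l in atTop, A (l + 1) ≤ ρ → F (l + 1) ≤ C * (F l - F (l + 1)))
    (hfreq : ∀ ε > 0, ∃ᶠ l in atTop, A l ≤ ε) : Tendsto A atTop (𝓝 0) := by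
  set w : ℕ → ℝ := fun l => √(F l / α) with hw
  set r := √(C / (1 + C)) with hr
  have hr1 : 0 < 1 - r := by
    rw [sub_pos, hr, Real.sqrt_lt' one_pos, one_pow, div_lt_one (by linarith)]
    linarith
  have hw0 : ∀ l, 0 ≤ w l := fun l => Real.sqrt_nonneg _
  have hbw : ∀ l, b l ≤ w l := fun l => Real.le_sqrt_of_sq_le <| by
    rw [le_div_iff₀ hα]
    linarith [hdec l, hF0 (l + 1)]
  have hwG : ∀ l, w l ≤ w l / (1 - r) := fun l =>
    le_div_self (hw0 l) hr1 (by linarith [Real.sqrt_nonneg (C / (1 + C))])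
  have hG0 : Tendsto (fun l => w l / (1 - r)) atTop (𝓝 0) := by
    have := ((Real.continuous_sqrt.tendsto _).comp (hF.div_const α)).div_const (1 - r)
    simpa only [zero_div, Real.sqrt_zero, Function.comp_def] using this
  -- Near the cluster point the excess decays geometrically, so `w l / (1 - r)` bounds the length of
  -- the remaining path.
  refine tendsto_zero_of_add_le_add (G := fun l => w l / (1 - r)) hρ hA
    (fun l => div_nonneg (hw0 l) hr1.le) hG0 ?_ hfreq
  filter_upwards [hKL] with l hl hlρ
  have hFl : F (l + 1) ≤ C / (1 + C) * F l := by
    rw [div_mul_eq_mul_div, le_div_iff₀ (by linarith)]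
    linarith [hl (by linarith [hAb l, hbw l, hwG l])]
  have hwl : w (l + 1) ≤ r * w l := by
    rw [hr, hw, ← Real.sqrt_mul (by positivity)]
    refine Real.sqrt_le_sqrt ?_
    rw [← mul_div_assoc]
    exact div_le_div_of_nonneg_right hFl hα.le
  calc A (l + 1) + w (l + 1) / (1 - r) ≤ (A l + w l) + r * w l / (1 - r) := by
        gcongr
        exact (hAb l).trans (by linarith [hbw l])
    _ = A l + w l / (1 - r) := by field_simp; ring

theorem eventually_nhdsGT_forall_le_of_pos {ι : Type*} {s : Set ι} (hs : s.Finite) (v : ι → ℝ) :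
    ∀ᶠ γ in 𝓝[>] (0 : ℝ), ∀ i ∈ s, 0 < v i → γ ≤ v i := by
  refine (eventually_all_finite hs).2 fun i _ => ?_
  by_cases h : 0 < v i
  · filter_upwards [Ioo_mem_nhdsGT h] with γ hγ _ using hγ.2.le
  · exact .of_forall fun γ h' => absurd h' h

theorem sum_Ico_two_mul {M : Type*} [AddCommMonoid M] (h : ℕ → M) {α β : ℕ} (hab : α ≤ β) :
    ∑ i ∈ Finset.Ico (2 * α) (2 * β), h i = ∑ j ∈ Finset.Ico α β, (h (2 * j) + h (2 * j + 1)) := by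
  induction β, hab using Nat.le_induction with
  | base => simp
  | succ β hb ih =>
    rw [Finset.sum_Ico_succ_top hb, ← ih, show 2 * (β + 1) = 2 * β + 1 + 1 by ring,
      Finset.sum_Ico_succ_top (by omega), Finset.sum_Ico_succ_top (by omega), add_assoc]

theorem sum_range_two_mul {M : Type*} [AddCommMonoid M] (h : ℕ → M) (n : ℕ) :
    ∑ i ∈ Finset.range (2 * n), h i = ∑ j ∈ Finset.range n, (h (2 * j) + h (2 * j + 1)) := by
  simpa only [Finset.range_eq_Ico] using sum_Ico_two_mul h (Nat.zero_le n)

/-! ### The cycle life function -/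

/-- The second derivative of `cycleLife a`. -/
noncomputable def cycleLifeCurv (a d : ℝ) : ℝ :=
  (10 : ℝ) ^ (a * (d - 1)) * (2 * (a * Real.log 10) + (a * Real.log 10) ^ 2 * d)

theorem log_ten_pos : 0 < Real.log 10 := Real.log_pos (by norm_num)

theorem hasDerivAt_ten_rpow (a d : ℝ) :
    HasDerivAt (fun y : ℝ => (10 : ℝ) ^ (a * (y - 1)))
      ((10 : ℝ) ^ (a * (d - 1)) * (a * Real.log 10)) d := by
  have hexp : HasDerivAt (fun y : ℝ => a * (y - 1)) a d := by
    simpa only [mul_one, id] using ((hasDerivAt_id d).sub_const 1).const_mul a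
  refine (hexp.const_rpow (by norm_num : (0 : ℝ) < 10)).congr_deriv ?_
  ring

theorem hasDerivAt_cycleLifeSlope (a d : ℝ) :
    HasDerivAt (cycleLifeSlope a) (cycleLifeCurv a d) d := by
  have haff : HasDerivAt (fun y : ℝ => 1 + a * y * Real.log 10) (a * Real.log 10) d := by
    simpa only [mul_one, id] using
      (((hasDerivAt_id d).const_mul a).mul_const (Real.log 10)).const_add 1
  refine ((hasDerivAt_ten_rpow a d).mul haff).congr_deriv ?_
  simp only [cycleLifeCurv]
  ring

theorem hasDerivAt_cycleLifeCurv (a d : ℝ) :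
    HasDerivAt (cycleLifeCurv a) ((10 : ℝ) ^ (a * (d - 1)) *
      (3 * (a * Real.log 10) ^ 2 + (a * Real.log 10) ^ 3 * d)) d := by
  have haff : HasDerivAt (fun y : ℝ => 2 * (a * Real.log 10) + (a * Real.log 10) ^ 2 * y)
      ((a * Real.log 10) ^ 2) d := by
    simpa only [mul_one, id] using ((hasDerivAt_id d).const_mul ((a * Real.log 10) ^ 2)).const_add
      (2 * (a * Real.log 10))
  refine ((hasDerivAt_ten_rpow a d).mul haff).congr_deriv ?_
  ring

theorem continuous_cycleLife (a : ℝ) : Continuous (cycleLife a) :=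
  continuous_iff_continuousAt.2 fun x => (hasDerivAt_cycleLife a x).continuousAt

theorem continuous_cycleLifeSlope (a : ℝ) : Continuous (cycleLifeSlope a) :=
  continuous_iff_continuousAt.2 fun x => (hasDerivAt_cycleLifeSlope a x).continuousAt

section Bounds

variable {a : ℝ}

/-- A lower bound for the second derivative of `cycleLife a` on the unit interval. -/
noncomputable def curvLower (a : ℝ) : ℝ := (10 : ℝ) ^ (-a) * (2 * (a * Real.log 10))

/-- An upper bound for the second derivative of `cycleLife a` on the unit interval. -/
noncomputable def curvUpper (a : ℝ) : ℝ := 2 * (a * Real.log 10) + (a * Real.log 10) ^ 2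

/-- A lower bound for the third derivative of `cycleLife a` on the unit interval. -/
noncomputable def jerkLower (a : ℝ) : ℝ := (10 : ℝ) ^ (-a) * (3 * (a * Real.log 10) ^ 2)

theorem curvLower_pos (ha : 0 < a) : 0 < curvLower a := by
  have := log_ten_pos
  unfold curvLower
  positivity

theorem curvUpper_pos (ha : 0 < a) : 0 < curvUpper a := by
  have := log_ten_pos
  unfold curvUpper
  positivity

theorem jerkLower_pos (ha : 0 < a) : 0 < jerkLower a := by
  have := log_ten_pos
  unfold jerkLower
  positivity

theorem ten_rpow_le_one {d : ℝ} (ha : 0 < a) (hd : d ≤ 1) : (10 : ℝ) ^ (a * (d - 1)) ≤ 1 :=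
  Real.rpow_le_one_of_one_le_of_nonpos (by norm_num)
    (mul_nonpos_of_nonneg_of_nonpos ha.le (by linarith))

theorem le_ten_rpow {d : ℝ} (ha : 0 < a) (hd : 0 ≤ d) :
    (10 : ℝ) ^ (-a) ≤ (10 : ℝ) ^ (a * (d - 1)) :=
  Real.rpow_le_rpow_of_exponent_le (by norm_num) (by nlinarith)

theorem le_cycleLifeSlope_sub (ha : 0 < a) {x y : ℝ} (hx : 0 ≤ x) (hxy : x ≤ y) (hy : y ≤ 1) :
    curvLower a * (y - x) ≤ cycleLifeSlope a y - cycleLifeSlope a x := by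
  have : 0 < a * Real.log 10 := mul_pos ha log_ten_pos
  refine mul_sub_le_image_sub_of_le_hasDerivAt (convex_Icc 0 1)
    (fun z _ => hasDerivAt_cycleLifeSlope a z) ?_ ⟨hx, hxy.trans hy⟩ ⟨hx.trans hxy, hy⟩ hxy
  rintro z ⟨hz0, -⟩
  exact mul_le_mul (le_ten_rpow ha hz0) (le_add_of_nonneg_right (by positivity)) (by positivity)
    (by positivity)

theorem cycleLifeSlope_sub_le (ha : 0 < a) {x y : ℝ} (hx : 0 ≤ x) (hxy : x ≤ y) (hy : y ≤ 1) :
    cycleLifeSlope a y - cycleLifeSlope a x ≤ curvUpper a * (y - x) := by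
  have : 0 < a * Real.log 10 := mul_pos ha log_ten_pos
  refine image_sub_le_mul_sub_of_hasDerivAt_le (convex_Icc 0 1)
    (fun z _ => hasDerivAt_cycleLifeSlope a z) ?_ ⟨hx, hxy.trans hy⟩ ⟨hx.trans hxy, hy⟩ hxy
  rintro z ⟨hz0, hz1⟩
  calc cycleLifeCurv a z ≤ 1 * (2 * (a * Real.log 10) + (a * Real.log 10) ^ 2 * z) :=
        mul_le_mul_of_nonneg_right (ten_rpow_le_one ha hz1) (by positivity)
    _ ≤ 2 * (a * Real.log 10) + (a * Real.log 10) ^ 2 * 1 := by rw [one_mul]; gcongr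
    _ = curvUpper a := by rw [mul_one, curvUpper]

theorem abs_cycleLifeSlope_sub_le (ha : 0 < a) {x y : ℝ} (hx0 : 0 ≤ x) (hx1 : x ≤ 1) (hy0 : 0 ≤ y)
    (hy1 : y ≤ 1) : |cycleLifeSlope a y - cycleLifeSlope a x| ≤ curvUpper a * |y - x| := by
  wlog hxy : x ≤ y generalizing x y
  · rw [abs_sub_comm, abs_sub_comm y]
    exact this hy0 hy1 hx0 hx1 (le_of_not_ge hxy)
  have hnonneg := (mul_nonneg (curvLower_pos ha).le (sub_nonneg.2 hxy)).trans
    (le_cycleLifeSlope_sub ha hx0 hxy hy1)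
  rw [abs_of_nonneg (sub_nonneg.2 hxy), abs_of_nonneg hnonneg]
  exact cycleLifeSlope_sub_le ha hx0 hxy hy1

theorem cycleLifeSlope_mono (ha : 0 < a) {x y : ℝ} (hx : 0 ≤ x) (hxy : x ≤ y) (hy : y ≤ 1) :
    cycleLifeSlope a x ≤ cycleLifeSlope a y :=
  sub_nonneg.1 ((mul_nonneg (curvLower_pos ha).le (sub_nonneg.2 hxy)).trans
    (le_cycleLifeSlope_sub ha hx hxy hy))

theorem cycleLifeSlope_pos (ha : 0 < a) {x : ℝ} (hx : 0 ≤ x) : 0 < cycleLifeSlope a x := by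
  have := log_ten_pos
  unfold cycleLifeSlope
  positivity

theorem tangent_add_sq_le_cycleLife (ha : 0 < a) {x y : ℝ} (hx0 : 0 ≤ x) (hx1 : x ≤ 1)
    (hy0 : 0 ≤ y) (hy1 : y ≤ 1) :
    cycleLife a x + cycleLifeSlope a x * (y - x) + curvLower a / 2 * (y - x) ^ 2
      ≤ cycleLife a y :=
  tangent_add_sq_le (convex_Icc 0 1) (fun z _ => hasDerivAt_cycleLife a z)
    (fun _ hs _ ht hst => le_cycleLifeSlope_sub ha hs.1 hst ht.2) ⟨hx0, hx1⟩ ⟨hy0, hy1⟩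

theorem cycleLife_sub_le (ha : 0 < a) {x y : ℝ} (hx0 : 0 ≤ x) (hx1 : x ≤ 1) (hy0 : 0 ≤ y)
    (hy1 : y ≤ 1) : cycleLife a y - cycleLife a x ≤ cycleLifeSlope a y * (y - x) := by
  have htangent := tangent_add_sq_le_cycleLife ha hy0 hy1 hx0 hx1
  have hsq : 0 ≤ curvLower a / 2 * (x - y) ^ 2 := by have := curvLower_pos ha; positivity
  linarith

theorem cycleLife_mono (ha : 0 < a) {x y : ℝ} (hx : 0 ≤ x) (hxy : x ≤ y) (hy : y ≤ 1) :
    cycleLife a x ≤ cycleLife a y := by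
  have htangent := tangent_add_sq_le_cycleLife ha hx (hxy.trans hy) (hx.trans hxy) hy
  have hlin := mul_nonneg (cycleLifeSlope_pos ha hx).le (sub_nonneg.2 hxy)
  have hsq : 0 ≤ curvLower a / 2 * (y - x) ^ 2 := by have := curvLower_pos ha; positivity
  linarith

theorem le_cycleLifeCurv_sub (ha : 0 < a) {x y : ℝ} (hx : 0 ≤ x) (hxy : x ≤ y) (hy : y ≤ 1) :
    jerkLower a * (y - x) ≤ cycleLifeCurv a y - cycleLifeCurv a x := by
  have : 0 < a * Real.log 10 := mul_pos ha log_ten_pos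
  refine mul_sub_le_image_sub_of_le_hasDerivAt (convex_Icc 0 1)
    (fun z _ => hasDerivAt_cycleLifeCurv a z) ?_ ⟨hx, hxy.trans hy⟩ ⟨hx.trans hxy, hy⟩ hxy
  rintro z ⟨hz0, -⟩
  exact mul_le_mul (le_ten_rpow ha hz0) (le_add_of_nonneg_right (by positivity)) (by positivity)
    (by positivity)

theorem le_cycleLifeSlope_add_sub_sub (ha : 0 < a) {x y η : ℝ} (hη : 0 ≤ η) (hx : 0 ≤ x)
    (hxy : x ≤ y) (hy : y + η ≤ 1) :
    jerkLower a * η * (y - x) ≤ (cycleLifeSlope a (y + η) - cycleLifeSlope a y)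
      - (cycleLifeSlope a (x + η) - cycleLifeSlope a x) := by
  refine mul_sub_le_image_sub_of_le_hasDerivAt (convex_Icc 0 (1 - η))
    (f := fun s => cycleLifeSlope a (s + η) - cycleLifeSlope a s)
    (fun s _ => ((hasDerivAt_cycleLifeSlope a (s + η)).comp_add_const s η).sub
      (hasDerivAt_cycleLifeSlope a s)) ?_ ⟨hx, by linarith⟩ ⟨hx.trans hxy, by linarith⟩ hxy
  rintro s ⟨hs0, hs1⟩
  simpa only [add_sub_cancel_left] using
    le_cycleLifeCurv_sub ha hs0 (le_add_of_nonneg_right hη) (by linarith)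

theorem tangent_add_sq_le_cycleLife_sub (ha : 0 < a) {x y η : ℝ} (hη : 0 ≤ η) (hx0 : 0 ≤ x)
    (hx1 : x + η ≤ 1) (hy0 : 0 ≤ y) (hy1 : y + η ≤ 1) :
    cycleLife a (x + η) - cycleLife a x
      + (cycleLifeSlope a (x + η) - cycleLifeSlope a x) * (y - x)
      + jerkLower a * η / 2 * (y - x) ^ 2 ≤ cycleLife a (y + η) - cycleLife a y :=
  tangent_add_sq_le (convex_Icc 0 (1 - η)) (f := fun s => cycleLife a (s + η) - cycleLife a s)
    (fun s _ => ((hasDerivAt_cycleLife a (s + η)).comp_add_const s η).sub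
      (hasDerivAt_cycleLife a s))
    (fun _ hs _ ht hst => le_cycleLifeSlope_add_sub_sub ha hη hs.1 hst (by linarith [ht.2]))
    ⟨hx0, by linarith⟩ ⟨hy0, by linarith⟩

theorem cycleLife_sub_mono (ha : 0 < a) {x y η : ℝ} (hη : 0 ≤ η) (hx0 : 0 ≤ x)
    (hxy : x ≤ y) (hy1 : y + η ≤ 1) :
    cycleLife a (x + η) - cycleLife a x ≤ cycleLife a (y + η) - cycleLife a y := by
  have htangent := tangent_add_sq_le_cycleLife_sub ha hη hx0 (by linarith) (hx0.trans hxy) hy1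
  have hslope := cycleLifeSlope_mono ha hx0 (le_add_of_nonneg_right hη) (by linarith)
  have hlin := mul_nonneg (sub_nonneg.2 hslope) (sub_nonneg.2 hxy)
  have hsq : 0 ≤ jerkLower a * η / 2 * (y - x) ^ 2 := by have := jerkLower_pos ha; positivity
  linarith

end Bounds

theorem sum_mul_cycleLifeSlope_add {ι : Type*} (a : ℝ) (s : Finset ι) (ε b : ι → ℝ) (q : ℝ) :
    ∑ i ∈ s, ε i * cycleLifeSlope a (b i + q) = (10 : ℝ) ^ (a * q) *
      ((∑ i ∈ s, ε i * cycleLifeSlope a (b i)) +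
        (a * Real.log 10 * ∑ i ∈ s, ε i * (10 : ℝ) ^ (a * (b i - 1))) * q) := by
  rw [Finset.mul_sum, Finset.sum_mul, ← Finset.sum_add_distrib, Finset.mul_sum]
  refine Finset.sum_congr rfl fun i _ => ?_
  have hexp :
      (10 : ℝ) ^ (a * (b i + q - 1)) = (10 : ℝ) ^ (a * q) * (10 : ℝ) ^ (a * (b i - 1)) := by
    rw [← Real.rpow_add (by norm_num)]
    congr 1
    ring
  rw [cycleLifeSlope, cycleLifeSlope, hexp]
  ring

theorem eventually_mul_sum_le_sq {ι : Type*} (a : ℝ) (s : Finset ι) (ε b : ι → ℝ) :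
    ∀ᶠ γ in 𝓝[>] (0 : ℝ), ∀ q : ℝ, |q| ≤ γ →
      γ * ∑ i ∈ s, ε i * (cycleLife a (b i + q) - cycleLife a (b i))
        ≤ (∑ i ∈ s, ε i * cycleLifeSlope a (b i + q)) ^ 2 := by
  refine eventually_mul_le_sq_of_eq_mul_add (g := fun q => (10 : ℝ) ^ (a * q))
    (fun q => ?_) ?_ ?_ ?_ (sum_mul_cycleLifeSlope_add a s ε b)
  · exact HasDerivAt.fun_sum fun i _ => (((hasDerivAt_cycleLife a (b i + q)).comp_const_add
      (b i) q).sub_const _).const_mul _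
  · simp only [add_zero, sub_self, mul_zero, Finset.sum_const_zero]
  · exact (Continuous.rpow continuous_const (continuous_const_mul a)
      fun _ => .inl (by norm_num)).continuousAt
  · rw [mul_zero, Real.rpow_zero]

/-! ### Chains of depths -/

/-- The scheduling problem in terms of the depths alone: a chain `y 0, y 1, …, y (2 * J)` of depths
whose increments buy time. Steps with even index are the sunlight periods, steps with odd index the
eclipses. Sequences are indexed by all of `ℕ`, but only the entries up to `2 * J` matter. -/
structure DepthChain where
  /-- number of periods -/
  J : ℕ
  /-- battery constant -/
  a : ℝ
  /-- initial depth -/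
  base : ℝ
  /-- least increments -/
  lo : ℕ → ℝ
  /-- increments from which on no more time is gained -/
  hi : ℕ → ℝ
  /-- the time needed -/
  T : ℝ
  a_pos : 0 < a
  lo_nonneg : ∀ i < 2 * J, i % 2 = 1 → 0 ≤ lo i
  lo_le_hi : ∀ i < 2 * J, lo i ≤ hi i

/-- The increment of a sequence in step `i`. -/
def inc (y : ℕ → ℝ) (i : ℕ) : ℝ := y (i + 1) - y i

/-- The sequence obtained by adding `τ` to the entries with index in `(p, r]`; only the increments
in the steps `p` and `r` change. -/
noncomputable def shiftIoc (y : ℕ → ℝ) (p r : ℕ) (τ : ℝ) (i : ℕ) : ℝ :=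
  y i + if p < i ∧ i ≤ r then τ else 0

theorem inc_smul_add_smul (y₁ y₂ : ℕ → ℝ) (s t : ℝ) (i : ℕ) :
    inc (s • y₁ + t • y₂) i = s • inc y₁ i + t • inc y₂ i := by
  simp only [inc, Pi.add_apply, Pi.smul_apply, smul_eq_mul]
  ring

section ShiftIoc

variable {y : ℕ → ℝ} {p r i : ℕ} {τ : ℝ}

theorem shiftIoc_of_mem (hp : p < i) (hr : i ≤ r) : shiftIoc y p r τ i = y i + τ := by
  rw [shiftIoc, if_pos ⟨hp, hr⟩]

theorem shiftIoc_of_notMem (h : ¬(p < i ∧ i ≤ r)) : shiftIoc y p r τ i = y i := by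
  rw [shiftIoc, if_neg h, add_zero]

theorem inc_shiftIoc_left (hpr : p < r) : inc (shiftIoc y p r τ) p = inc y p + τ := by
  rw [inc, shiftIoc_of_mem (by omega) hpr, shiftIoc_of_notMem (by omega), inc]
  ring

theorem inc_shiftIoc_right (hpr : p < r) : inc (shiftIoc y p r τ) r = inc y r - τ := by
  rw [inc, shiftIoc_of_notMem (by omega), shiftIoc_of_mem hpr le_rfl, inc]
  ring

theorem inc_shiftIoc_of_ne (hp : i ≠ p) (hr : i ≠ r) : inc (shiftIoc y p r τ) i = inc y i := by
  by_cases h : p < i ∧ i ≤ r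
  · rw [inc, shiftIoc_of_mem (by omega) (by omega), shiftIoc_of_mem h.1 h.2, inc]
    ring
  · rw [inc, shiftIoc_of_notMem (by omega), shiftIoc_of_notMem h, inc]

end ShiftIoc

namespace DepthChain

variable (c : DepthChain)

/-- The time bought by a sequence. -/
noncomputable def time (y : ℕ → ℝ) : ℝ :=
  ∑ i ∈ Finset.range (2 * c.J), (min (inc y i) (c.hi i) - c.lo i)

/-- All constraints but the one on the total time. -/
structure IsAdmissible (y : ℕ → ℝ) : Prop where
  base : y 0 = c.base
  lo : ∀ i < 2 * c.J, c.lo i ≤ inc y i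
  hi : ∀ i < 2 * c.J, i % 2 = 1 → inc y i ≤ c.hi i
  nonneg : ∀ i < 2 * c.J, 0 ≤ y (i + 1)
  le_one : ∀ i < 2 * c.J, y (i + 1) ≤ 1

/-- The value of the linear form with coefficients `g` at the displacement from `y` to `y'`. -/
noncomputable def linForm (g y y' : ℕ → ℝ) : ℝ :=
  ∑ i ∈ Finset.range (2 * c.J), g (i + 1) * (y' (i + 1) - y (i + 1))

/-- The objective: life consumed at the ends minus life consumed at the starts of eclipses. -/
noncomputable def objective (y : ℕ → ℝ) : ℝ :=
  ∑ i ∈ Finset.range (2 * c.J), (-1) ^ (i + 1) * cycleLife c.a (y (i + 1))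

/-- `y` satisfies the first-order condition with a gradient `g` that may differ by `ω` from that of
the objective in the entries coming from `v`. -/
structure IsNearCritical (y g : ℕ → ℝ) (ω : ℝ) : Prop where
  adm : c.IsAdmissible y
  time_ge : c.T ≤ c.time y
  vi : ∀ y', c.IsAdmissible y' → c.T ≤ c.time y' → 0 ≤ c.linForm g y y'
  ω_nonneg : 0 ≤ ω
  odd_step : ∀ i < 2 * c.J, i % 2 = 1 → g (i + 1) = cycleLifeSlope c.a (y (i + 1))
  even_step : ∀ i < 2 * c.J, i % 2 = 0 → |g (i + 1) + cycleLifeSlope c.a (y (i + 1))| ≤ ω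

/-- `y` minimizes the objective, even if the total time is left free. -/
def IsGlobalMin (y : ℕ → ℝ) : Prop := ∀ y', c.IsAdmissible y' → c.objective y ≤ c.objective y'

/-- Time costs at most `p` per unit: saving `ε` of it improves the linearized objective by at most
`p * ε`. -/
def TimePriceLE (y g : ℕ → ℝ) (p : ℝ) : Prop :=
  ∀ y' ε, 0 ≤ ε → c.IsAdmissible y' → c.T - ε ≤ c.time y' → -(p * ε) ≤ c.linForm g y y'

/-- All positive slacks of `y` are at least `γ`. -/
structure HasSlackGap (y : ℕ → ℝ) (γ : ℝ) : Prop where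
  pos : 0 < γ
  nonneg : ∀ i < 2 * c.J, 0 < y (i + 1) → γ ≤ y (i + 1)
  le_one : ∀ i < 2 * c.J, y (i + 1) < 1 → γ ≤ 1 - y (i + 1)
  lo : ∀ i < 2 * c.J, c.lo i < inc y i → γ ≤ inc y i - c.lo i
  hi : ∀ i < 2 * c.J, inc y i < c.hi i → γ ≤ c.hi i - inc y i
  hi' : ∀ i < 2 * c.J, c.hi i < inc y i → γ ≤ inc y i - c.hi i

theorem eventually_hasSlackGap (y : ℕ → ℝ) : ∀ᶠ γ in 𝓝[>] (0 : ℝ), c.HasSlackGap y γ := by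
  have hgap := eventually_nhdsGT_forall_le_of_pos (Set.finite_Iio (2 * c.J))
  filter_upwards [self_mem_nhdsWithin, hgap fun i => y (i + 1), hgap fun i => 1 - y (i + 1),
    hgap fun i => inc y i - c.lo i, hgap fun i => c.hi i - inc y i,
    hgap fun i => inc y i - c.hi i] with γ hγ h0 h1 hlo hhi hhi'
  exact ⟨hγ, h0, fun i hi h => h1 i hi (sub_pos.2 h), fun i hi h => hlo i hi (sub_pos.2 h),
    fun i hi h => hhi i hi (sub_pos.2 h), fun i hi h => hhi' i hi (sub_pos.2 h)⟩

theorem exists_hasSlackGap (y : ℕ → ℝ) : ∃ γ, c.HasSlackGap y γ :=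
  (c.eventually_hasSlackGap y).exists

theorem convex_setOf_isAdmissible : Convex ℝ {y | c.IsAdmissible y} := by
  intro y₁ h₁ y₂ h₂ s t hs ht hst
  refine ⟨convex_singleton c.base h₁.base h₂.base hs ht hst, fun i hi => ?_, fun i hi ho => ?_,
    fun i hi => convex_Ici (0 : ℝ) (h₁.nonneg i hi) (h₂.nonneg i hi) hs ht hst,
    fun i hi => convex_Iic (1 : ℝ) (h₁.le_one i hi) (h₂.le_one i hi) hs ht hst⟩
  · rw [inc_smul_add_smul]
    exact convex_Ici (c.lo i) (h₁.lo i hi) (h₂.lo i hi) hs ht hst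
  · rw [inc_smul_add_smul]
    exact convex_Iic (c.hi i) (h₁.hi i hi ho) (h₂.hi i hi ho) hs ht hst

theorem concaveOn_time : ConcaveOn ℝ Set.univ c.time := by
  refine ⟨convex_univ, fun y₁ _ y₂ _ s t hs ht hst => ?_⟩
  rw [time, time, time, Finset.smul_sum, Finset.smul_sum, ← Finset.sum_add_distrib]
  refine Finset.sum_le_sum fun i _ => ?_
  have hmin := ((concaveOn_id convex_univ).inf (concaveOn_const (c.hi i) convex_univ)).2
    (Set.mem_univ (inc y₁ i)) (Set.mem_univ (inc y₂ i)) hs ht hst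
  have hlo : s * c.lo i + t * c.lo i = c.lo i := by rw [← add_mul, hst, one_mul]
  simp only [inc_smul_add_smul, Pi.inf_apply, id, smul_eq_mul, mul_sub] at hmin ⊢
  linarith

theorem linForm_smul_add_smul (g y y₁ y₂ : ℕ → ℝ) {s t : ℝ} (hst : s + t = 1) :
    c.linForm g y (s • y₁ + t • y₂) = s * c.linForm g y y₁ + t * c.linForm g y y₂ := by
  rw [linForm, linForm, linForm, Finset.mul_sum, Finset.mul_sum, ← Finset.sum_add_distrib]
  refine Finset.sum_congr rfl fun i _ => ?_
  obtain rfl : t = 1 - s := by linarith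
  simp only [Pi.add_apply, Pi.smul_apply, smul_eq_mul]
  ring

theorem objective_eq_sum_pairs (y : ℕ → ℝ) :
    c.objective y = ∑ j ∈ Finset.range c.J,
      (cycleLife c.a (y (2 * j + 2)) - cycleLife c.a (y (2 * j + 1))) := by
  rw [objective, sum_range_two_mul]
  refine Finset.sum_congr rfl fun j _ => ?_
  rw [Odd.neg_one_pow ⟨j, rfl⟩, Even.neg_one_pow ⟨j + 1, by ring⟩]
  ring

variable {c} {y y₁ y₂ g : ℕ → ℝ} {ω γ : ℝ}

theorem IsNearCritical.mix {ε₁ ε₂ : ℝ} (h : c.IsNearCritical y g ω)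
    (h₁ : c.IsAdmissible y₁) (h₂ : c.IsAdmissible y₂) (hε₁ : 0 < ε₁) (hε₂ : 0 ≤ ε₂)
    (ht₁ : c.T + ε₁ ≤ c.time y₁) (ht₂ : c.T - ε₂ ≤ c.time y₂) :
    0 ≤ ε₂ * c.linForm g y y₁ + ε₁ * c.linForm g y y₂ := by
  have hpos : 0 < ε₂ + ε₁ := by linarith
  have hs : 0 ≤ ε₂ / (ε₂ + ε₁) := by positivity
  have ht : 0 ≤ ε₁ / (ε₂ + ε₁) := by positivity
  have hst : ε₂ / (ε₂ + ε₁) + ε₁ / (ε₂ + ε₁) = 1 := by rw [← add_div, div_self hpos.ne']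
  -- The convex combination balances the time gained along `y₁` against the time lost along `y₂`.
  have htime : c.T ≤ c.time ((ε₂ / (ε₂ + ε₁)) • y₁ + (ε₁ / (ε₂ + ε₁)) • y₂) :=
    calc c.T = ε₂ / (ε₂ + ε₁) * (c.T + ε₁) + ε₁ / (ε₂ + ε₁) * (c.T - ε₂) := by field_simp; ring
      _ ≤ ε₂ / (ε₂ + ε₁) * c.time y₁ + ε₁ / (ε₂ + ε₁) * c.time y₂ := by gcongr
      _ ≤ _ := c.concaveOn_time.2 trivial trivial hs ht hst
  have hvi := h.vi _ (c.convex_setOf_isAdmissible h₁ h₂ hs ht hst) htime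
  rw [c.linForm_smul_add_smul g y y₁ y₂ hst, div_mul_eq_mul_div, div_mul_eq_mul_div,
    ← add_div] at hvi
  simpa only [zero_mul] using (le_div_iff₀ hpos).1 hvi

theorem IsNearCritical.timePriceLE {p ε : ℝ} (h : c.IsNearCritical y g ω)
    (h₁ : c.IsAdmissible y₁) (hε : 0 < ε) (ht₁ : c.T + ε ≤ c.time y₁)
    (hp : c.linForm g y y₁ ≤ p * ε) : c.TimePriceLE y g p := by
  intro y' ε' hε' h' ht'
  have hmix := h.mix h₁ h' hε hε' ht₁ ht'
  have hcost := mul_le_mul_of_nonneg_left hp hε'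
  have hprod : 0 ≤ ε * (p * ε' + c.linForm g y y') := by linarith
  linarith [nonneg_of_mul_nonneg_right hprod hε]

section Shift

variable {p r : ℕ} {τ : ℝ}

theorem IsAdmissible.shiftIoc (h : c.IsAdmissible y) (hpr : p < r) (hlop : c.lo p ≤ inc y p + τ)
    (hhip : p % 2 = 1 → inc y p + τ ≤ c.hi p) (hlor : r < 2 * c.J → c.lo r ≤ inc y r - τ)
    (hhir : r < 2 * c.J → r % 2 = 1 → inc y r - τ ≤ c.hi r)
    (h0 : ∀ i, p ≤ i → i < r → 0 ≤ y (i + 1) + τ) (h1 : ∀ i, p ≤ i → i < r → y (i + 1) + τ ≤ 1) :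
    c.IsAdmissible (shiftIoc y p r τ) where
  base := by rw [shiftIoc_of_notMem (by omega), h.base]
  lo i hi := by
    obtain rfl | hp := eq_or_ne i p
    · rwa [inc_shiftIoc_left hpr]
    obtain rfl | hr := eq_or_ne i r
    · exact inc_shiftIoc_right hpr ▸ hlor hi
    exact (inc_shiftIoc_of_ne hp hr).symm ▸ h.lo i hi
  hi i hi ho := by
    obtain rfl | hp := eq_or_ne i p
    · exact inc_shiftIoc_left hpr ▸ hhip ho
    obtain rfl | hr := eq_or_ne i r
    · exact inc_shiftIoc_right hpr ▸ hhir hi ho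
    exact (inc_shiftIoc_of_ne hp hr).symm ▸ h.hi i hi ho
  nonneg i hi := by
    by_cases hmem : p < i + 1 ∧ i + 1 ≤ r
    · exact shiftIoc_of_mem (τ := τ) hmem.1 hmem.2 ▸ h0 i (by omega) (by omega)
    · exact shiftIoc_of_notMem hmem ▸ h.nonneg i hi
  le_one i hi := by
    by_cases hmem : p < i + 1 ∧ i + 1 ≤ r
    · exact shiftIoc_of_mem (τ := τ) hmem.1 hmem.2 ▸ h1 i (by omega) (by omega)
    · exact shiftIoc_of_notMem hmem ▸ h.le_one i hi

theorem linForm_shiftIoc (hr : r ≤ 2 * c.J) :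
    c.linForm g y (shiftIoc y p r τ) = τ * ∑ i ∈ Finset.Ico p r, g (i + 1) := by
  have hIco : Finset.Ico p r = (Finset.range (2 * c.J)).filter fun i => p ≤ i ∧ i < r := by
    ext i
    simp only [Finset.mem_Ico, Finset.mem_filter, Finset.mem_range]
    omega
  rw [linForm, hIco, Finset.sum_filter, Finset.mul_sum]
  refine Finset.sum_congr rfl fun i _ => ?_
  by_cases h : p ≤ i ∧ i < r
  · rw [if_pos h, shiftIoc_of_mem (by omega) (by omega)]
    ring
  · rw [if_neg h, shiftIoc_of_notMem (by omega)]
    ring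

theorem add_le_time_shiftIoc (hpr : p < r) (hr : r ≤ 2 * c.J) {A B : ℝ}
    (hA : min (inc y p) (c.hi p) + A ≤ min (inc y p + τ) (c.hi p))
    (hB : r < 2 * c.J → min (inc y r) (c.hi r) + B ≤ min (inc y r - τ) (c.hi r))
    (hB' : r = 2 * c.J → B ≤ 0) :
    c.time y + A + B ≤ c.time (shiftIoc y p r τ) := by
  have hA_eq : A = ∑ i ∈ Finset.range (2 * c.J), if i = p then A else 0 := by
    rw [Finset.sum_ite_eq', if_pos (Finset.mem_range.2 (by omega))]
  have hB_le : B ≤ ∑ i ∈ Finset.range (2 * c.J), if i = r then B else 0 := by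
    rw [Finset.sum_ite_eq']
    split_ifs with h
    · exact le_rfl
    · exact hB' (by rw [Finset.mem_range] at h; omega)
  have hsum : c.time y + (∑ i ∈ Finset.range (2 * c.J), if i = p then A else 0)
      + (∑ i ∈ Finset.range (2 * c.J), if i = r then B else 0) ≤ c.time (shiftIoc y p r τ) := by
    rw [time, time, ← Finset.sum_add_distrib, ← Finset.sum_add_distrib]
    refine Finset.sum_le_sum fun i hi => ?_
    obtain rfl | hp := eq_or_ne i p
    · rw [if_pos rfl, if_neg hpr.ne, inc_shiftIoc_left hpr]
      linarith
    obtain rfl | hr := eq_or_ne i r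
    · rw [if_pos rfl, if_neg hp, inc_shiftIoc_right hpr]
      linarith [hB (Finset.mem_range.1 hi)]
    rw [inc_shiftIoc_of_ne hp hr, if_neg hp, if_neg hr]
    linarith
  linarith

theorem time_sub_le_time_shiftIoc_neg (hpr : p < r) (hr : r ≤ 2 * c.J) (hγ : 0 ≤ γ) :
    c.time y - γ ≤ c.time (shiftIoc y p r (-γ)) := by
  rw [← add_zero (c.time y - γ), sub_eq_add_neg]
  refine add_le_time_shiftIoc hpr hr ?_ (fun _ => ?_) fun _ => le_rfl
  · rw [← min_add_add_right]
    exact min_le_min_left _ (by linarith)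
  · rw [add_zero]
    exact min_le_min_right _ (by linarith)

theorem TimePriceLE.sum_le {q : ℝ} (hq : c.TimePriceLE y g q) (hT : c.T ≤ c.time y) (hpr : p < r)
    (hr : r ≤ 2 * c.J) (hγ : 0 < γ) (hadm : c.IsAdmissible (shiftIoc y p r (-γ))) :
    ∑ i ∈ Finset.Ico p r, g (i + 1) ≤ q := by
  have htime := time_sub_le_time_shiftIoc_neg (c := c) (y := y) hpr hr hγ.le
  have hprice := hq _ γ hγ.le hadm (by linarith)
  rw [linForm_shiftIoc hr] at hprice
  have hprod : 0 ≤ γ * (q - ∑ i ∈ Finset.Ico p r, g (i + 1)) := by linarith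
  exact sub_nonneg.1 (nonneg_of_mul_nonneg_right hprod hγ)

end Shift

theorem IsAdmissible.le_succ (h : c.IsAdmissible y) {i : ℕ} (hi : i < 2 * c.J) (ho : i % 2 = 1) :
    y i ≤ y (i + 1) :=
  sub_nonneg.1 ((c.lo_nonneg i hi ho).trans (h.lo i hi))

theorem IsAdmissible.nonneg' (h : c.IsAdmissible y) {i : ℕ} (hi : i ≤ 2 * c.J) (h0 : i ≠ 0) :
    0 ≤ y i := by
  obtain ⟨k, rfl⟩ := Nat.exists_eq_succ_of_ne_zero h0
  exact h.nonneg k (by omega)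

theorem IsAdmissible.le_one' (h : c.IsAdmissible y) {i : ℕ} (hi : i ≤ 2 * c.J) (h0 : i ≠ 0) :
    y i ≤ 1 := by
  obtain ⟨k, rfl⟩ := Nat.exists_eq_succ_of_ne_zero h0
  exact h.le_one k (by omega)

theorem IsAdmissible.cycleLifeSlope_le_succ (h : c.IsAdmissible y) {i : ℕ} (hi : i < 2 * c.J)
    (ho : i % 2 = 1) : cycleLifeSlope c.a (y i) ≤ cycleLifeSlope c.a (y (i + 1)) :=
  cycleLifeSlope_mono c.a_pos (h.nonneg' hi.le (by omega)) (h.le_succ hi ho) (h.le_one i hi)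

theorem IsNearCritical.slope_sub_le_pair (h : c.IsNearCritical y g ω) {k : ℕ} (hk : k < c.J) :
    cycleLifeSlope c.a (y (2 * k + 2)) - cycleLifeSlope c.a (y (2 * k + 1)) - ω
      ≤ g (2 * k + 1) + g (2 * k + 1 + 1) := by
  have heven := (abs_le.1 (h.even_step (2 * k) (by omega) (by omega))).1
  rw [h.odd_step (2 * k + 1) (by omega) (by omega)]
  linarith

theorem IsNearCritical.sum_pairs_le (h : c.IsNearCritical y g ω) {α β j : ℕ} (hβ : β ≤ c.J)
    (hj : α ≤ j) (hj' : j < β) :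
    cycleLifeSlope c.a (y (2 * j + 2)) - cycleLifeSlope c.a (y (2 * j + 1)) - 2 * c.J * ω
      ≤ ∑ i ∈ Finset.Ico (2 * α) (2 * β), g (i + 1) := by
  rw [sum_Ico_two_mul _ (by omega : α ≤ β)]
  have hpair : ∀ k ∈ Finset.Ico α β, (if k = j then
      (cycleLifeSlope c.a (y (2 * j + 2)) - cycleLifeSlope c.a (y (2 * j + 1))) else 0) - ω
      ≤ g (2 * k + 1) + g (2 * k + 1 + 1) := by
    intro k hk
    rw [Finset.mem_Ico] at hk
    refine le_trans ?_ (h.slope_sub_le_pair (by omega : k < c.J))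
    split_ifs with hkj
    · rw [hkj]
    · linarith [h.adm.cycleLifeSlope_le_succ (i := 2 * k + 1) (by omega) (by omega)]
  refine le_trans ?_ (Finset.sum_le_sum hpair)
  rw [Finset.sum_sub_distrib, Finset.sum_ite_eq', if_pos (Finset.mem_Ico.2 ⟨hj, hj'⟩),
    Finset.sum_const, Nat.card_Ico, nsmul_eq_mul]
  have hcard : ((β - α : ℕ) : ℝ) ≤ 2 * c.J := by
    exact_mod_cast (by omega : β - α ≤ 2 * c.J)
  gcongr
  exact h.ω_nonneg

theorem IsNearCritical.neg_le_sum_pairs (h : c.IsNearCritical y g ω) {α β : ℕ} (hβ : β ≤ c.J) :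
    -(2 * c.J * ω) ≤ ∑ i ∈ Finset.Ico (2 * α) (2 * β), g (i + 1) := by
  rcases lt_or_ge α β with hαβ | hβα
  · have := h.adm.cycleLifeSlope_le_succ (i := 2 * α + 1) (by omega) (by omega)
    linarith [h.sum_pairs_le hβ le_rfl hαβ]
  · rw [Finset.Ico_eq_empty (by omega), Finset.sum_empty, neg_nonpos]
    have := h.ω_nonneg
    positivity

/-! ### Cheap time -/

theorem TimePriceLE.cycleLifeSlope_le {q : ℝ} (hy : c.IsAdmissible y) (hT : c.T ≤ c.time y)
    (hq : c.TimePriceLE y g q) {i : ℕ} (hi : i < 2 * c.J) (ho : i % 2 = 1)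
    (hlt : c.lo i < inc y i) : g (i + 1) ≤ q := by
  have h0 : 0 ≤ y i := hy.nonneg' hi.le (by omega)
  have hlo := c.lo_nonneg i hi ho
  have hadm : c.IsAdmissible (shiftIoc y i (i + 1) (-(inc y i - c.lo i))) := by
    refine hy.shiftIoc (by omega) (by linarith) (fun _ => ?_) (fun hr => ?_) (fun _ h => by omega)
      (fun k hik hki => ?_) (fun k hik hki => ?_)
    · linarith [c.lo_le_hi i hi]
    · linarith [hy.lo (i + 1) hr]
    · obtain rfl : k = i := by omega
      simp only [inc]
      linarith
    · obtain rfl : k = i := by omega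
      linarith [hy.le_one k hi]
  simpa only [Nat.Ico_succ_singleton, Finset.sum_singleton] using
    hq.sum_le hT (by omega) (by omega) (sub_pos.2 hlt) hadm

section CheapTime

variable {p : ℝ}

theorem IsNearCritical.inc_eq_lo (h : c.IsNearCritical y g ω) (hc : c.TimePriceLE y g p)
    (hp : p < cycleLifeSlope c.a 0) {i : ℕ} (hi : i < 2 * c.J) (ho : i % 2 = 1) :
    inc y i = c.lo i := by
  by_contra hne
  have hslope := hc.cycleLifeSlope_le h.adm h.time_ge hi ho (lt_of_le_of_ne' (h.adm.lo i hi) hne)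
  rw [h.odd_step i hi ho] at hslope
  linarith [cycleLifeSlope_mono c.a_pos le_rfl (h.adm.nonneg i hi) (h.adm.le_one i hi)]

theorem exists_le_and_forall_lt {y y' : ℕ → ℝ} {n : ℕ} (h0 : y 0 ≤ y' 0) (hn : y' n < y n) :
    ∃ q < n, y q ≤ y' q ∧ ∀ i, q < i → i ≤ n → y' i < y i := by
  induction n with
  | zero => exact absurd hn h0.not_gt
  | succ n ih =>
    by_cases hle : y n ≤ y' n
    · refine ⟨n, n.lt_succ_self, hle, fun i hni hin => ?_⟩
      rwa [show i = n + 1 by omega]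
    · obtain ⟨q, hqn, hq, hlt⟩ := ih (not_le.1 hle)
      refine ⟨q, by omega, hq, fun i hqi hin => ?_⟩
      obtain rfl | hi := eq_or_ne i (n + 1)
      · exact hn
      · exact hlt i hqi (by omega)

/-- Otherwise the block of depths of `y` that exceed those of `y'` could be lowered, and the eclipse
at its end would yield more than the time is worth. -/
theorem IsNearCritical.le_of_timePriceLE (h : c.IsNearCritical y g ω) (hc : c.TimePriceLE y g p)
    (hp : p < cycleLifeSlope c.a 0) (hω : 2 * c.J * ω ≤ p) {y' : ℕ → ℝ} (hy' : c.IsAdmissible y')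
    {j : ℕ} (hj : j < c.J) (hlo : 2 * p < curvLower c.a * c.lo (2 * j + 1)) :
    y (2 * j + 1) ≤ y' (2 * j + 1) := by
  by_contra! hgt
  have htight := fun i => h.inc_eq_lo hc hp (i := i)
  obtain ⟨q, hqj, hq, hlt⟩ := exists_le_and_forall_lt (h.adm.base.trans hy'.base.symm).le hgt
  have hslack : c.lo q < inc y q := by
    have hlo' := hy'.lo q (by omega)
    have hlt' := hlt (q + 1) (by omega) (by omega)
    simp only [inc] at hlo' ⊢
    linarith
  have hq_even : q % 2 = 0 := by
    by_contra ho
    exact hslack.ne' (htight q (by omega) (by omega))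
  have hpos : ∀ i, q ≤ i → i < 2 * j + 2 → 0 < y (i + 1) := by
    intro i hqi hij
    have hpos_lt : ∀ k, q ≤ k → k ≤ 2 * j → 0 < y (k + 1) := fun k hqk hkj =>
      (hy'.nonneg k (by omega)).trans_lt (hlt (k + 1) (by omega) (by omega))
    rcases Nat.lt_or_ge i (2 * j + 1) with hi | hi
    · exact hpos_lt i hqi (by omega)
    · obtain rfl : i = 2 * j + 1 := by omega
      exact (hpos_lt (2 * j) (by omega) le_rfl).trans_le (h.adm.le_succ (by omega) (by omega))
  obtain ⟨γ, hγ⟩ := c.exists_hasSlackGap y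
  have hadm : c.IsAdmissible (shiftIoc y q (2 * j + 2) (-γ)) := by
    have := hγ.pos
    refine h.adm.shiftIoc (by omega) (by linarith [hγ.lo q (by omega) hslack])
      (fun _ => by omega) (fun hr => by linarith [h.adm.lo _ hr]) (fun _ _ => by omega)
      (fun k hqk hkj => by linarith [hγ.nonneg k (by omega) (hpos k hqk hkj)])
      (fun k _ hkj => by linarith [h.adm.le_one k (by omega)])
  have hsum_le := hc.sum_le h.time_ge (by omega) (by omega) hγ.pos hadm
  obtain ⟨α, rfl⟩ : ∃ α, q = 2 * α := ⟨q / 2, by omega⟩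
  have hle_sum := h.sum_pairs_le (α := α) (β := j + 1) (j := j) (by omega) (by omega) (by omega)
  have hslope := le_cycleLifeSlope_sub c.a_pos (h.adm.nonneg (2 * j) (by omega))
    (h.adm.le_succ (i := 2 * j + 1) (by omega) (by omega)) (h.adm.le_one (2 * j + 1) (by omega))
  have hinc : y (2 * j + 1 + 1) - y (2 * j + 1) = c.lo (2 * j + 1) :=
    htight (2 * j + 1) (by omega) (by omega)
  rw [hinc] at hslope
  rw [show 2 * (j + 1) = 2 * j + 2 by ring] at hle_sum
  linarith

theorem IsNearCritical.isGlobalMin (h : c.IsNearCritical y g ω) (hc : c.TimePriceLE y g p)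
    (hp : p < cycleLifeSlope c.a 0) (hω : 2 * c.J * ω ≤ p)
    (hlo : ∀ i < 2 * c.J, 0 < c.lo i → 2 * p < curvLower c.a * c.lo i) : c.IsGlobalMin y := by
  intro y' hy'
  rw [objective_eq_sum_pairs, objective_eq_sum_pairs]
  refine Finset.sum_le_sum fun j hj => ?_
  have hj : j < c.J := Finset.mem_range.1 hj
  have hlo0 := c.lo_nonneg (2 * j + 1) (by omega) (by omega)
  have hinc : y (2 * j + 2) - y (2 * j + 1) = c.lo (2 * j + 1) :=
    h.inc_eq_lo hc hp (by omega) (by omega)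
  have hinc' : c.lo (2 * j + 1) ≤ y' (2 * j + 2) - y' (2 * j + 1) := hy'.lo (2 * j + 1) (by omega)
  have h0 : 0 ≤ y' (2 * j + 1) := hy'.nonneg (2 * j) (by omega)
  have h1 : y' (2 * j + 2) ≤ 1 := hy'.le_one (2 * j + 1) (by omega)
  have hmono := cycleLife_mono c.a_pos (x := y' (2 * j + 1) + c.lo (2 * j + 1)) (by linarith)
    (by linarith) h1
  rcases hlo0.eq_or_lt with hzero | hpos
  · rw [show y (2 * j + 2) = y (2 * j + 1) by linarith, sub_self]
    rw [← hzero, add_zero] at hmono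
    linarith
  · have hle := h.le_of_timePriceLE hc hp hω hy' hj (hlo _ (by omega) hpos)
    rw [show y (2 * j + 2) = y (2 * j + 1) + c.lo (2 * j + 1) by linarith]
    linarith [cycleLife_sub_mono c.a_pos hlo0 (h.adm.nonneg (2 * j) (by omega)) hle (by linarith)]

end CheapTime

theorem exists_isGlobalMin_of_timePriceLE (c : DepthChain) :
    ∃ p > 0, ∀ y g ω, c.IsNearCritical y g ω → 2 * c.J * ω ≤ p → c.TimePriceLE y g p →
      c.IsGlobalMin y := by
  have hm := curvLower_pos c.a_pos
  have hsmall : ∀ᶠ p in 𝓝[>] (0 : ℝ), p ∈ Set.Ioo 0 (cycleLifeSlope c.a 0) :=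
    Ioo_mem_nhdsGT (cycleLifeSlope_pos c.a_pos le_rfl)
  obtain ⟨p, ⟨hp, hslope⟩, hgap⟩ := (hsmall.and <| eventually_nhdsGT_forall_le_of_pos
    (Set.finite_Iio (2 * c.J)) fun i => curvLower c.a * c.lo i / 4).exists
  refine ⟨p, hp, fun y g ω h hω hc => h.isGlobalMin hc hslope hω fun i hi hlo => ?_⟩
  have : 0 < curvLower c.a * c.lo i := mul_pos hm hlo
  linarith [hgap i hi (by positivity)]

theorem IsNearCritical.time_eq {p : ℝ} (h : c.IsNearCritical y g ω)
    (hp : ¬ c.TimePriceLE y g p) (hp0 : 0 ≤ p) : c.time y = c.T := by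
  refine le_antisymm ?_ h.time_ge
  by_contra! hlt
  refine hp (h.timePriceLE (ε := c.time y - c.T) h.adm (by linarith) (by linarith) ?_)
  have hzero : c.linForm g y y = 0 := by simp only [linForm, sub_self, mul_zero,
    Finset.sum_const_zero]
  rw [hzero]
  exact mul_nonneg hp0 (by linarith)

end DepthChain

/-! ### The price of time -/

namespace DepthChain

variable {c : DepthChain} {y g ys : ℕ → ℝ} {ω γ p : ℝ} {a r : ℕ}

/-- The increment of step `i` can be changed in both directions, at the price of time. -/
def IsHinge (c : DepthChain) (y : ℕ → ℝ) (i : ℕ) : Prop := c.lo i < inc y i ∧ inc y i < c.hi i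

/-- The entries with index in `(a, r]` can be shifted in both directions, and the shift changes
the time bought at step `a` only. -/
structure FreeEnd (c : DepthChain) (y : ℕ → ℝ) (a r : ℕ) : Prop where
  lt : a < r
  le : r ≤ 2 * c.J
  even : r % 2 = 0
  hinge : c.IsHinge y a
  cut : r < 2 * c.J → c.hi r < inc y r
  pos : ∀ i, a ≤ i → i < r → 0 < y (i + 1)
  lt_one : ∀ i, a ≤ i → i < r → y (i + 1) < 1

theorem FreeEnd.isAdmissible_and_add_le_time (hf : c.FreeEnd y a r) (hy : c.IsAdmissible y)
    (hγ : c.HasSlackGap y γ) :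
    c.IsAdmissible (shiftIoc y a r γ) ∧ c.time y + γ ≤ c.time (shiftIoc y a r γ) := by
  obtain ⟨har, hr, hre, hinge, hcut, hpos, hlt_one⟩ := hf
  have hγ0 := hγ.pos
  have hslack := hγ.hi a (by omega) hinge.2
  have hcut' : r < 2 * c.J → c.hi r ≤ inc y r - γ := fun hr' => by
    linarith [hγ.hi' r hr' (hcut hr')]
  constructor
  · exact hy.shiftIoc har (by linarith [hinge.1]) (fun _ => by linarith)
      (fun hr' => (c.lo_le_hi r hr').trans (hcut' hr')) (fun _ _ => by omega)
      (fun i hai hir => by linarith [hpos i hai hir])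
      (fun i hai hir => by linarith [hγ.le_one i (by omega) (hlt_one i hai hir)])
  · rw [← add_zero (c.time y + γ)]
    refine add_le_time_shiftIoc har hr ?_ (fun hr' => ?_) fun _ => le_rfl
    · rw [min_eq_left hinge.2.le, min_eq_left (by linarith)]
    · rw [min_eq_right (hcut hr').le, min_eq_right (hcut' hr'), add_zero]

theorem FreeEnd.isAdmissible_shiftIoc_neg (hf : c.FreeEnd y a r) (hy : c.IsAdmissible y)
    (hγ : c.HasSlackGap y γ) : c.IsAdmissible (shiftIoc y a r (-γ)) := by
  obtain ⟨har, hr, hre, hinge, -, hpos, hlt_one⟩ := hf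
  have hγ0 := hγ.pos
  have hslack := hγ.lo a (by omega) hinge.1
  exact hy.shiftIoc har (by linarith) (fun _ => by linarith [hinge.2])
    (fun hr' => by linarith [hy.lo r hr']) (fun _ _ => by omega)
    (fun i hai hir => by linarith [hγ.nonneg i (by omega) (hpos i hai hir)])
    (fun i hai hir => by linarith [hlt_one i hai hir])

theorem IsNearCritical.timePriceLE_of_freeEnd (h : c.IsNearCritical y g ω) (hT : c.time y = c.T)
    (hf : c.FreeEnd y a r) : c.TimePriceLE y g (∑ i ∈ Finset.Ico a r, g (i + 1)) := by
  obtain ⟨γ, hγ⟩ := c.exists_hasSlackGap y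
  obtain ⟨hadm, htime⟩ := hf.isAdmissible_and_add_le_time h.adm hγ
  refine h.timePriceLE hadm hγ.pos (by linarith) ?_
  rw [linForm_shiftIoc hf.le, mul_comm]

theorem TimePriceLE.sum_le_of_freeEnd (hp : c.TimePriceLE y g p) (hy : c.IsAdmissible y)
    (hT : c.T ≤ c.time y) (hf : c.FreeEnd y a r) : ∑ i ∈ Finset.Ico a r, g (i + 1) ≤ p := by
  obtain ⟨γ, hγ⟩ := c.exists_hasSlackGap y
  exact hp.sum_le hT hf.lt hf.le hγ.pos (hf.isAdmissible_shiftIoc_neg hy hγ)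

theorem TimePriceLE.mono {q : ℝ} (h : c.TimePriceLE y g q) (hqp : q ≤ p) :
    c.TimePriceLE y g p := fun y' ε hε hy' ht =>
  (neg_le_neg (mul_le_mul_of_nonneg_right hqp hε)).trans (h y' ε hε hy' ht)

/-- `t` is the price of time: it is what a unit of time costs at every free end, and no eclipse
that could be shortened buys time at a higher price. -/
structure IsPrice (c : DepthChain) (y g : ℕ → ℝ) (t : ℝ) : Prop where
  sum_eq : ∀ a r, c.FreeEnd y a r → ∑ i ∈ Finset.Ico a r, g (i + 1) = t
  slope_le : ∀ i < 2 * c.J, i % 2 = 1 → c.lo i < inc y i → cycleLifeSlope c.a (y (i + 1)) ≤ t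

/-- Time bought at any two free ends has the same price, since it could be traded otherwise. -/
theorem IsNearCritical.exists_isPrice (h : c.IsNearCritical y g ω) (hT : c.time y = c.T) :
    ∃ t, c.IsPrice y g t := by
  by_cases hex : ∃ a r, c.FreeEnd y a r
  · obtain ⟨a, r, hf⟩ := hex
    refine ⟨∑ i ∈ Finset.Ico a r, g (i + 1), fun a' r' hf' => le_antisymm ?_ ?_,
      fun i hi ho hlt => ?_⟩
    · exact (h.timePriceLE_of_freeEnd hT hf).sum_le_of_freeEnd h.adm h.time_ge hf'
    · exact (h.timePriceLE_of_freeEnd hT hf').sum_le_of_freeEnd h.adm h.time_ge hf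
    · rw [← h.odd_step i hi ho]
      exact (h.timePriceLE_of_freeEnd hT hf).cycleLifeSlope_le h.adm h.time_ge hi ho hlt
  · push Not at hex
    refine ⟨cycleLifeSlope c.a 1, fun a r hf => absurd hf (hex a r), fun i hi _ _ => ?_⟩
    exact cycleLifeSlope_mono c.a_pos (h.adm.nonneg i hi) (h.adm.le_one i hi) le_rfl

theorem IsNearCritical.sum_eq_zero_of_isHinge (h : c.IsNearCritical y g ω) (har : a < r)
    (hr : r < 2 * c.J) (ha : c.IsHinge y a) (hb : c.IsHinge y r)
    (hpos : ∀ i, a ≤ i → i < r → 0 < y (i + 1)) (hlt : ∀ i, a ≤ i → i < r → y (i + 1) < 1) :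
    ∑ i ∈ Finset.Ico a r, g (i + 1) = 0 := by
  obtain ⟨γ, hγ⟩ := c.exists_hasSlackGap y
  have hγ0 := hγ.pos
  have hshift : ∀ τ, |τ| ≤ γ → 0 ≤ τ * ∑ i ∈ Finset.Ico a r, g (i + 1) := by
    intro τ hτ
    obtain ⟨hτl, hτu⟩ := abs_le.1 hτ
    have hloa := hγ.lo a (by omega) ha.1
    have hhia := hγ.hi a (by omega) ha.2
    have hlor := hγ.lo r (by omega) hb.1
    have hhir := hγ.hi r (by omega) hb.2
    have hadm : c.IsAdmissible (shiftIoc y a r τ) :=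
      h.adm.shiftIoc har (by linarith) (fun _ => by linarith) (fun _ => by linarith)
        (fun _ _ => by linarith)
        (fun i hai hir => by linarith [hγ.nonneg i (by omega) (hpos i hai hir)])
        (fun i hai hir => by linarith [hγ.le_one i (by omega) (hlt i hai hir)])
    have htime := add_le_time_shiftIoc (c := c) (y := y) (τ := τ) (A := τ) (B := -τ) har hr.le
      (by rw [min_eq_left ha.2.le, min_eq_left (by linarith)])
      (fun _ => by rw [min_eq_left hb.2.le, min_eq_left (by linarith)]; linarith)
      (fun _ => by omega)
    rw [← linForm_shiftIoc hr.le]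
    exact h.vi _ hadm (by linarith [h.time_ge])
  have hup := hshift γ (abs_of_pos hγ0).le
  have hdown := hshift (-γ) (by rw [abs_neg, abs_of_pos hγ0])
  exact (mul_eq_zero.1 (by linarith)).resolve_left hγ0.ne'

/-- Energy is wasted in the sunlight period `a` and the battery is never full between `a` and `r`,
so that the depths in between can be lowered without losing time in step `a`. -/
structure IsCutBlock (c : DepthChain) (y : ℕ → ℝ) (a r : ℕ) : Prop where
  lt : a < r
  le : r ≤ 2 * c.J
  even : a % 2 = 0
  cut : c.hi a < inc y a
  pos : ∀ i, a ≤ i → i < r → 0 < y (i + 1)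

theorem IsCutBlock.succ (hb : c.IsCutBlock y a r) (hr : r < 2 * c.J) (hpos : 0 < y (r + 1)) :
    c.IsCutBlock y a (r + 1) where
  lt := hb.lt.trans r.lt_succ_self
  le := hr
  even := hb.even
  cut := hb.cut
  pos i hai hir := by
    rcases Nat.lt_succ_iff_lt_or_eq.1 hir with hlt | rfl
    · exact hb.pos i hai hlt
    · exact hpos

theorem isCutBlock_succ_self (ha : a < 2 * c.J) (hae : a % 2 = 0) (hcut : c.hi a < inc y a)
    (hpos : 0 < y (a + 1)) : c.IsCutBlock y a (a + 1) where
  lt := a.lt_succ_self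
  le := ha
  even := hae
  cut := hcut
  pos i hai hia := by rwa [show i = a by omega]

theorem IsCutBlock.isAdmissible_shiftIoc (hb : c.IsCutBlock y a r) (hr : r % 2 = 0)
    (hy : c.IsAdmissible y) (hγ : c.HasSlackGap y γ) : c.IsAdmissible (shiftIoc y a r (-γ)) := by
  obtain ⟨har, hle, ha, hcut, hpos⟩ := hb
  have hγ0 := hγ.pos
  have hslack := hγ.hi' a (by omega) hcut
  exact hy.shiftIoc har (by linarith [c.lo_le_hi a (by omega)]) (fun _ => by omega)
    (fun hr' => by linarith [hy.lo r hr']) (fun _ _ => by omega)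
    (fun i hai hir => by linarith [hγ.nonneg i (by omega) (hpos i hai hir)])
    (fun i _ hir => by linarith [hy.le_one i (by omega)])

theorem IsCutBlock.add_le_time_shiftIoc (hb : c.IsCutBlock y a r) (hγ : c.HasSlackGap y γ) {B : ℝ}
    (hB : r < 2 * c.J → min (inc y r) (c.hi r) + B ≤ min (inc y r + γ) (c.hi r))
    (hB' : r = 2 * c.J → B ≤ 0) : c.time y + B ≤ c.time (shiftIoc y a r (-γ)) := by
  have hslack := hγ.hi' a (by have := hb.lt; have := hb.le; omega) hb.cut
  rw [← add_zero (c.time y)]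
  refine DepthChain.add_le_time_shiftIoc hb.lt hb.le ?_ (by simpa only [sub_neg_eq_add]) hB'
  rw [min_eq_right hb.cut.le, min_eq_right (by linarith), add_zero]

theorem IsNearCritical.cycleLifeSlope_sub_le_of_cut (h : c.IsNearCritical y g ω)
    (hb : c.IsCutBlock y a r) (hr : r % 2 = 0) {i : ℕ} (hai : a ≤ i) (hir : i < r)
    (hi : i % 2 = 1) :
    cycleLifeSlope c.a (y (i + 1)) - cycleLifeSlope c.a (y i) ≤ 2 * c.J * ω := by
  obtain ⟨γ, hγ⟩ := c.exists_hasSlackGap y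
  have htime : c.time y + 0 ≤ c.time (shiftIoc y a r (-γ)) :=
    hb.add_le_time_shiftIoc hγ
      (fun _ => by rw [add_zero]; exact min_le_min_right _ (by linarith [hγ.pos])) fun _ => le_rfl
  have hvi := h.vi _ (hb.isAdmissible_shiftIoc hr h.adm hγ) (by linarith [h.time_ge])
  rw [linForm_shiftIoc hb.le, neg_mul, neg_nonneg] at hvi
  have hsum := nonpos_of_mul_nonpos_right hvi hγ.pos
  obtain ⟨har, hle, ha, -, -⟩ := hb
  obtain ⟨α, rfl⟩ : ∃ α, a = 2 * α := ⟨a / 2, by omega⟩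
  obtain ⟨β, rfl⟩ : ∃ β, r = 2 * β := ⟨r / 2, by omega⟩
  obtain ⟨j, rfl⟩ : ∃ j, i = 2 * j + 1 := ⟨i / 2, by omega⟩
  linarith [h.sum_pairs_le (α := α) (β := β) (j := j) (by omega) (by omega) (by omega)]

theorem IsNearCritical.hi_le_of_cut (h : c.IsNearCritical y g ω) (hp : ¬ c.TimePriceLE y g p)
    (hωp : 2 * c.J * ω ≤ p) (hb : c.IsCutBlock y a r) (hr : r < 2 * c.J)
    (hre : r % 2 = 0) : c.hi r ≤ inc y r := by
  by_contra! hlt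
  obtain ⟨γ, hγ⟩ := c.exists_hasSlackGap y
  have htime : c.time y + γ ≤ c.time (shiftIoc y a r (-γ)) := by
    refine hb.add_le_time_shiftIoc hγ (fun _ => ?_) fun _ => by omega
    rw [min_eq_left hlt.le, min_eq_left (by linarith [hγ.hi r hr hlt])]
  refine hp (h.timePriceLE (hb.isAdmissible_shiftIoc hre h.adm hγ) hγ.pos
    (by linarith [h.time_ge]) ?_)
  rw [linForm_shiftIoc hr.le, neg_mul_comm, mul_comm p]
  have ha := hb.even
  obtain ⟨α, rfl⟩ : ∃ α, a = 2 * α := ⟨a / 2, by omega⟩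
  obtain ⟨β, rfl⟩ : ∃ β, r = 2 * β := ⟨r / 2, by omega⟩
  refine mul_le_mul_of_nonneg_left ?_ hγ.pos.le
  linarith [h.neg_le_sum_pairs (α := α) (β := β) (by omega)]

/-- The derivative of the objective along a shift of the entries with index in `(a, r]`. -/
noncomputable def objectiveSlope (c : DepthChain) (y : ℕ → ℝ) (a r : ℕ) : ℝ :=
  ∑ i ∈ Finset.Ico a r, (-1) ^ (i + 1) * cycleLifeSlope c.a (y (i + 1))

theorem IsNearCritical.abs_objectiveSlope_sub_le (h : c.IsNearCritical y g ω)
    (hr : r ≤ 2 * c.J) :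
    |c.objectiveSlope y a r - ∑ i ∈ Finset.Ico a r, g (i + 1)| ≤ 2 * c.J * ω := by
  rw [objectiveSlope, ← Finset.sum_sub_distrib]
  have hterm : ∀ i ∈ Finset.Ico a r,
      |(-1) ^ (i + 1) * cycleLifeSlope c.a (y (i + 1)) - g (i + 1)| ≤ ω := by
    intro i hi
    rw [Finset.mem_Ico] at hi
    rcases Nat.mod_two_eq_zero_or_one i with he | ho
    · rw [Odd.neg_one_pow (Nat.odd_iff.2 (by omega)), neg_one_mul, ← abs_neg, neg_sub,
        sub_neg_eq_add]
      exact h.even_step i (by omega) he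
    · rw [Even.neg_one_pow (Nat.even_iff.2 (by omega)), one_mul, h.odd_step i (by omega) ho,
        sub_self, abs_zero]
      exact h.ω_nonneg
  refine (Finset.abs_sum_le_sum_abs _ _).trans ((Finset.sum_le_sum hterm).trans ?_)
  rw [Finset.sum_const, Nat.card_Ico, nsmul_eq_mul]
  have hcard : ((r - a : ℕ) : ℝ) ≤ 2 * c.J := by exact_mod_cast (by omega : r - a ≤ 2 * c.J)
  exact mul_le_mul_of_nonneg_right hcard h.ω_nonneg

/-! ### Blocks of depths that move together -/

/-- Change of the objective on the entries with index in `(a, r]`. -/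
noncomputable def objectiveDiff (c : DepthChain) (y ys : ℕ → ℝ) (a r : ℕ) : ℝ :=
  ∑ i ∈ Finset.Ico a r, (-1) ^ (i + 1) * (cycleLife c.a (y (i + 1)) - cycleLife c.a (ys (i + 1)))

theorem objectiveDiff_add {b : ℕ} (hab : a ≤ b) (hbr : b ≤ r) :
    c.objectiveDiff y ys a b + c.objectiveDiff y ys b r = c.objectiveDiff y ys a r :=
  Finset.sum_Ico_consecutive _ hab hbr

theorem objectiveDiff_eq_zero (h : ∀ i, a ≤ i → i < r → y (i + 1) - ys (i + 1) = 0) :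
    c.objectiveDiff y ys a r = 0 := by
  refine Finset.sum_eq_zero fun i hi => ?_
  rw [Finset.mem_Ico] at hi
  rw [sub_eq_zero.1 (h i hi.1 hi.2), sub_self, mul_zero]

/-- An almost critical point `y`, at which time is not cheap, so close to the admissible point `ys`
that all constraints active at `y` are active at `ys`. The last field is a Łojasiewicz inequality at
`ys` for the objective along shifts of a block of entries. -/
structure Nearby (c : DepthChain) (y g ys : ℕ → ℝ) (ω γ p : ℝ) : Prop where
  crit : c.IsNearCritical y g ω
  time_eq : c.time y = c.T
  not_cheap : ¬ c.TimePriceLE y g p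
  le_p : 2 * c.J * ω ≤ p
  adm : c.IsAdmissible ys
  γ_pos : 0 < γ
  small : 2 * c.J * ω < curvLower c.a * γ
  close : ∀ i < 2 * c.J, |y (i + 1) - ys (i + 1)| ≤ γ
  pos : ∀ i < 2 * c.J, y (i + 1) = 0 → ys (i + 1) = 0
  lt_one : ∀ i < 2 * c.J, y (i + 1) = 1 → ys (i + 1) = 1
  lo : ∀ i < 2 * c.J, inc y i = c.lo i → inc ys i = c.lo i
  le_hi : ∀ i < 2 * c.J, inc y i ≤ c.hi i → inc ys i ≤ c.hi i
  hi_le : ∀ i < 2 * c.J, c.hi i ≤ inc y i → c.hi i ≤ inc ys i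
  inc_pos : ∀ i < 2 * c.J, 0 < inc ys i → γ ≤ inc y i
  loj : ∀ a ≤ 2 * c.J, ∀ r ≤ 2 * c.J, ∀ q, |q| ≤ γ →
    γ * ∑ i ∈ Finset.Ico a r, (-1) ^ (i + 1) * (cycleLife c.a (ys (i + 1) + q)
      - cycleLife c.a (ys (i + 1))) ≤
    (∑ i ∈ Finset.Ico a r, (-1) ^ (i + 1) * cycleLifeSlope c.a (ys (i + 1) + q)) ^ 2

/-- The modulus of strong convexity of the objective along shifts of a free end. -/
noncomputable def convModulus (c : DepthChain) (γ : ℝ) : ℝ :=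
  min (curvLower c.a) (jerkLower c.a * γ)

/-- The constant in the Łojasiewicz inequality for one block of depths, whose two summands come from
blocks between two hinges and from free ends. -/
noncomputable def groupConst (c : DepthChain) (γ : ℝ) : ℝ :=
  (2 * c.J) ^ 2 / γ + (2 * c.J) ^ 2 / (2 * c.convModulus γ)

theorem convModulus_pos (hγ : 0 < γ) : 0 < c.convModulus γ :=
  lt_min (curvLower_pos c.a_pos) (mul_pos (jerkLower_pos c.a_pos) hγ)

theorem groupConst_nonneg (hγ : 0 < γ) : 0 ≤ c.groupConst γ := by
  have := c.convModulus_pos hγ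
  unfold groupConst
  positivity

namespace Nearby

variable {q : ℝ}

theorem interior_or_eq_zero (h : c.Nearby y g ys ω γ p) (hr : r ≤ 2 * c.J)
    (hq : ∀ i, a ≤ i → i < r → y (i + 1) - ys (i + 1) = q) :
    ((∀ i, a ≤ i → i < r → 0 < y (i + 1)) ∧ (∀ i, a ≤ i → i < r → y (i + 1) < 1)) ∨ q = 0 := by
  by_contra! hcon
  obtain ⟨hinterior, hq0⟩ := hcon
  have hpos : ∀ i, a ≤ i → i < r → 0 < y (i + 1) := by
    by_contra! hex
    obtain ⟨i, hai, hir, hle⟩ := hex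
    have hzero : y (i + 1) = 0 := le_antisymm hle (h.crit.adm.nonneg i (by omega))
    exact hq0 (by rw [← hq i hai hir, hzero, h.pos i (by omega) hzero, sub_self])
  obtain ⟨i, hai, hir, hge⟩ := hinterior hpos
  have hone : y (i + 1) = 1 := le_antisymm (h.crit.adm.le_one i (by omega)) hge
  exact hq0 (by rw [← hq i hai hir, hone, h.lt_one i (by omega) hone, sub_self])

theorem mul_objectiveDiff_le_sq (h : c.Nearby y g ys ω γ p) (har : a < r) (hr : r ≤ 2 * c.J)
    (hq : ∀ i, a ≤ i → i < r → y (i + 1) - ys (i + 1) = q) :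
    γ * c.objectiveDiff y ys a r ≤ c.objectiveSlope y a r ^ 2 := by
  have hqγ : |q| ≤ γ := by rw [← hq a le_rfl har]; exact h.close a (by omega)
  have hys : ∀ i ∈ Finset.Ico a r, ys (i + 1) + q = y (i + 1) := fun i hi => by
    rw [← hq i (Finset.mem_Ico.1 hi).1 (Finset.mem_Ico.1 hi).2, add_sub_cancel]
  convert h.loj a (by omega) r hr q hqγ using 2
  · exact Finset.sum_congr rfl fun i hi => by rw [hys i hi]
  · exact Finset.sum_congr rfl fun i hi => by rw [hys i hi]

theorem objectiveDiff_le_of_isHinge (h : c.Nearby y g ys ω γ p) (har : a < r) (hr : r < 2 * c.J)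
    (ha : c.IsHinge y a) (hb : c.IsHinge y r)
    (hq : ∀ i, a ≤ i → i < r → y (i + 1) - ys (i + 1) = q) :
    c.objectiveDiff y ys a r ≤ c.groupConst γ * ω ^ 2 := by
  have hγ := h.γ_pos
  have hm := c.convModulus_pos hγ
  rcases h.interior_or_eq_zero hr.le hq with ⟨hpos, hlt⟩ | rfl
  · have hslope : |c.objectiveSlope y a r| ≤ 2 * c.J * ω := by
      simpa only [h.crit.sum_eq_zero_of_isHinge har hr ha hb hpos hlt, sub_zero] using
        h.crit.abs_objectiveSlope_sub_le (a := a) hr.le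
    calc c.objectiveDiff y ys a r ≤ c.objectiveSlope y a r ^ 2 / γ := by
          rw [le_div_iff₀' hγ]
          exact h.mul_objectiveDiff_le_sq har hr.le hq
      _ ≤ (2 * c.J * ω) ^ 2 / γ := by
          rw [← sq_abs]
          gcongr
      _ = (2 * c.J) ^ 2 / γ * ω ^ 2 := by ring
      _ ≤ c.groupConst γ * ω ^ 2 :=
          mul_le_mul_of_nonneg_right (le_add_of_nonneg_right (by positivity)) (sq_nonneg ω)
  · rw [objectiveDiff_eq_zero hq]
    exact mul_nonneg (c.groupConst_nonneg hγ) (sq_nonneg ω)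

theorem pair_le (h : c.Nearby y g ys ω γ p) {α β : ℕ} (hβ : β ≤ c.J)
    (hq : ∀ i, 2 * α ≤ i → i < 2 * β → y (i + 1) - ys (i + 1) = q) {j : ℕ} (hj : α ≤ j)
    (hj' : j < β) :
    (-1) ^ (2 * j + 1) * (cycleLife c.a (y (2 * j + 1)) - cycleLife c.a (ys (2 * j + 1))) +
      (-1) ^ (2 * j + 1 + 1) * (cycleLife c.a (y (2 * j + 1 + 1)) -
        cycleLife c.a (ys (2 * j + 1 + 1))) ≤
    ((-1) ^ (2 * j + 1) * cycleLifeSlope c.a (y (2 * j + 1)) +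
      (-1) ^ (2 * j + 1 + 1) * cycleLifeSlope c.a (y (2 * j + 1 + 1))) * q -
      jerkLower c.a * inc y (2 * j + 1) / 2 * q ^ 2 := by
  have hstart : ys (2 * j + 1) - y (2 * j + 1) = -q := by
    linarith [hq (2 * j) (by omega) (by omega)]
  have hinc : y (2 * j + 1 + 1) = y (2 * j + 1) + inc y (2 * j + 1) := by
    simp only [inc]; ring
  have hinc' : ys (2 * j + 1 + 1) = ys (2 * j + 1) + inc y (2 * j + 1) := by
    linarith [hq (2 * j + 1) (by omega) (by omega)]
  have hle_one := h.crit.adm.le_one (2 * j + 1) (by omega)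
  have hle_one' := h.adm.le_one (2 * j + 1) (by omega)
  rw [hinc] at hle_one
  rw [hinc'] at hle_one'
  have htangent := tangent_add_sq_le_cycleLife_sub c.a_pos
    (sub_nonneg.2 (h.crit.adm.le_succ (i := 2 * j + 1) (by omega) (by omega)))
    (h.crit.adm.nonneg (2 * j) (by omega)) hle_one (h.adm.nonneg (2 * j) (by omega)) hle_one'
  rw [← inc, hstart] at htangent
  rw [Odd.neg_one_pow ⟨j, rfl⟩, Even.neg_one_pow ⟨j + 1, by ring⟩, hinc, hinc']
  linarith

theorem objectiveDiff_pairs_le (h : c.Nearby y g ys ω γ p) {α β : ℕ} (hαβ : α ≤ β)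
    (hβ : β ≤ c.J) (hq : ∀ i, 2 * α ≤ i → i < 2 * β → y (i + 1) - ys (i + 1) = q) :
    c.objectiveDiff y ys (2 * α) (2 * β) ≤ c.objectiveSlope y (2 * α) (2 * β) * q -
      (∑ j ∈ Finset.Ico α β, jerkLower c.a * inc y (2 * j + 1) / 2) * q ^ 2 := by
  rw [objectiveDiff, objectiveSlope, sum_Ico_two_mul _ hαβ, sum_Ico_two_mul _ hαβ,
    Finset.sum_mul, Finset.sum_mul, ← Finset.sum_sub_distrib]
  exact Finset.sum_le_sum fun j hj =>
    h.pair_le hβ hq (Finset.mem_Ico.1 hj).1 (Finset.mem_Ico.1 hj).2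

theorem jerkLower_mul_inc_nonneg (h : c.Nearby y g ys ω γ p) {j : ℕ} (hj : j < c.J) :
    0 ≤ jerkLower c.a * inc y (2 * j + 1) / 2 := by
  have := (jerkLower_pos c.a_pos).le
  have : 0 ≤ inc y (2 * j + 1) := sub_nonneg.2 (h.crit.adm.le_succ (by omega) (by omega))
  positivity

/-- Otherwise all eclipses of the block would be empty, and time would be cheap. -/
theorem exists_le_inc_of_freeEnd (h : c.Nearby y g ys ω γ p) {α β : ℕ}
    (hf : c.FreeEnd y (2 * α) (2 * β))
    (hq : ∀ i, 2 * α ≤ i → i < 2 * β → y (i + 1) - ys (i + 1) = q) :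
    ∃ j, α ≤ j ∧ j < β ∧ γ ≤ inc y (2 * j + 1) := by
  by_contra! hcon
  have hlt := hf.lt
  have hle := hf.le
  have hempty : ∀ j ∈ Finset.Ico α β, y (2 * j + 1 + 1) = y (2 * j + 1) := by
    intro j hj
    rw [Finset.mem_Ico] at hj
    have hinc : inc ys (2 * j + 1) ≤ 0 := not_lt.1 fun hpos =>
      absurd (h.inc_pos (2 * j + 1) (by omega) hpos) (not_le.2 (hcon j hj.1 hj.2))
    have hmono := h.adm.le_succ (i := 2 * j + 1) (by omega) (by omega)
    simp only [inc] at hinc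
    linarith [hq (2 * j) (by omega) (by omega), hq (2 * j + 1) (by omega) (by omega)]
  have hslope : c.objectiveSlope y (2 * α) (2 * β) = 0 := by
    rw [objectiveSlope, sum_Ico_two_mul _ (by omega)]
    refine Finset.sum_eq_zero fun j hj => ?_
    rw [hempty j hj, pow_succ]
    ring
  have hsum := h.crit.abs_objectiveSlope_sub_le (a := 2 * α) hle
  rw [hslope, zero_sub, abs_neg] at hsum
  exact h.not_cheap ((h.crit.timePriceLE_of_freeEnd h.time_eq hf).mono
    ((le_abs_self _).trans (hsum.trans h.le_p)))

theorem objectiveDiff_le_of_freeEnd_of_even (h : c.Nearby y g ys ω γ p) {α β : ℕ}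
    (hf : c.FreeEnd y (2 * α) (2 * β))
    (hq : ∀ i, 2 * α ≤ i → i < 2 * β → y (i + 1) - ys (i + 1) = q) :
    c.objectiveDiff y ys (2 * α) (2 * β) ≤
      c.objectiveSlope y (2 * α) (2 * β) * q - c.convModulus γ / 2 * q ^ 2 := by
  have hlt := hf.lt
  have hle := hf.le
  obtain ⟨j, hαj, hjβ, hj⟩ := h.exists_le_inc_of_freeEnd hf hq
  refine (h.objectiveDiff_pairs_le (by omega) (by omega) hq).trans ?_
  have hmodulus : c.convModulus γ / 2 ≤
      ∑ k ∈ Finset.Ico α β, jerkLower c.a * inc y (2 * k + 1) / 2 :=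
    calc c.convModulus γ / 2 ≤ jerkLower c.a * inc y (2 * j + 1) / 2 := by
          have := (jerkLower_pos c.a_pos).le
          have := min_le_right (curvLower c.a) (jerkLower c.a * γ)
          unfold convModulus
          grw [this, hj]
      _ ≤ _ := Finset.single_le_sum (f := fun k => jerkLower c.a * inc y (2 * k + 1) / 2)
          (fun k hk => h.jerkLower_mul_inc_nonneg (by rw [Finset.mem_Ico] at hk; omega))
          (Finset.mem_Ico.2 ⟨hαj, hjβ⟩)
  gcongr

theorem objectiveDiff_succ_le (h : c.Nearby y g ys ω γ p) {α : ℕ} (hα : α < c.J)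
    (hq : y (2 * α + 1 + 1) - ys (2 * α + 1 + 1) = q) :
    c.objectiveDiff y ys (2 * α + 1) (2 * α + 1 + 1) ≤
      c.objectiveSlope y (2 * α + 1) (2 * α + 1 + 1) * q - curvLower c.a / 2 * q ^ 2 := by
  have htangent := tangent_add_sq_le_cycleLife c.a_pos
    (h.crit.adm.nonneg (2 * α + 1) (by omega)) (h.crit.adm.le_one (2 * α + 1) (by omega))
    (h.adm.nonneg (2 * α + 1) (by omega)) (h.adm.le_one (2 * α + 1) (by omega))
  rw [← neg_sub, hq] at htangent
  rw [objectiveDiff, objectiveSlope, Nat.Ico_succ_singleton, Finset.sum_singleton,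
    Finset.sum_singleton, Even.neg_one_pow ⟨α + 1, by ring⟩, one_mul, one_mul]
  linarith

theorem objectiveDiff_le_of_freeEnd (h : c.Nearby y g ys ω γ p) (hf : c.FreeEnd y a r)
    (hq : ∀ i, a ≤ i → i < r → y (i + 1) - ys (i + 1) = q) :
    c.objectiveDiff y ys a r ≤ c.objectiveSlope y a r * q - c.convModulus γ / 2 * q ^ 2 := by
  have hlt := hf.lt
  have hle := hf.le
  have hre := hf.even
  obtain ⟨β, rfl⟩ : ∃ β, r = 2 * β := ⟨r / 2, by omega⟩
  rcases Nat.mod_two_eq_zero_or_one a with he | ho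
  · obtain ⟨α, rfl⟩ : ∃ α, a = 2 * α := ⟨a / 2, by omega⟩
    exact h.objectiveDiff_le_of_freeEnd_of_even hf hq
  -- The first entry belongs to an eclipse that starts before the block.
  · obtain ⟨α, rfl⟩ : ∃ α, a = 2 * α + 1 := ⟨a / 2, by omega⟩
    have hfirst := h.objectiveDiff_succ_le (by omega) (hq (2 * α + 1) le_rfl hlt)
    have hrest := h.objectiveDiff_pairs_le (α := α + 1) (by omega) (by omega)
      fun i hi hir => hq i (by omega) hir
    have hjerk : 0 ≤ ∑ j ∈ Finset.Ico (α + 1) β, jerkLower c.a * inc y (2 * j + 1) / 2 :=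
      Finset.sum_nonneg fun j hj =>
        h.jerkLower_mul_inc_nonneg (by rw [Finset.mem_Ico] at hj; omega)
    have hdiff : c.objectiveDiff y ys (2 * α + 1) (2 * α + 1 + 1) +
        c.objectiveDiff y ys (2 * (α + 1)) (2 * β) = c.objectiveDiff y ys (2 * α + 1) (2 * β) :=
      objectiveDiff_add (by omega) (by omega)
    have hslope : c.objectiveSlope y (2 * α + 1) (2 * α + 1 + 1) +
        c.objectiveSlope y (2 * (α + 1)) (2 * β) = c.objectiveSlope y (2 * α + 1) (2 * β) :=
      Finset.sum_Ico_consecutive _ (by omega) (by omega)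
    have hmodulus : c.convModulus γ / 2 * q ^ 2 ≤ curvLower c.a / 2 * q ^ 2 := by
      have := min_le_left (curvLower c.a) (jerkLower c.a * γ)
      unfold convModulus
      gcongr
    rw [← hdiff, ← hslope]
    linarith [mul_nonneg hjerk (sq_nonneg q)]

theorem objectiveDiff_le_of_end (h : c.Nearby y g ys ω γ p) {t : ℝ}
    (ht : c.IsPrice y g t) (har : a < r) (hr : r ≤ 2 * c.J) (hre : r % 2 = 0) (ha : c.IsHinge y a)
    (hcut : r < 2 * c.J → c.hi r < inc y r)
    (hq : ∀ i, a ≤ i → i < r → y (i + 1) - ys (i + 1) = q) :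
    c.objectiveDiff y ys a r ≤ c.groupConst γ * ω ^ 2 + t * q := by
  have hγ := h.γ_pos
  have hm := c.convModulus_pos hγ
  rcases h.interior_or_eq_zero hr hq with ⟨hpos, hlt⟩ | rfl
  · have hf : c.FreeEnd y a r := ⟨har, hr, hre, ha, hcut, hpos, hlt⟩
    have hconv := h.objectiveDiff_le_of_freeEnd hf hq
    have hslope := h.crit.abs_objectiveSlope_sub_le (a := a) hr
    rw [ht.sum_eq a r hf] at hslope
    set s := c.objectiveSlope y a r - t
    have hsq : s * q - c.convModulus γ / 2 * q ^ 2 ≤ s ^ 2 / (2 * c.convModulus γ) := by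
      rw [le_div_iff₀ (by positivity)]
      nlinarith only [sq_nonneg (s - c.convModulus γ * q)]
    have hbound : s ^ 2 / (2 * c.convModulus γ) ≤ c.groupConst γ * ω ^ 2 :=
      calc s ^ 2 / (2 * c.convModulus γ) ≤ (2 * c.J * ω) ^ 2 / (2 * c.convModulus γ) := by
            rw [← sq_abs]
            gcongr
        _ = (2 * c.J) ^ 2 / (2 * c.convModulus γ) * ω ^ 2 := by ring
        _ ≤ c.groupConst γ * ω ^ 2 :=
            mul_le_mul_of_nonneg_right (le_add_of_nonneg_left (by positivity)) (sq_nonneg ω)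
    linarith
  · rw [objectiveDiff_eq_zero hq, mul_zero, add_zero]
    exact mul_nonneg (c.groupConst_nonneg hγ) (sq_nonneg ω)

end Nearby

end DepthChain

/-! ### Reading a chain from left to right -/

namespace DepthChain

variable {c : DepthChain} {y g ys : ℕ → ℝ} {ω γ p : ℝ}

/-- Change of the time bought at the first `n` steps. -/
noncomputable def timeDiff (c : DepthChain) (y ys : ℕ → ℝ) (n : ℕ) : ℝ :=
  ∑ i ∈ Finset.range n, (min (inc y i) (c.hi i) - min (inc ys i) (c.hi i))

theorem timeDiff_succ (n : ℕ) : c.timeDiff y ys (n + 1) =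
    c.timeDiff y ys n + (min (inc y n) (c.hi n) - min (inc ys n) (c.hi n)) :=
  Finset.sum_range_succ _ _

theorem timeDiff_two_mul_J (y ys : ℕ → ℝ) :
    c.timeDiff y ys (2 * c.J) = c.time y - c.time ys := by
  rw [timeDiff, time, time, ← Finset.sum_sub_distrib]
  exact Finset.sum_congr rfl fun i _ => (sub_sub_sub_cancel_right _ _ _).symm

theorem objectiveDiff_zero_succ (n : ℕ) : c.objectiveDiff y ys 0 (n + 1) =
    c.objectiveDiff y ys 0 n +
      (-1) ^ (n + 1) * (cycleLife c.a (y (n + 1)) - cycleLife c.a (ys (n + 1))) :=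
  Finset.sum_Ico_succ_top (Nat.zero_le n) _

theorem objectiveDiff_zero_two_mul_J (y ys : ℕ → ℝ) :
    c.objectiveDiff y ys 0 (2 * c.J) = c.objective y - c.objective ys := by
  rw [objectiveDiff, objective, objective, ← Finset.sum_sub_distrib, Finset.range_eq_Ico]
  exact Finset.sum_congr rfl fun i _ => mul_sub _ _ _

/-- The change of the objective on the first `n` entries is accounted for by the time gained there
and an error of at most `D` per entry. -/
def IsPaid (c : DepthChain) (y ys : ℕ → ℝ) (t D : ℝ) (n : ℕ) : Prop :=
  c.objectiveDiff y ys 0 n ≤ n * D + t * c.timeDiff y ys n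

/-- The index `n` belongs to a block of depths that starts after the hinge `a`, and the change of
the objective before this block is paid for. -/
structure IsRunning (c : DepthChain) (y ys : ℕ → ℝ) (t D : ℝ) (n a : ℕ) : Prop where
  lt : a < n
  hinge : c.IsHinge y a
  sub_eq : ∀ i, a ≤ i → i < n → y (i + 1) - ys (i + 1) = y n - ys n
  paid : c.objectiveDiff y ys 0 a ≤ a * D + t * (c.timeDiff y ys n - (y n - ys n))

/-- The states that can be reached without wasting energy when a chain is read from left to right
up to the index `n`. -/
inductive LinkedState (c : DepthChain) (y ys : ℕ → ℝ) (t D : ℝ) (n : ℕ) : Prop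
  | settled (eq : y n = ys n) (paid : c.IsPaid y ys t D n)
  | running (a : ℕ) (block : c.IsRunning y ys t D n a)

/-- The states that can be reached when a chain is read from left to right. The last two occur
after a step that wastes energy, at the beginning and at the end of a sunlight period. -/
inductive ScanState (c : DepthChain) (y ys : ℕ → ℝ) (t D : ℝ) : ℕ → Prop
  | linked {n : ℕ} (state : c.LinkedState y ys t D n) : ScanState c y ys t D n
  | cutEven {n a : ℕ} (even : n % 2 = 0) (block : c.IsCutBlock y a n)
      (paid : c.IsPaid y ys t D n) : ScanState c y ys t D n
  | cutOdd {n a : ℕ} (even : n % 2 = 0) (block : c.IsCutBlock y a (n + 1))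
      (paid : c.objectiveDiff y ys 0 n ≤ n * D + t * c.timeDiff y ys (n + 1)) :
      ScanState c y ys t D (n + 1)

theorem IsPaid.succ_of_eq {t D : ℝ} {n : ℕ} (hpaid : c.IsPaid y ys t D n) (hD : 0 ≤ D)
    (hy : y (n + 1) = ys (n + 1)) (htime : c.timeDiff y ys (n + 1) = c.timeDiff y ys n) :
    c.IsPaid y ys t D (n + 1) := by
  rw [IsPaid] at hpaid ⊢
  rw [objectiveDiff_zero_succ, hy, htime]
  push_cast
  linarith

namespace Nearby

variable {t D : ℝ} {n a : ℕ}

theorem nonneg_of_le (h : c.Nearby y g ys ω γ p) (hD : c.groupConst γ * ω ^ 2 ≤ D) : 0 ≤ D :=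
  (mul_nonneg (c.groupConst_nonneg h.γ_pos) (sq_nonneg ω)).trans hD

theorem objectiveDiff_zero_le (h : c.Nearby y g ys ω γ p) (hD : c.groupConst γ * ω ^ 2 ≤ D)
    {b e : ℝ} (han : a < n) (hfirst : c.objectiveDiff y ys 0 a ≤ a * D + b)
    (hblock : c.objectiveDiff y ys a n ≤ c.groupConst γ * ω ^ 2 + e) :
    c.objectiveDiff y ys 0 n ≤ n * D + (b + e) := by
  have hcount : ((a : ℝ) + 1) * D ≤ n * D :=
    mul_le_mul_of_nonneg_right (by exact_mod_cast han) (h.nonneg_of_le hD)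
  rw [← objectiveDiff_add (Nat.zero_le a) han.le]
  linarith

theorem objectiveDiff_zero_le_of_isHinge (h : c.Nearby y g ys ω γ p)
    (hD : c.groupConst γ * ω ^ 2 ≤ D) (hn : n < 2 * c.J) (hb : c.IsHinge y n)
    (hs : c.LinkedState y ys t D n) :
    c.objectiveDiff y ys 0 n ≤ n * D + t * (c.timeDiff y ys n - (y n - ys n)) := by
  rcases hs with ⟨heq, hpaid⟩ | ⟨a, han, ha, hq, hpaid⟩
  · rw [heq, sub_self, sub_zero]
    exact hpaid
  · simpa only [add_zero] using h.objectiveDiff_zero_le hD (e := 0) han hpaid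
      (by simpa only [add_zero] using h.objectiveDiff_le_of_isHinge han hn ha hb hq)

theorem isPaid_of_end (h : c.Nearby y g ys ω γ p) (ht : c.IsPrice y g t)
    (hD : c.groupConst γ * ω ^ 2 ≤ D) (hn : n ≤ 2 * c.J) (hne : n % 2 = 0)
    (hcut : n < 2 * c.J → c.hi n < inc y n) (hs : c.ScanState y ys t D n) :
    c.IsPaid y ys t D n := by
  rcases hs with ⟨⟨-, hpaid⟩ | ⟨a, han, ha, hq, hpaid⟩⟩ | ⟨-, -, hpaid⟩ | _
  · exact hpaid
  · rw [IsPaid, show t * c.timeDiff y ys n = t * (c.timeDiff y ys n - (y n - ys n)) +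
      t * (y n - ys n) by ring]
    exact h.objectiveDiff_zero_le hD han hpaid
      (h.objectiveDiff_le_of_end ht han hn hne ha hcut hq)
  · exact hpaid
  · omega

theorem timeDiff_succ_of_inc_le_hi (h : c.Nearby y g ys ω γ p) (hn : n < 2 * c.J)
    (hle : inc y n ≤ c.hi n) : c.timeDiff y ys (n + 1) - (y (n + 1) - ys (n + 1)) =
      c.timeDiff y ys n - (y n - ys n) := by
  rw [timeDiff_succ, min_eq_left hle, min_eq_left (h.le_hi n hn hle), inc, inc]
  ring

theorem timeDiff_succ_of_hi_le_inc (h : c.Nearby y g ys ω γ p) (hn : n < 2 * c.J)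
    (hle : c.hi n ≤ inc y n) : c.timeDiff y ys (n + 1) = c.timeDiff y ys n := by
  rw [timeDiff_succ, min_eq_right hle, min_eq_right (h.hi_le n hn hle), sub_self, add_zero]

theorem isRunning_succ_of_isHinge (h : c.Nearby y g ys ω γ p)
    (hD : c.groupConst γ * ω ^ 2 ≤ D) (hn : n < 2 * c.J) (hb : c.IsHinge y n)
    (hs : c.LinkedState y ys t D n) : c.IsRunning y ys t D (n + 1) n where
  lt := n.lt_succ_self
  hinge := hb
  sub_eq i hni hin := by rw [show i = n by omega]
  paid := by
    rw [h.timeDiff_succ_of_inc_le_hi hn hb.2.le]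
    exact h.objectiveDiff_zero_le_of_isHinge hD hn hb hs

theorem linkedState_succ_of_inc_eq (h : c.Nearby y g ys ω γ p) (hD : 0 ≤ D) (hn : n < 2 * c.J)
    (hle : inc y n ≤ c.hi n) (hinc : inc y n = inc ys n) (hs : c.LinkedState y ys t D n) :
    c.LinkedState y ys t D (n + 1) := by
  have htime := h.timeDiff_succ_of_inc_le_hi hn hle
  have hsub : y (n + 1) - ys (n + 1) = y n - ys n := by
    simp only [inc] at hinc
    linarith
  rcases hs with ⟨heq, hpaid⟩ | ⟨a, han, ha, hq, hpaid⟩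
  · have heq' : y (n + 1) = ys (n + 1) := by linarith
    exact .settled heq' (hpaid.succ_of_eq hD heq' (by linarith))
  · refine .running a ⟨by omega, ha, fun i hai hin => ?_, htime ▸ hpaid⟩
    rcases Nat.lt_succ_iff_lt_or_eq.1 hin with hlt | rfl
    · rw [hq i hai hlt, hsub]
    · rfl

theorem linkedState_succ (h : c.Nearby y g ys ω γ p) (hD : c.groupConst γ * ω ^ 2 ≤ D)
    (hn : n < 2 * c.J) (hle : inc y n ≤ c.hi n) (hs : c.LinkedState y ys t D n) :
    c.LinkedState y ys t D (n + 1) := by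
  have hlink := fun hinc => h.linkedState_succ_of_inc_eq (h.nonneg_of_le hD) hn hle hinc hs
  rcases (h.crit.adm.lo n hn).eq_or_lt with hlo | hlo
  · exact hlink (by rw [h.lo n hn hlo.symm, hlo])
  rcases hle.eq_or_lt with hhi | hhi
  · exact hlink (hhi.trans (le_antisymm (h.hi_le n hn hhi.ge) (h.le_hi n hn hle)))
  · exact .running n (h.isRunning_succ_of_isHinge hD hn ⟨hlo, hhi⟩ hs)

theorem scanState_succ_of_isPaid (h : c.Nearby y g ys ω γ p) (hD : 0 ≤ D) (hn : n < 2 * c.J)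
    (hne : n % 2 = 0) (hhi : c.hi n ≤ inc y n) (hpaid : c.IsPaid y ys t D n)
    (hblock : 0 < y (n + 1) → c.IsCutBlock y a (n + 1)) : c.ScanState y ys t D (n + 1) := by
  have htime := h.timeDiff_succ_of_hi_le_inc hn hhi
  rcases (h.crit.adm.nonneg n hn).eq_or_lt with hzero | hpos
  · have heq : y (n + 1) = ys (n + 1) := by rw [← hzero, h.pos n hn hzero.symm]
    exact .linked (.settled heq (hpaid.succ_of_eq hD heq htime))
  · exact .cutOdd hne (hblock hpos) (htime ▸ hpaid)

/-- The depths of `y` before and after the eclipse differ too little to be bounded away from `0`. -/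
theorem inc_eq_zero_of_isCutBlock (h : c.Nearby y g ys ω γ p) (hn : n < 2 * c.J)
    (ho : n % 2 = 1) (hb : c.IsCutBlock y a (n + 1)) (han : a ≤ n) : inc ys n = 0 := by
  have hslope := h.crit.cycleLifeSlope_sub_le_of_cut hb (by omega) han n.lt_succ_self ho
  have hconv := le_cycleLifeSlope_sub c.a_pos (h.crit.adm.nonneg' hn.le (by omega))
    (h.crit.adm.le_succ hn ho) (h.crit.adm.le_one n hn)
  have hlt : inc y n < γ := lt_of_mul_lt_mul_left
    ((hconv.trans hslope).trans_lt h.small) (curvLower_pos c.a_pos).le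
  exact le_antisymm (not_lt.1 fun hpos => hlt.not_ge (h.inc_pos n hn hpos))
    (sub_nonneg.2 (h.adm.le_succ hn ho))

theorem cycleLife_sub_le_price_mul_inc (h : c.Nearby y g ys ω γ p) (ht : c.IsPrice y g t)
    (hn : n < 2 * c.J) (ho : n % 2 = 1) (hinc : inc ys n = 0) :
    cycleLife c.a (y (n + 1)) - cycleLife c.a (y n) ≤ t * inc y n := by
  rcases (h.crit.adm.lo n hn).eq_or_lt with hlo | hlo
  · have hzero : inc y n = 0 :=
      le_antisymm (by rw [← hlo, ← hinc]; exact h.adm.lo n hn)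
        (sub_nonneg.2 (h.crit.adm.le_succ hn ho))
    rw [hzero, sub_eq_zero.1 hzero, sub_self, mul_zero]
  · have hy0 := h.crit.adm.nonneg' hn.le (by omega)
    exact (cycleLife_sub_le c.a_pos hy0 (h.crit.adm.le_one' hn.le (by omega))
      (h.crit.adm.nonneg n hn) (h.crit.adm.le_one n hn)).trans
      (mul_le_mul_of_nonneg_right (ht.slope_le n hn ho hlo)
        (sub_nonneg.2 (h.crit.adm.le_succ hn ho)))

theorem isPaid_of_isCutBlock (h : c.Nearby y g ys ω γ p) (ht : c.IsPrice y g t) (hD : 0 ≤ D)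
    (hn : n + 1 < 2 * c.J) (hne : n % 2 = 0) (hb : c.IsCutBlock y a (n + 2)) (han : a ≤ n)
    (hpaid : c.objectiveDiff y ys 0 n ≤ n * D + t * c.timeDiff y ys (n + 1)) :
    c.IsPaid y ys t D (n + 2) := by
  have ho : (n + 1) % 2 = 1 := by omega
  have hinc := h.inc_eq_zero_of_isCutBlock hn ho hb (by omega)
  have hlife := h.cycleLife_sub_le_price_mul_inc ht hn ho hinc
  have hhi := h.crit.adm.hi (n + 1) hn ho
  rw [IsPaid, objectiveDiff_zero_succ, objectiveDiff_zero_succ, timeDiff_succ, min_eq_left hhi,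
    min_eq_left (h.le_hi (n + 1) hn hhi), Odd.neg_one_pow (Nat.odd_iff.2 ho),
    Even.neg_one_pow (Nat.even_iff.2 (by omega)), sub_eq_zero.1 hinc, hinc]
  push_cast
  linarith

theorem scanState_succ (h : c.Nearby y g ys ω γ p) (ht : c.IsPrice y g t)
    (hD : c.groupConst γ * ω ^ 2 ≤ D) (hn : n < 2 * c.J) (hs : c.ScanState y ys t D n) :
    c.ScanState y ys t D (n + 1) := by
  have hD0 := h.nonneg_of_le hD
  by_cases hwaste : n % 2 = 0 ∧ c.hi n < inc y n
  · obtain ⟨hne, hcut⟩ := hwaste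
    exact h.scanState_succ_of_isPaid hD0 hn hne hcut.le
      (h.isPaid_of_end ht hD hn.le hne (fun _ => hcut) hs) (isCutBlock_succ_self hn hne hcut)
  have hle : inc y n ≤ c.hi n := by
    rcases Nat.mod_two_eq_zero_or_one n with hne | ho
    · exact not_lt.1 fun hlt => hwaste ⟨hne, hlt⟩
    · exact h.crit.adm.hi n hn ho
  rcases hs with hs | ⟨hne, hblock, hpaid⟩ | @⟨k, a, hke, hblock, hpaid⟩
  · exact .linked (h.linkedState_succ hD hn hle hs)
  · exact h.scanState_succ_of_isPaid hD0 hn hne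
      (h.crit.hi_le_of_cut h.not_cheap h.le_p hblock hn hne) hpaid (hblock.succ hn)
  · have hblock' := hblock.succ hn ((hblock.pos k (Nat.lt_succ_iff.1 hblock.lt)
      k.lt_succ_self).trans_le (h.crit.adm.le_succ hn (by omega)))
    exact .cutEven (by omega) hblock'
      (h.isPaid_of_isCutBlock ht hD0 hn hke hblock' (Nat.lt_succ_iff.1 hblock.lt) hpaid)

theorem objective_sub_le (h : c.Nearby y g ys ω γ p) (hT : c.time ys = c.T) :
    c.objective y - c.objective ys ≤ 2 * c.J * c.groupConst γ * ω ^ 2 := by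
  obtain ⟨t, ht⟩ := h.crit.exists_isPrice h.time_eq
  have hstate : ∀ n ≤ 2 * c.J, c.ScanState y ys t (c.groupConst γ * ω ^ 2) n := by
    intro n
    induction n with
    | zero =>
      refine fun _ => .linked (.settled (h.crit.adm.base.trans h.adm.base.symm) ?_)
      simp only [IsPaid, objectiveDiff, timeDiff, Finset.Ico_self, Finset.range_zero,
        Finset.sum_empty, Nat.cast_zero, zero_mul, mul_zero, add_zero, le_refl]
    | succ n ih => exact fun hn => h.scanState_succ ht le_rfl hn (ih (by omega))
  have hpaid := h.isPaid_of_end ht le_rfl le_rfl (by omega) (fun hlt => (hlt.ne rfl).elim)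
    (hstate _ le_rfl)
  rw [IsPaid, objectiveDiff_zero_two_mul_J, timeDiff_two_mul_J, h.time_eq, hT] at hpaid
  push_cast at hpaid
  linarith

end Nearby

theorem IsAdmissible.abs_inc_sub_le (hy : c.IsAdmissible y) (hys : c.IsAdmissible ys) (hγ : 0 ≤ γ)
    (hclose : ∀ i < 2 * c.J, |y (i + 1) - ys (i + 1)| ≤ γ) {i : ℕ} (hi : i < 2 * c.J) :
    |inc y i - inc ys i| ≤ 2 * γ := by
  have hstart : |y i - ys i| ≤ γ := by
    cases i with
    | zero => rwa [hy.base, hys.base, sub_self, abs_zero]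
    | succ i => exact hclose i (by omega)
  rw [inc, inc, sub_sub_sub_comm, two_mul]
  exact (abs_sub _ _).trans (add_le_add (hclose i hi) hstart)

theorem IsNearCritical.nearby (h : c.IsNearCritical y g ω) (hcheap : ¬ c.TimePriceLE y g p)
    (hys : c.IsAdmissible ys) (hγ : c.HasSlackGap ys (3 * γ))
    (hinc : ∀ i < 2 * c.J, 0 < inc ys i → 3 * γ ≤ inc ys i)
    (hloj : ∀ a ≤ 2 * c.J, ∀ r ≤ 2 * c.J, ∀ q, |q| ≤ γ →
      γ * ∑ i ∈ Finset.Ico a r, (-1) ^ (i + 1) * (cycleLife c.a (ys (i + 1) + q)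
        - cycleLife c.a (ys (i + 1))) ≤
      (∑ i ∈ Finset.Ico a r, (-1) ^ (i + 1) * cycleLifeSlope c.a (ys (i + 1) + q)) ^ 2)
    (hωp : 2 * c.J * ω ≤ p) (hsmall : 2 * c.J * ω < curvLower c.a * γ)
    (hclose : ∀ i < 2 * c.J, |y (i + 1) - ys (i + 1)| ≤ γ) : c.Nearby y g ys ω γ p := by
  have hγ0 : 0 < γ := by linarith [hγ.pos]
  have hdepth := fun i hi => abs_le.1 (hclose i hi)
  have hdiff := fun i hi => abs_le.1 (h.adm.abs_inc_sub_le hys hγ0.le hclose (i := i) hi)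
  have hp : 0 ≤ p := le_trans (by have := h.ω_nonneg; positivity) hωp
  refine ⟨h, h.time_eq hcheap hp, hcheap, hωp, hys, hγ0, hsmall, hclose,
    fun i hi hzero => ?_, fun i hi hone => ?_, fun i hi hlo => ?_, fun i hi hle => ?_,
    fun i hi hle => ?_, fun i hi hpos => ?_, hloj⟩
  · by_contra hne
    linarith [hγ.nonneg i hi (lt_of_le_of_ne' (hys.nonneg i hi) hne), hdepth i hi]
  · by_contra hne
    linarith [hγ.le_one i hi (lt_of_le_of_ne (hys.le_one i hi) hne), hdepth i hi]
  · by_contra hne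
    linarith [hγ.lo i hi (lt_of_le_of_ne' (hys.lo i hi) hne), hdiff i hi]
  · by_contra! hlt
    linarith [hγ.hi' i hi hlt, hdiff i hi]
  · by_contra! hlt
    linarith [hγ.hi i hi hlt, hdiff i hi]
  · linarith [hinc i hi hpos, hdiff i hi]

theorem eventually_mul_sum_Ico_le_sq (c : DepthChain) (ys : ℕ → ℝ) :
    ∀ᶠ γ in 𝓝[>] (0 : ℝ), ∀ a ≤ 2 * c.J, ∀ r ≤ 2 * c.J, ∀ q, |q| ≤ γ →
      γ * ∑ i ∈ Finset.Ico a r, (-1) ^ (i + 1) * (cycleLife c.a (ys (i + 1) + q)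
        - cycleLife c.a (ys (i + 1))) ≤
      (∑ i ∈ Finset.Ico a r, (-1) ^ (i + 1) * cycleLifeSlope c.a (ys (i + 1) + q)) ^ 2 :=
  (eventually_all_finite (Set.finite_Iic (2 * c.J))).2 fun a _ =>
    (eventually_all_finite (Set.finite_Iic (2 * c.J))).2 fun r _ =>
      eventually_mul_sum_le_sq c.a (Finset.Ico a r) (fun i => (-1) ^ (i + 1)) fun i => ys (i + 1)

/-- This is the Łojasiewicz inequality with exponent `1/2`. -/
theorem IsAdmissible.exists_objective_sub_le (hys : c.IsAdmissible ys) (hT : c.time ys = c.T)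
    (hp : 0 < p) : ∃ ρ > 0, ∃ C ≥ 0, ∀ y g ω, c.IsNearCritical y g ω → ¬ c.TimePriceLE y g p →
      ω ≤ ρ → (∀ i < 2 * c.J, |y (i + 1) - ys (i + 1)| ≤ ρ) →
      c.objective y - c.objective ys ≤ C * ω ^ 2 := by
  obtain ⟨γ, ⟨⟨hloj, hgap⟩, hinc⟩, hγ⟩ := ((((c.eventually_mul_sum_Ico_le_sq ys).and
    (eventually_nhdsGT_zero_mul_left zero_lt_three (c.eventually_hasSlackGap ys))).and
    (eventually_nhdsGT_zero_mul_left zero_lt_three (eventually_nhdsGT_forall_le_of_pos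
      (Set.finite_Iio (2 * c.J)) fun i => inc ys i))).and self_mem_nhdsWithin).exists
  replace hγ : 0 < γ := hγ
  have hm := mul_pos (curvLower_pos c.a_pos) hγ
  obtain ⟨ρ, hρp, hρm, hργ, hρ⟩ : ∃ ρ, 2 * c.J * ρ ≤ p ∧ 2 * c.J * ρ < curvLower c.a * γ ∧
      ρ ≤ γ ∧ 0 < ρ := by
    have hlim : Tendsto (fun ρ : ℝ => 2 * c.J * ρ) (𝓝[>] 0) (𝓝 0) := by
      simpa only [mul_zero] using
        ((continuous_const_mul (2 * c.J : ℝ)).tendsto 0).mono_left nhdsWithin_le_nhds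
    have hle : ∀ᶠ ρ in 𝓝[>] (0 : ℝ), ρ ≤ γ ∧ 0 < ρ := by
      filter_upwards [Ioc_mem_nhdsGT hγ] with ρ hρ using hρ.symm
    exact ((hlim.eventually_le_const hp).and ((hlim.eventually_lt_const hm).and hle)).exists
  refine ⟨ρ, hρ, 2 * c.J * c.groupConst γ,
    mul_nonneg (by positivity) (c.groupConst_nonneg hγ), fun y g ω h hcheap hω hclose => ?_⟩
  have hωρ : 2 * c.J * ω ≤ 2 * c.J * ρ := by gcongr
  exact (h.nearby hcheap hys hgap hinc hloj (hωρ.trans hρp) (hωρ.trans_lt hρm)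
    fun i hi => (hclose i hi).trans hργ).objective_sub_le hT

end DepthChain

/-! ### The procedure on chains -/

namespace DepthChain

variable {c : DepthChain}

/-- The `ℓ¹` distance of two sequences, taken over the entries that matter. -/
noncomputable def l1Dist (c : DepthChain) (z y : ℕ → ℝ) : ℝ :=
  ∑ i ∈ Finset.range (2 * c.J), |y (i + 1) - z (i + 1)|

/-- The gradient at `y` of the surrogate objective in which the concave part of the objective is
linearized at `z`. -/
noncomputable def surrogateGrad (c : DepthChain) (z y : ℕ → ℝ) (i : ℕ) : ℝ :=
  if i % 2 = 0 then cycleLifeSlope c.a (y i) else -cycleLifeSlope c.a (z i)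

/-- All constraints, including the one on the total time. -/
def IsFeasible (c : DepthChain) (y : ℕ → ℝ) : Prop := c.IsAdmissible y ∧ c.T ≤ c.time y

/-- First-order optimality of `y` for the surrogate problem built at `z`. -/
def IsSurrogateCritical (c : DepthChain) (z y : ℕ → ℝ) : Prop :=
  c.IsFeasible y ∧ ∀ y', c.IsFeasible y' → 0 ≤ c.linForm (c.surrogateGrad z y) y y'

/-- The iterates of a concave-convex procedure that never stops. They are normalized to vanish at
the indices that do not matter, so that they have a cluster point in `ℕ → ℝ`. -/
structure IsRun (c : DepthChain) (y : ℕ → ℕ → ℝ) : Prop where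
  init : c.IsFeasible (y 0)
  step : ∀ l, c.IsSurrogateCritical (y l) (y (l + 1))
  eq_zero : ∀ l i, 2 * c.J < i → y l i = 0

section SurrogateCritical

variable {z y : ℕ → ℝ}

theorem l1Dist_nonneg (c : DepthChain) (z y : ℕ → ℝ) : 0 ≤ c.l1Dist z y :=
  Finset.sum_nonneg fun _ _ => abs_nonneg _

theorem l1Dist_le_add (c : DepthChain) (x y z : ℕ → ℝ) :
    c.l1Dist x z ≤ c.l1Dist x y + c.l1Dist y z := by
  rw [l1Dist, l1Dist, l1Dist, ← Finset.sum_add_distrib]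
  refine Finset.sum_le_sum fun i _ => ?_
  linarith [abs_sub_le (z (i + 1)) (y (i + 1)) (x (i + 1))]

theorem abs_sub_le_l1Dist {i : ℕ} (hi : i < 2 * c.J) : |y (i + 1) - z (i + 1)| ≤ c.l1Dist z y :=
  Finset.single_le_sum (f := fun i => |y (i + 1) - z (i + 1)|) (fun _ _ => abs_nonneg _)
    (Finset.mem_range.2 hi)

theorem sq_l1Dist_le (c : DepthChain) (z y : ℕ → ℝ) : c.l1Dist z y ^ 2 ≤
    2 * c.J * ∑ i ∈ Finset.range (2 * c.J), (y (i + 1) - z (i + 1)) ^ 2 := by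
  simpa only [l1Dist, Finset.card_range, sq_abs, Nat.cast_mul, Nat.cast_ofNat] using
    sq_sum_le_card_mul_sum_sq (s := Finset.range (2 * c.J)) (f := fun i => |y (i + 1) - z (i + 1)|)

theorem IsSurrogateCritical.isNearCritical (h : c.IsSurrogateCritical z y) (hz : c.IsFeasible z) :
    c.IsNearCritical y (c.surrogateGrad z y) (curvUpper c.a * c.l1Dist z y) where
  adm := h.1.1
  time_ge := h.1.2
  vi y' hadm htime := h.2 y' ⟨hadm, htime⟩
  ω_nonneg := mul_nonneg (curvUpper_pos c.a_pos).le (c.l1Dist_nonneg z y)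
  odd_step _ _ _ := if_pos (by omega)
  even_step i hi he := by
    rw [surrogateGrad, if_neg (by omega), neg_add_eq_sub]
    exact (abs_cycleLifeSlope_sub_le c.a_pos (hz.1.nonneg i hi) (hz.1.le_one i hi)
      (h.1.1.nonneg i hi) (h.1.1.le_one i hi)).trans
      (mul_le_mul_of_nonneg_left (abs_sub_le_l1Dist hi) (curvUpper_pos c.a_pos).le)

/-- The constant in the sufficient decrease condition; the summand `1` keeps the denominator
positive for `J = 0`. -/
noncomputable def decreaseConst (c : DepthChain) : ℝ := curvLower c.a / 2 / (2 * c.J + 1)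

theorem decreaseConst_pos : 0 < c.decreaseConst := by
  have := curvLower_pos c.a_pos
  unfold decreaseConst
  positivity

theorem decreaseConst_mul_sq_l1Dist_le (c : DepthChain) (z y : ℕ → ℝ) :
    c.decreaseConst * c.l1Dist z y ^ 2 ≤
      curvLower c.a / 2 * ∑ i ∈ Finset.range (2 * c.J), (y (i + 1) - z (i + 1)) ^ 2 := by
  have hsum : 0 ≤ ∑ i ∈ Finset.range (2 * c.J), (y (i + 1) - z (i + 1)) ^ 2 :=
    Finset.sum_nonneg fun _ _ => sq_nonneg _
  rw [decreaseConst, div_mul_eq_mul_div, div_le_iff₀ (by positivity), mul_assoc]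
  refine mul_le_mul_of_nonneg_left ?_ (half_pos (curvLower_pos c.a_pos)).le
  linarith [c.sq_l1Dist_le z y]

/-- Both parts of the objective contribute: the convexity of `u` at the new depths, and that of `v`
at the old ones. -/
theorem sum_sq_add_linForm_le_objective_sub (hy : c.IsAdmissible y) (hz : c.IsAdmissible z) :
    curvLower c.a / 2 * ∑ i ∈ Finset.range (2 * c.J), (y (i + 1) - z (i + 1)) ^ 2 +
      c.linForm (c.surrogateGrad z y) y z ≤ c.objective z - c.objective y := by
  rw [linForm, objective, objective, Finset.mul_sum, ← Finset.sum_add_distrib,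
    ← Finset.sum_sub_distrib]
  refine Finset.sum_le_sum fun i hi => ?_
  rw [Finset.mem_range] at hi
  have y0 := hy.nonneg i hi
  have y1 := hy.le_one i hi
  have z0 := hz.nonneg i hi
  have z1 := hz.le_one i hi
  rcases Nat.even_or_odd (i + 1) with hi' | hi'
  · rw [surrogateGrad, if_pos (Nat.even_iff.1 hi'), hi'.neg_one_pow]
    linarith [tangent_add_sq_le_cycleLife c.a_pos y0 y1 z0 z1]
  · rw [surrogateGrad, if_neg (by rw [Nat.odd_iff.1 hi']; norm_num), hi'.neg_one_pow]
    linarith [tangent_add_sq_le_cycleLife c.a_pos z0 z1 y0 y1]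

theorem IsSurrogateCritical.mul_sq_l1Dist_le (h : c.IsSurrogateCritical z y)
    (hz : c.IsFeasible z) :
    c.decreaseConst * c.l1Dist z y ^ 2 ≤ c.objective z - c.objective y := by
  linarith [c.decreaseConst_mul_sq_l1Dist_le z y, sum_sq_add_linForm_le_objective_sub h.1.1 hz.1,
    h.2 z hz]

end SurrogateCritical

theorem continuous_objective (c : DepthChain) : Continuous c.objective :=
  continuous_finsetSum _ fun i _ =>
    continuous_const.mul ((continuous_cycleLife c.a).comp (continuous_apply (i + 1)))

theorem continuous_inc (i : ℕ) : Continuous fun y : ℕ → ℝ => inc y i :=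
  (continuous_apply (i + 1)).sub (continuous_apply i)

theorem continuous_time (c : DepthChain) : Continuous c.time :=
  continuous_finsetSum _ fun i _ => ((continuous_inc i).min continuous_const).sub continuous_const

theorem continuous_l1Dist (c : DepthChain) (z : ℕ → ℝ) : Continuous (c.l1Dist z) :=
  continuous_finsetSum _ fun i _ => ((continuous_apply (i + 1)).sub continuous_const).abs

theorem isClosed_setOf_isAdmissible (c : DepthChain) : IsClosed {y | c.IsAdmissible y} := by
  have hset : {y | c.IsAdmissible y} = {y | y 0 = c.base ∧ (∀ i < 2 * c.J, c.lo i ≤ inc y i) ∧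
      (∀ i < 2 * c.J, i % 2 = 1 → inc y i ≤ c.hi i) ∧ (∀ i < 2 * c.J, 0 ≤ y (i + 1)) ∧
      ∀ i < 2 * c.J, y (i + 1) ≤ 1} :=
    Set.ext fun y => ⟨fun h => ⟨h.base, h.lo, h.hi, h.nonneg, h.le_one⟩,
      fun ⟨hbase, hlo, hhi, h0, h1⟩ => ⟨hbase, hlo, hhi, h0, h1⟩⟩
  simp only [hset, Set.ofPred_and, Set.ofPred_forall]
  refine (isClosed_eq (continuous_apply 0) continuous_const).inter
    (IsClosed.inter ?_ (IsClosed.inter ?_ (IsClosed.inter ?_ ?_)))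
  · exact isClosed_biInter fun i _ => isClosed_le continuous_const (continuous_inc i)
  · exact isClosed_biInter fun i _ => isClosed_iInter fun _ =>
      isClosed_le (continuous_inc i) continuous_const
  · exact isClosed_biInter fun i _ => isClosed_le continuous_const (continuous_apply (i + 1))
  · exact isClosed_biInter fun i _ => isClosed_le (continuous_apply (i + 1)) continuous_const

theorem isCompact_setOf_isFeasible (c : DepthChain) :
    IsCompact {y | c.IsFeasible y ∧ ∀ i, 2 * c.J < i → y i = 0} := by
  have hbox : IsCompact (Set.pi Set.univ fun _ : ℕ => Set.Icc (min 0 c.base) (max 1 c.base)) :=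
    isCompact_univ_pi fun _ => isCompact_Icc
  refine hbox.of_isClosed_subset ?_ ?_
  · have hzero : IsClosed {y : ℕ → ℝ | ∀ i, 2 * c.J < i → y i = 0} := by
      simp only [Set.ofPred_forall]
      exact isClosed_biInter fun i _ => isClosed_eq (continuous_apply i) continuous_const
    exact (c.isClosed_setOf_isAdmissible.inter
      (isClosed_le continuous_const c.continuous_time)).inter hzero
  · rintro y ⟨⟨h, -⟩, hzero⟩ i -
    rcases Nat.eq_zero_or_pos i with rfl | hpos
    · rw [h.base]
      exact ⟨min_le_right _ _, le_max_right _ _⟩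
    rcases lt_or_ge (2 * c.J) i with hi | hi
    · rw [hzero i hi]
      exact ⟨min_le_left _ _, le_max_of_le_left zero_le_one⟩
    · exact ⟨(min_le_left _ _).trans (h.nonneg' hi hpos.ne'),
        (h.le_one' hi hpos.ne').trans (le_max_left _ _)⟩

namespace IsRun

variable {y : ℕ → ℕ → ℝ} {ys : ℕ → ℝ} {φ : ℕ → ℕ}

theorem isFeasible (h : c.IsRun y) : ∀ l, c.IsFeasible (y l)
  | 0 => h.init
  | l + 1 => (h.step l).1

theorem mul_sq_l1Dist_le (h : c.IsRun y) (l : ℕ) :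
    c.decreaseConst * c.l1Dist (y l) (y (l + 1)) ^ 2 ≤
      c.objective (y l) - c.objective (y (l + 1)) :=
  (h.step l).mul_sq_l1Dist_le (h.isFeasible l)

theorem isNearCritical (h : c.IsRun y) (l : ℕ) : c.IsNearCritical (y (l + 1))
    (c.surrogateGrad (y l) (y (l + 1))) (curvUpper c.a * c.l1Dist (y l) (y (l + 1))) :=
  (h.step l).isNearCritical (h.isFeasible l)

theorem antitone_objective (h : c.IsRun y) : Antitone fun l => c.objective (y l) :=
  antitone_nat_of_succ_le fun l => sub_nonneg.1 <|
    (mul_nonneg decreaseConst_pos.le (sq_nonneg _)).trans (h.mul_sq_l1Dist_le l)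

theorem exists_tendsto_subseq (h : c.IsRun y) : ∃ ys, (c.IsFeasible ys ∧
    ∀ i, 2 * c.J < i → ys i = 0) ∧ ∃ φ : ℕ → ℕ, StrictMono φ ∧ Tendsto (y ∘ φ) atTop (𝓝 ys) :=
  c.isCompact_setOf_isFeasible.tendsto_subseq fun l => ⟨h.isFeasible l, h.eq_zero l⟩

theorem tendsto_objective (h : c.IsRun y) (hφ : StrictMono φ)
    (hlim : Tendsto (y ∘ φ) atTop (𝓝 ys)) :
    Tendsto (fun l => c.objective (y l)) atTop (𝓝 (c.objective ys)) :=
  (tendsto_iff_tendsto_subseq_of_antitone h.antitone_objective hφ.tendsto_atTop).2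
    ((c.continuous_objective.tendsto ys).comp hlim)

theorem tendsto_l1Dist (h : c.IsRun y) :
    Tendsto (fun l => c.l1Dist (y l) (y (l + 1))) atTop (𝓝 0) := by
  obtain ⟨ys, -, φ, hφ, hlim⟩ := h.exists_tendsto_subseq
  have hobj := h.tendsto_objective hφ hlim
  have hsq : Tendsto (fun l => c.l1Dist (y l) (y (l + 1)) ^ 2) atTop (𝓝 0) := by
    have hdiff : Tendsto (fun l => (c.objective (y l) - c.objective (y (l + 1))) / c.decreaseConst)
        atTop (𝓝 0) := by
      simpa only [sub_self, zero_div, Function.comp_def] using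
        (hobj.sub (hobj.comp (tendsto_add_atTop_nat 1))).div_const c.decreaseConst
    refine squeeze_zero (fun l => sq_nonneg _) (fun l => ?_) hdiff
    rw [le_div_iff₀ decreaseConst_pos, mul_comm]
    exact h.mul_sq_l1Dist_le l
  simpa only [Function.comp_def, Real.sqrt_zero, Real.sqrt_sq (c.l1Dist_nonneg _ _)] using
    (Real.continuous_sqrt.tendsto 0).comp hsq

/-- At a vanishing price of time an iterate would be a global minimizer, which the next step
nevertheless improves. -/
theorem exists_eventually_not_timePriceLE (h : c.IsRun y)
    (hmove : ∀ l, 0 < c.l1Dist (y l) (y (l + 1))) : ∃ p > 0, ∀ᶠ l in atTop,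
      ¬ c.TimePriceLE (y (l + 1)) (c.surrogateGrad (y l) (y (l + 1))) p := by
  obtain ⟨p, hp, hmin⟩ := c.exists_isGlobalMin_of_timePriceLE
  have herr : Tendsto (fun l => 2 * c.J * (curvUpper c.a * c.l1Dist (y l) (y (l + 1)))) atTop
      (𝓝 0) := by
    simpa only [mul_zero] using (h.tendsto_l1Dist.const_mul (curvUpper c.a)).const_mul (2 * c.J : ℝ)
  refine ⟨p, hp, ?_⟩
  filter_upwards [herr.eventually_le_const hp] with l hl hcheap
  have hle := hmin _ _ _ (h.isNearCritical l) hl hcheap _ (h.isFeasible (l + 1 + 1)).1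
  have : 0 < c.decreaseConst * c.l1Dist (y (l + 1)) (y (l + 1 + 1)) ^ 2 :=
    mul_pos decreaseConst_pos (pow_pos (hmove (l + 1)) 2)
  linarith [h.mul_sq_l1Dist_le (l + 1)]

theorem eventually_time_eq (h : c.IsRun y) {p : ℝ} (hp : 0 < p) (hcheap : ∀ᶠ l in atTop,
      ¬ c.TimePriceLE (y (l + 1)) (c.surrogateGrad (y l) (y (l + 1))) p) :
    ∀ᶠ l in atTop, c.time (y l) = c.T := by
  rw [← map_add_atTop_eq_nat 1, eventually_map]
  filter_upwards [hcheap] with l hl using (h.isNearCritical l).time_eq hl hp.le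

theorem tendsto_l1Dist_of_subseq (h : c.IsRun y) {p : ℝ} (hp : 0 < p)
    (hcheap : ∀ᶠ l in atTop,
      ¬ c.TimePriceLE (y (l + 1)) (c.surrogateGrad (y l) (y (l + 1))) p)
    (hys : c.IsAdmissible ys) (hφ : StrictMono φ) (hlim : Tendsto (y ∘ φ) atTop (𝓝 ys)) :
    Tendsto (fun l => c.l1Dist ys (y l)) atTop (𝓝 0) := by
  have hα := c.decreaseConst_pos
  have htime : c.time ys = c.T :=
    tendsto_nhds_unique_of_eventuallyEq ((c.continuous_time.tendsto ys).comp hlim)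
      tendsto_const_nhds (hφ.tendsto_atTop.eventually (h.eventually_time_eq hp hcheap))
  obtain ⟨ρ, hρ, C, hC, hKL⟩ := hys.exists_objective_sub_le htime hp
  have hobj := h.tendsto_objective hφ hlim
  have herr : Tendsto (fun l => curvUpper c.a * c.l1Dist (y l) (y (l + 1))) atTop (𝓝 0) := by
    simpa only [mul_zero] using h.tendsto_l1Dist.const_mul (curvUpper c.a)
  refine tendsto_zero_of_descent (b := fun l => c.l1Dist (y l) (y (l + 1)))
    (F := fun l => c.objective (y l) - c.objective ys)
    (C := C * curvUpper c.a ^ 2 / c.decreaseConst) hα (by positivity) hρ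
    (fun l => c.l1Dist_nonneg _ _) (fun l => c.l1Dist_le_add _ _ _)
    (by simpa only [sub_self] using hobj.sub_const (c.objective ys))
    (fun l => sub_nonneg.2 (h.antitone_objective.le_of_tendsto hobj l))
    (fun l => by simpa only [sub_sub_sub_cancel_right] using h.mul_sq_l1Dist_le l) ?_
    (fun ε hε => ?_)
  · filter_upwards [hcheap, herr.eventually_le_const hρ] with l hl herr_le hclose
    calc c.objective (y (l + 1)) - c.objective ys
        ≤ C * (curvUpper c.a * c.l1Dist (y l) (y (l + 1))) ^ 2 :=
          hKL _ _ _ (h.isNearCritical l) hl herr_le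
            fun i hi => (abs_sub_le_l1Dist hi).trans hclose
      _ = C * curvUpper c.a ^ 2 / c.decreaseConst *
            (c.decreaseConst * c.l1Dist (y l) (y (l + 1)) ^ 2) := by field_simp
      _ ≤ _ := by
          rw [sub_sub_sub_cancel_right]
          gcongr
          exact h.mul_sq_l1Dist_le l
  · have hdist := ((c.continuous_l1Dist ys).tendsto ys).comp hlim
    have hself : c.l1Dist ys ys = 0 := by
      simp only [l1Dist, sub_self, abs_zero, Finset.sum_const_zero]
    rw [hself] at hdist
    exact hφ.tendsto_atTop.frequently (hdist.eventually_le_const hε).frequently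

theorem tendsto_of_tendsto_l1Dist (h : c.IsRun y) (hys : c.IsAdmissible ys)
    (hzero : ∀ i, 2 * c.J < i → ys i = 0)
    (hdist : Tendsto (fun l => c.l1Dist ys (y l)) atTop (𝓝 0)) : Tendsto y atTop (𝓝 ys) := by
  refine tendsto_pi_nhds.2 fun i => ?_
  rcases i with _ | i
  · simp only [(h.isFeasible _).1.base, hys.base]
    exact tendsto_const_nhds
  rcases lt_or_ge i (2 * c.J) with hi | hi
  · exact tendsto_iff_dist_tendsto_zero.2 <| squeeze_zero (fun _ => dist_nonneg)
      (fun l => (Real.dist_eq _ _).trans_le (abs_sub_le_l1Dist hi)) hdist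
  · simp only [h.eq_zero _ _ (Nat.lt_succ_of_le hi), hzero _ (Nat.lt_succ_of_le hi)]
    exact tendsto_const_nhds

theorem exists_tendsto (h : c.IsRun y) (hmove : ∀ l, 0 < c.l1Dist (y l) (y (l + 1))) :
    ∃ ys, Tendsto y atTop (𝓝 ys) ∧ ∀ᶠ l in atTop, c.time (y l) = c.T := by
  obtain ⟨ys, ⟨hys, hzero⟩, φ, hφ, hlim⟩ := h.exists_tendsto_subseq
  obtain ⟨p, hp, hcheap⟩ := h.exists_eventually_not_timePriceLE hmove
  exact ⟨ys, h.tendsto_of_tendsto_l1Dist hys.1 hzero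
    (h.tendsto_l1Dist_of_subseq hp hcheap hys.1 hφ hlim), h.eventually_time_eq hp hcheap⟩

end IsRun

end DepthChain

/-! ### Feasible and stationary points -/

variable {J : ℕ}

namespace SatVar

@[fun_prop] theorem continuous_tauS (j : Fin J) : Continuous fun x : SatVar J => x.tauS j := by
  unfold tauS; fun_prop

@[fun_prop] theorem continuous_tauE (j : Fin J) : Continuous fun x : SatVar J => x.tauE j := by
  unfold tauE; fun_prop

@[fun_prop] theorem continuous_bE (j : Fin J) : Continuous fun x : SatVar J => x.bE j := by
  unfold bE; fun_prop

@[fun_prop] theorem continuous_bSnext (j : Fin J) :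
    Continuous fun x : SatVar J => x.bSnext j := by
  unfold bSnext; fun_prop

@[fun_prop] theorem continuous_dE (j : Fin J) : Continuous fun x : SatVar J => x.dE j := by
  unfold dE; fun_prop

@[fun_prop] theorem continuous_dHat (j : Fin J) : Continuous fun x : SatVar J => x.dHat j := by
  unfold dHat; fun_prop

theorem continuous_dVec : Continuous fun x : SatVar J => x.dVec :=
  (PiLp.continuous_toLp 2 _).comp (continuous_pi fun j => continuous_dE j)

theorem hasFDerivAt_dE (x : SatVar J) (j : Fin J) : HasFDerivAt (fun x : SatVar J => x.dE j)
    (EuclideanSpace.proj (4, j) : SatVar J →L[ℝ] ℝ) x :=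
  (EuclideanSpace.proj (4, j) : SatVar J →L[ℝ] ℝ).hasFDerivAt

theorem hasFDerivAt_dHat (x : SatVar J) (j : Fin J) : HasFDerivAt (fun x : SatVar J => x.dHat j)
    (EuclideanSpace.proj (5, j) : SatVar J →L[ℝ] ℝ) x :=
  (EuclideanSpace.proj (5, j) : SatVar J →L[ℝ] ℝ).hasFDerivAt

end SatVar

namespace SatData

section FeasibleSet

variable (p : SatData J)

theorem continuous_bS (j : Fin J) : Continuous fun x : SatVar J => p.bS x j := by
  unfold bS
  split_ifs
  · exact continuous_const
  · exact SatVar.continuous_bSnext _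

theorem bS_smul_add_smul {s t : ℝ} (hst : s + t = 1) (x y : SatVar J) (j : Fin J) :
    p.bS (s • x + t • y) j = s * p.bS x j + t * p.bS y j := by
  unfold bS
  split_ifs
  · rw [← add_mul, hst, one_mul]
  · rfl

theorem feasibleSet_eq_setOf : p.feasibleSet = {x : SatVar J |
    (∀ j, x.bSnext j = x.bE j - p.EdE j - p.Pc * x.tauE j) ∧
    (∀ j, x.bE j ≤ min (p.bS x j + p.EhS j - p.EdS j - p.Pc * x.tauS j) p.Bmax) ∧
    (∀ j, 0 ≤ p.EhS j - p.EdS j - p.Pc * x.tauS j) ∧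
    (∀ j, x.dE j = (p.Bmax - x.bE j) / p.Bmax) ∧
    (∀ j, x.dHat j = (p.Bmax - x.bSnext j) / p.Bmax) ∧
    ∑ j, (x.tauS j + x.tauE j) = p.Tc ∧
    (∀ j, 0 ≤ x.tauS j ∧ x.tauS j ≤ p.tE j - p.tS j.castSucc) ∧
    (∀ j, 0 ≤ x.tauE j ∧ x.tauE j ≤ p.tS j.succ - p.tE j) ∧
    (∀ j, 0 ≤ x.bSnext j ∧ x.bSnext j ≤ p.Bmax) ∧
    ∀ j, 0 ≤ x.bE j ∧ x.bE j ≤ p.Bmax} :=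
  Set.ext fun _ => ⟨fun ⟨h₁, h₂, h₃, h₄, h₅, h₆, h₇, h₈, h₉, h₁₀⟩ =>
      ⟨h₁, h₂, h₃, h₄, h₅, h₆, h₇, h₈, h₉, h₁₀⟩,
    fun ⟨h₁, h₂, h₃, h₄, h₅, h₆, h₇, h₈, h₉, h₁₀⟩ => ⟨h₁, h₂, h₃, h₄, h₅, h₆, h₇, h₈, h₉, h₁₀⟩⟩

theorem isClosed_feasibleSet : IsClosed p.feasibleSet := by
  have hmin (j : Fin J) : Continuous fun x : SatVar J =>
      min (p.bS x j + p.EhS j - p.EdS j - p.Pc * x.tauS j) p.Bmax := by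
    have := p.continuous_bS j
    fun_prop
  have hIcc {f : SatVar J → ℝ} (hf : Continuous f) (U : ℝ) : IsClosed {x | 0 ≤ f x ∧ f x ≤ U} :=
    (isClosed_le continuous_const hf).inter (isClosed_le hf continuous_const)
  simp only [feasibleSet_eq_setOf, Set.ofPred_and, Set.ofPred_forall]
  exact (isClosed_iInter fun j => isClosed_eq (by fun_prop) (by fun_prop)).inter <|
    (isClosed_iInter fun j => isClosed_le (by fun_prop) (hmin j)).inter <|
    (isClosed_iInter fun j => isClosed_le (by fun_prop) (by fun_prop)).inter <|
    (isClosed_iInter fun j => isClosed_eq (by fun_prop) (by fun_prop)).inter <|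
    (isClosed_iInter fun j => isClosed_eq (by fun_prop) (by fun_prop)).inter <|
    (isClosed_eq (by fun_prop) (by fun_prop)).inter <|
    (isClosed_iInter fun j => hIcc (SatVar.continuous_tauS j) _).inter <|
    (isClosed_iInter fun j => hIcc (SatVar.continuous_tauE j) _).inter <|
    (isClosed_iInter fun j => hIcc (SatVar.continuous_bSnext j) _).inter <|
    isClosed_iInter fun j => hIcc (SatVar.continuous_bE j) _

variable {p} in
theorem IsFeasible.dE_mem {x : SatVar J} (h : p.IsFeasible x) (j : Fin J) :
    0 ≤ x.dE j ∧ x.dE j ≤ 1 := by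
  rw [h.dod_start j]
  exact ⟨div_nonneg (sub_nonneg.2 (h.level_start j).2) p.Bmax_pos.le,
    (div_le_one p.Bmax_pos).2 (sub_le_self _ (h.level_start j).1)⟩

variable {p} in
theorem IsFeasible.dHat_mem {x : SatVar J} (h : p.IsFeasible x) (j : Fin J) :
    0 ≤ x.dHat j ∧ x.dHat j ≤ 1 := by
  rw [h.dod_end j]
  exact ⟨div_nonneg (sub_nonneg.2 (h.level_end j).2) p.Bmax_pos.le,
    (div_le_one p.Bmax_pos).2 (sub_le_self _ (h.level_end j).1)⟩

theorem isCompact_feasibleSet : IsCompact p.feasibleSet := by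
  let upper : Fin 6 × Fin J → ℝ := fun k => ![p.tE k.2 - p.tS k.2.castSucc,
    p.tS k.2.succ - p.tE k.2, p.Bmax, p.Bmax, 1, 1] k.1
  have hbox : IsCompact ((WithLp.toLp 2 : (Fin 6 × Fin J → ℝ) → SatVar J) ''
      Set.pi Set.univ fun k => Set.Icc 0 (upper k)) :=
    (isCompact_univ_pi fun _ => isCompact_Icc).image (PiLp.continuous_toLp 2 _)
  refine hbox.of_isClosed_subset p.isClosed_feasibleSet fun x hx => ⟨fun k => x k, ?_, rfl⟩
  replace hx : p.IsFeasible x := hx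
  rintro ⟨k, j⟩ -
  fin_cases k
  exacts [hx.time_sun j, hx.time_ecl j, hx.level_start j, hx.level_end j, hx.dE_mem j,
    hx.dHat_mem j]

theorem convex_feasibleSet : Convex ℝ p.feasibleSet := by
  intro x hx y hy s t hs ht hst
  replace hx : p.IsFeasible x := hx
  replace hy : p.IsFeasible y := hy
  have hIcc {U a b : ℝ} (ha : 0 ≤ a ∧ a ≤ U) (hb : 0 ≤ b ∧ b ≤ U) :
      0 ≤ s * a + t * b ∧ s * a + t * b ≤ U := convex_Icc 0 U ha hb hs ht hst
  have hτS (j) : (s • x + t • y).tauS j = s * x.tauS j + t * y.tauS j := rfl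
  have hτE (j) : (s • x + t • y).tauE j = s * x.tauE j + t * y.tauE j := rfl
  have hbE (j) : (s • x + t • y).bE j = s * x.bE j + t * y.bE j := rfl
  have hbS (j) : (s • x + t • y).bSnext j = s * x.bSnext j + t * y.bSnext j := rfl
  have hdE (j) : (s • x + t • y).dE j = s * x.dE j + t * y.dE j := rfl
  have hdHat (j) : (s • x + t • y).dHat j = s * x.dHat j + t * y.dHat j := rfl
  obtain rfl : t = 1 - s := by linarith
  refine ⟨fun j => ?_, fun j => ?_, fun j => ?_, fun j => ?_, fun j => ?_, ?_,
    fun j => hIcc (hx.time_sun j) (hy.time_sun j), fun j => hIcc (hx.time_ecl j) (hy.time_ecl j),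
    fun j => hIcc (hx.level_end j) (hy.level_end j),
    fun j => hIcc (hx.level_start j) (hy.level_start j)⟩
  · rw [hτE, hbE, hbS, hx.eclipse, hy.eclipse]; ring
  · rw [p.bS_smul_add_smul hst, hτS, hbE]
    obtain ⟨hxs, hxB⟩ := le_min_iff.1 (hx.sunlight j)
    obtain ⟨hys, hyB⟩ := le_min_iff.1 (hy.sunlight j)
    refine le_min ?_ (convex_Iic p.Bmax hxB hyB hs ht hst)
    linarith [mul_le_mul_of_nonneg_left hxs hs, mul_le_mul_of_nonneg_left hys ht]
  · rw [hτS]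
    linarith [mul_nonneg hs (hx.no_discharge j), mul_nonneg ht (hy.no_discharge j)]
  · rw [hdE, hbE, hx.dod_start, hy.dod_start]; ring
  · rw [hdHat, hbS, hx.dod_end, hy.dod_end]; ring
  · have hsum : ∑ j, ((s • x + (1 - s) • y).tauS j + (s • x + (1 - s) • y).tauE j) =
        s * ∑ j, (x.tauS j + x.tauE j) + (1 - s) * ∑ j, (y.tauS j + y.tauE j) := by
      rw [Finset.mul_sum, Finset.mul_sum, ← Finset.sum_add_distrib]
      refine Finset.sum_congr rfl fun j _ => ?_
      rw [hτS, hτE]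
      ring
    rw [hsum, hx.total_time, hy.total_time]
    ring

end FeasibleSet

section Stationary

variable {p : SatData J}

/-- The derivative at `x` of the surrogate objective built at `z`. -/
noncomputable def surrogateDeriv (p : SatData J) (z x : SatVar J) : SatVar J →L[ℝ] ℝ :=
  ∑ j, cycleLifeSlope p.a (x.dHat j) • (EuclideanSpace.proj (5, j) : SatVar J →L[ℝ] ℝ) -
    ∑ j, cycleLifeSlope p.a (z.dE j) • (EuclideanSpace.proj (4, j) : SatVar J →L[ℝ] ℝ)

theorem surrogateDeriv_apply (z x v : SatVar J) : p.surrogateDeriv z x v =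
    ∑ j, cycleLifeSlope p.a (x.dHat j) * v.dHat j -
      ∑ j, cycleLifeSlope p.a (z.dE j) * v.dE j := by
  simp [surrogateDeriv, SatVar.dHat, SatVar.dE]

theorem hasFDerivAt_u (p : SatData J) (x : SatVar J) : HasFDerivAt p.u
    (∑ j, cycleLifeSlope p.a (x.dHat j) • (EuclideanSpace.proj (5, j) : SatVar J →L[ℝ] ℝ)) x := by
  refine HasFDerivAt.fun_sum fun j _ => ?_
  exact (hasDerivAt_cycleLife p.a (x.dHat j)).comp_hasFDerivAt x (x.hasFDerivAt_dHat j)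

theorem hasFDerivAt_surrogate (p : SatData J) (z x : SatVar J) :
    HasFDerivAt (p.surrogate z) (p.surrogateDeriv z x) x :=
  (p.hasFDerivAt_u x).sub (HasFDerivAt.fun_sum fun j _ => (x.hasFDerivAt_dE j).mul_const _)

theorem hasFDerivAt_objective (p : SatData J) (x : SatVar J) :
    HasFDerivAt p.objective (p.surrogateDeriv x x) x := by
  refine (p.hasFDerivAt_u x).sub (HasFDerivAt.fun_sum fun j _ => ?_)
  exact (hasDerivAt_cycleLife p.a (x.dE j)).comp_hasFDerivAt x (x.hasFDerivAt_dE j)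

theorem isStationary_iff {x : SatVar J} : p.IsStationary x ↔
    x ∈ p.feasibleSet ∧ ∀ y ∈ p.feasibleSet, 0 ≤ p.surrogateDeriv x x (y - x) := by
  rw [IsStationary, (p.hasFDerivAt_objective x).fderiv]

theorem fderiv_apply_sub_nonneg_of_isMinOn {E : Type*} [NormedAddCommGroup E] [NormedSpace ℝ E]
    {f : E → ℝ} {f' : E →L[ℝ] ℝ} {s : Set E} {x y : E} (hs : Convex ℝ s)
    (hf : HasFDerivAt f f' x) (hmin : IsMinOn f s x) (hx : x ∈ s) (hy : y ∈ s) : 0 ≤ f' (y - x) :=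
  hmin.localize.hasFDerivWithinAt_nonneg hf.hasFDerivWithinAt
    (sub_mem_posTangentConeAt_of_segment_subset (hs.segment_subset hx hy))

theorem IsSurrogateOptimal.surrogateDeriv_nonneg {z x y : SatVar J}
    (h : p.IsSurrogateOptimal z x) (hy : y ∈ p.feasibleSet) : 0 ≤ p.surrogateDeriv z x (y - x) :=
  fderiv_apply_sub_nonneg_of_isMinOn p.convex_feasibleSet (p.hasFDerivAt_surrogate z x)
    (fun y hy => h.2 y hy) h.1 hy

theorem IsSurrogateOptimal.isStationary {z x : SatVar J} (h : p.IsSurrogateOptimal z x)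
    (hd : z.dVec = x.dVec) : p.IsStationary x := by
  have hdE (j : Fin J) : z.dE j = x.dE j := congrArg (fun d : EuclideanSpace ℝ (Fin J) => d j) hd
  have hderiv : p.surrogateDeriv z x = p.surrogateDeriv x x := by simp only [surrogateDeriv, hdE]
  exact isStationary_iff.2 ⟨h.1, fun y hy => hderiv ▸ h.surrogateDeriv_nonneg hy⟩

theorem exists_isStationary (h : p.feasibleSet.Nonempty) : ∃ x, p.IsStationary x := by
  obtain ⟨x, hx, hmin⟩ := p.isCompact_feasibleSet.exists_isMinOn h
    (fun x _ => (p.hasFDerivAt_objective x).continuousAt.continuousWithinAt)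
  exact ⟨x, isStationary_iff.2 ⟨hx, fun y hy => fderiv_apply_sub_nonneg_of_isMinOn
    p.convex_feasibleSet (p.hasFDerivAt_objective x) hmin hx hy⟩⟩

theorem continuous_surrogate (p : SatData J) :
    Continuous fun q : SatVar J × SatVar J => p.surrogate q.1 q.2 :=
  (continuous_finsetSum _ fun j _ => (continuous_cycleLife p.a).comp
    ((SatVar.continuous_dHat j).comp continuous_snd)).sub <|
  continuous_finsetSum _ fun j _ => ((SatVar.continuous_dE j).comp continuous_snd).mul
    ((continuous_cycleLifeSlope p.a).comp ((SatVar.continuous_dE j).comp continuous_fst))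

theorem IsSurrogateOptimal.of_tendsto {z x : ℕ → SatVar J} {zbar xbar : SatVar J}
    (h : ∀ l, p.IsSurrogateOptimal (z l) (x l)) (hz : Tendsto z atTop (𝓝 zbar))
    (hx : Tendsto x atTop (𝓝 xbar)) : p.IsSurrogateOptimal zbar xbar :=
  ⟨p.isClosed_feasibleSet.mem_of_tendsto hx (Eventually.of_forall fun l => (h l).1), fun y hy =>
    le_of_tendsto_of_tendsto'
      ((p.continuous_surrogate.tendsto (zbar, xbar)).comp (hz.prodMk_nhds hx))
      ((p.continuous_surrogate.tendsto (zbar, y)).comp (hz.prodMk_nhds tendsto_const_nhds))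
      fun l => (h l).2 y hy⟩

theorem exists_infDist_isStationary_lt (p : SatData J) {η : ℝ} (hη : 0 < η) :
    ∃ ε > 0, ∀ z x : SatVar J, z ∈ p.feasibleSet → p.IsSurrogateOptimal z x →
      ‖x.dVec - z.dVec‖ ≤ ε → Metric.infDist x {x | p.IsStationary x} < η := by
  by_contra! hfar
  choose z x hz hx hd hfar using fun n : ℕ => hfar (1 / ((n : ℝ) + 1)) (by positivity)
  obtain ⟨⟨zbar, xbar⟩, -, φ, hφ, hlim⟩ :=
    (p.isCompact_feasibleSet.prod p.isCompact_feasibleSet).tendsto_subseq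
      (x := fun n => (z n, x n)) (fun n => ⟨hz n, (hx n).1⟩)
  have hlimz : Tendsto (z ∘ φ) atTop (𝓝 zbar) := (continuous_fst.tendsto _).comp hlim
  have hlimx : Tendsto (x ∘ φ) atTop (𝓝 xbar) := (continuous_snd.tendsto _).comp hlim
  have hdVec : zbar.dVec = xbar.dVec := by
    have hnorm : Tendsto (fun n => ‖(x (φ n)).dVec - (z (φ n)).dVec‖) atTop
        (𝓝 ‖xbar.dVec - zbar.dVec‖) :=
      (((SatVar.continuous_dVec.tendsto _).comp hlimx).sub
        ((SatVar.continuous_dVec.tendsto _).comp hlimz)).norm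
    have hle := le_of_tendsto_of_tendsto' hnorm
      (tendsto_one_div_add_atTop_nhds_zero_nat.comp hφ.tendsto_atTop) fun n => hd (φ n)
    exact (sub_eq_zero.1 (norm_le_zero_iff.1 hle)).symm
  have hstat : p.IsStationary xbar :=
    (IsSurrogateOptimal.of_tendsto (fun n => hx (φ n)) hlimz hlimx).isStationary hdVec
  obtain ⟨n, hn⟩ := ((tendsto_iff_dist_tendsto_zero.1 hlimx).eventually_lt_const hη).exists
  have hstat' : xbar ∈ {x | p.IsStationary x} := hstat
  exact ((Metric.infDist_le_dist_of_mem hstat').trans_lt hn).not_ge (hfar (φ n))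

end Stationary

end SatData

/-! ### From schedules to chains -/

namespace DepthChain

variable {c : DepthChain} {y : ℕ → ℝ} {θ : ℝ}

/-- The time bought in the eclipses. -/
noncomputable def eclipseTime (c : DepthChain) (y : ℕ → ℝ) : ℝ :=
  ∑ j ∈ Finset.range c.J, (inc y (2 * j + 1) - c.lo (2 * j + 1))

theorem time_eq_add (h : c.IsAdmissible y) : c.time y = c.eclipseTime y +
    ∑ j ∈ Finset.range c.J, (min (inc y (2 * j)) (c.hi (2 * j)) - c.lo (2 * j)) := by
  unfold time eclipseTime
  rw [sum_range_two_mul, ← Finset.sum_add_distrib]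
  refine Finset.sum_congr rfl fun j hj => ?_
  rw [Finset.mem_range] at hj
  rw [min_eq_left (h.hi (2 * j + 1) (by omega) (by omega))]
  ring

theorem IsAdmissible.lo_le_min (h : c.IsAdmissible y) {i : ℕ} (hi : i < 2 * c.J) :
    c.lo i ≤ min (inc y i) (c.hi i) :=
  le_min (h.lo i hi) (c.lo_le_hi i hi)

theorem IsAdmissible.eclipseTime_le_time (h : c.IsAdmissible y) : c.eclipseTime y ≤ c.time y := by
  rw [time_eq_add h]
  refine le_add_of_nonneg_right (Finset.sum_nonneg fun j hj => sub_nonneg.2 (h.lo_le_min ?_))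
  rw [Finset.mem_range] at hj
  omega

/-- The chain in which the time bought in every eclipse is multiplied by `θ`, while the depths at
the starts of the eclipses stay as they are. -/
noncomputable def scaleEclipses (c : DepthChain) (θ : ℝ) (y : ℕ → ℝ) (i : ℕ) : ℝ :=
  if i = 0 ∨ i % 2 = 1 then y i
  else y (i - 1) + (c.lo (i - 1) + θ * (inc y (i - 1) - c.lo (i - 1)))

theorem scaleEclipses_zero : c.scaleEclipses θ y 0 = y 0 := if_pos (.inl rfl)

theorem scaleEclipses_odd (j : ℕ) : c.scaleEclipses θ y (2 * j + 1) = y (2 * j + 1) :=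
  if_pos (.inr (by omega))

theorem scaleEclipses_even (j : ℕ) : c.scaleEclipses θ y (2 * j + 1 + 1) = y (2 * j + 1) +
    (c.lo (2 * j + 1) + θ * (inc y (2 * j + 1) - c.lo (2 * j + 1))) :=
  if_neg (by omega)

theorem inc_scaleEclipses_odd (j : ℕ) : inc (c.scaleEclipses θ y) (2 * j + 1) =
    c.lo (2 * j + 1) + θ * (inc y (2 * j + 1) - c.lo (2 * j + 1)) := by
  rw [inc, scaleEclipses_even, scaleEclipses_odd, add_sub_cancel_left]

theorem eclipseTime_scaleEclipses : c.eclipseTime (c.scaleEclipses θ y) = θ * c.eclipseTime y := by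
  simp only [eclipseTime, inc_scaleEclipses_odd, add_sub_cancel_left, Finset.mul_sum]

theorem exists_lt_of_lt_two_mul {i n : ℕ} (hi : i < 2 * n) : ∃ j < n, i = 2 * j ∨ i = 2 * j + 1 :=
  ⟨i / 2, by omega, by omega⟩

theorem IsAdmissible.inc_scaleEclipses_odd_le (h : c.IsAdmissible y) (hθ : θ ≤ 1) {j : ℕ}
    (hj : j < c.J) : inc (c.scaleEclipses θ y) (2 * j + 1) ≤ inc y (2 * j + 1) := by
  rw [inc_scaleEclipses_odd, ← le_sub_iff_add_le']
  exact mul_le_of_le_one_left (sub_nonneg.2 (h.lo _ (by omega))) hθ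

theorem IsAdmissible.scaleEclipses_even_le (h : c.IsAdmissible y) (hθ : θ ≤ 1) {j : ℕ}
    (hj : j < c.J) : c.scaleEclipses θ y (2 * j + 1 + 1) ≤ y (2 * j + 1 + 1) := by
  have hinc := h.inc_scaleEclipses_odd_le hθ hj
  rwa [inc, inc, scaleEclipses_odd, sub_le_sub_iff_right] at hinc

theorem IsAdmissible.inc_le_inc_scaleEclipses_even (h : c.IsAdmissible y) (hθ : θ ≤ 1) {j : ℕ}
    (hj : j < c.J) : inc y (2 * j) ≤ inc (c.scaleEclipses θ y) (2 * j) := by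
  rw [inc, inc, scaleEclipses_odd]
  refine sub_le_sub_left ?_ _
  cases j with
  | zero => exact scaleEclipses_zero.le
  | succ j => exact h.scaleEclipses_even_le hθ (by omega)

theorem IsAdmissible.scaleEclipses (h : c.IsAdmissible y) (hθ₀ : 0 ≤ θ) (hθ₁ : θ ≤ 1) :
    c.IsAdmissible (c.scaleEclipses θ y) := by
  have hgain {j : ℕ} (hj : j < c.J) : 0 ≤ θ * (inc y (2 * j + 1) - c.lo (2 * j + 1)) :=
    mul_nonneg hθ₀ (sub_nonneg.2 (h.lo _ (by omega)))
  refine ⟨scaleEclipses_zero.trans h.base, fun i hi => ?_, fun i hi hodd => ?_, fun i hi => ?_,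
    fun i hi => ?_⟩ <;> obtain ⟨j, hj, rfl | rfl⟩ := exists_lt_of_lt_two_mul hi
  · exact (h.lo _ hi).trans (h.inc_le_inc_scaleEclipses_even hθ₁ hj)
  · rw [inc_scaleEclipses_odd]
    exact le_add_of_nonneg_right (hgain hj)
  · omega
  · exact (h.inc_scaleEclipses_odd_le hθ₁ hj).trans (h.hi _ hi hodd)
  · rw [scaleEclipses_odd]
    exact h.nonneg _ hi
  · rw [scaleEclipses_even]
    exact add_nonneg (h.nonneg _ (by omega))
      (add_nonneg (c.lo_nonneg _ hi (by omega)) (hgain hj))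
  · rw [scaleEclipses_odd]
    exact h.le_one _ hi
  · exact (h.scaleEclipses_even_le hθ₁ hj).trans (h.le_one _ hi)

theorem IsFeasible.exists_eclipseTime_le (h : c.IsFeasible y) (hT : 0 ≤ c.T) :
    ∃ y', c.IsFeasible y' ∧ c.eclipseTime y' ≤ c.T ∧
      (∀ j < c.J, y' (2 * j + 1) = y (2 * j + 1)) ∧
      ∀ j < c.J, y' (2 * j + 1 + 1) ≤ y (2 * j + 1 + 1) := by
  rcases le_or_gt (c.eclipseTime y) c.T with hle | hlt
  · exact ⟨y, h, hle, fun _ _ => rfl, fun _ _ => le_rfl⟩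
  have hpos : 0 < c.eclipseTime y := hT.trans_lt hlt
  have hθ₁ : c.T / c.eclipseTime y ≤ 1 := (div_le_one hpos).2 hlt.le
  have hadm := h.1.scaleEclipses (div_nonneg hT hpos.le) hθ₁
  have htime : c.eclipseTime (c.scaleEclipses (c.T / c.eclipseTime y) y) = c.T := by
    rw [eclipseTime_scaleEclipses, div_mul_cancel₀ _ hpos.ne']
  exact ⟨_, ⟨hadm, htime.symm.le.trans hadm.eclipseTime_le_time⟩, htime.le,
    fun j _ => scaleEclipses_odd j, fun j hj => h.1.scaleEclipses_even_le hθ₁ hj⟩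

end DepthChain

/-- The extension of a vector by zero to a sequence. -/
def extendZero (f : Fin J → ℝ) (k : ℕ) : ℝ := if h : k < J then f ⟨k, h⟩ else 0

theorem extendZero_apply (f : Fin J → ℝ) (j : Fin J) : extendZero f j = f j := dif_pos j.2

theorem exists_fin_of_lt_two_mul {i : ℕ} (hi : i < 2 * J) :
    ∃ j : Fin J, i = 2 * j ∨ i = 2 * j + 1 :=
  ⟨⟨i / 2, by omega⟩, by dsimp only; omega⟩

theorem exists_sum_eq_of_le_sum {ι : Type*} [Fintype ι] {cap : ι → ℝ} {r : ℝ}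
    (hcap : ∀ i, 0 ≤ cap i) (hr₀ : 0 ≤ r) (hr : r ≤ ∑ i, cap i) :
    ∃ s : ι → ℝ, (∀ i, 0 ≤ s i) ∧ (∀ i, s i ≤ cap i) ∧ ∑ i, s i = r := by
  rcases (Finset.sum_nonneg fun i _ => hcap i).eq_or_lt with hzero | hpos
  · exact ⟨0, fun _ => le_rfl, hcap, by simpa using le_antisymm hr₀ (hzero ▸ hr)⟩
  · refine ⟨fun i => r / (∑ i, cap i) * cap i, fun i => mul_nonneg (div_nonneg hr₀ hpos.le)
      (hcap i), fun i => mul_le_of_le_one_left (hcap i) ((div_le_one hpos).2 hr), ?_⟩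
    rw [← Finset.mul_sum, div_mul_cancel₀ _ hpos.ne']

namespace SatData

section Chain

variable (p : SatData J)

/-- The least increments of the depth of discharge: those without training. -/
noncomputable def chainLo (i : ℕ) : ℝ :=
  if i % 2 = 0 then extendZero (fun j => -(p.EhS j - p.EdS j) / p.Bmax) (i / 2)
  else extendZero (fun j => p.EdE j / p.Bmax) (i / 2)

/-- The increments of the depth of discharge that correspond to the maximal training times. The
condition that the battery is not discharged in sunlight bounds them by `0` there. -/
noncomputable def chainHi (i : ℕ) : ℝ :=
  if i % 2 = 0 then extendZero (fun j => min (-(p.EhS j - p.EdS j) / p.Bmax +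
    p.Pc * (p.tE j - p.tS j.castSucc) / p.Bmax) 0) (i / 2)
  else extendZero (fun j => p.EdE j / p.Bmax + p.Pc * (p.tS j.succ - p.tE j) / p.Bmax) (i / 2)

/-- The depths of discharge of a schedule in temporal order: the initial one, then those at the
start and at the end of each eclipse. -/
noncomputable def depths (x : SatVar J) (i : ℕ) : ℝ :=
  if i = 0 then 1 - p.B0 / p.Bmax else if i % 2 = 1 then extendZero x.dE (i / 2)
  else extendZero x.dHat (i / 2 - 1)

variable {p}

theorem chainLo_even (j : Fin J) : p.chainLo (2 * j) = -(p.EhS j - p.EdS j) / p.Bmax := by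
  rw [chainLo, if_pos (by omega), show 2 * (j : ℕ) / 2 = j by omega, extendZero_apply]

theorem chainLo_odd (j : Fin J) : p.chainLo (2 * j + 1) = p.EdE j / p.Bmax := by
  rw [chainLo, if_neg (by omega), show (2 * (j : ℕ) + 1) / 2 = j by omega, extendZero_apply]

theorem chainHi_even (j : Fin J) : p.chainHi (2 * j) = min (-(p.EhS j - p.EdS j) / p.Bmax +
    p.Pc * (p.tE j - p.tS j.castSucc) / p.Bmax) 0 := by
  rw [chainHi, if_pos (by omega), show 2 * (j : ℕ) / 2 = j by omega, extendZero_apply]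

theorem chainHi_odd (j : Fin J) : p.chainHi (2 * j + 1) =
    p.EdE j / p.Bmax + p.Pc * (p.tS j.succ - p.tE j) / p.Bmax := by
  rw [chainHi, if_neg (by omega), show (2 * (j : ℕ) + 1) / 2 = j by omega, extendZero_apply]

theorem chainLo_add_le_chainHi_even_iff (j : Fin J) (t : ℝ) :
    p.chainLo (2 * j) + p.Pc * t / p.Bmax ≤ p.chainHi (2 * j) ↔
      t ≤ p.tE j - p.tS j.castSucc ∧ 0 ≤ p.EhS j - p.EdS j - p.Pc * t := by
  rw [chainLo_even, chainHi_even, le_min_iff, add_le_add_iff_left,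
    div_le_div_iff_of_pos_right p.Bmax_pos, mul_le_mul_iff_right₀ p.Pc_pos, ← add_div,
    div_le_iff₀ p.Bmax_pos, zero_mul, neg_add_nonpos_iff, sub_nonneg (b := p.Pc * t)]

theorem chainLo_add_le_chainHi_odd_iff (j : Fin J) (t : ℝ) :
    p.chainLo (2 * j + 1) + p.Pc * t / p.Bmax ≤ p.chainHi (2 * j + 1) ↔
      t ≤ p.tS j.succ - p.tE j := by
  rw [chainLo_odd, chainHi_odd, add_le_add_iff_left, div_le_div_iff_of_pos_right p.Bmax_pos,
    mul_le_mul_iff_right₀ p.Pc_pos]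

theorem depths_zero (x : SatVar J) : p.depths x 0 = 1 - p.B0 / p.Bmax := if_pos rfl

theorem depths_odd (x : SatVar J) (j : Fin J) : p.depths x (2 * j + 1) = x.dE j := by
  rw [depths, if_neg (by omega), if_pos (by omega), show (2 * (j : ℕ) + 1) / 2 = j by omega,
    extendZero_apply]

theorem depths_even (x : SatVar J) (j : Fin J) : p.depths x (2 * j + 1 + 1) = x.dHat j := by
  rw [depths, if_neg (by omega), if_neg (by omega),
    show (2 * (j : ℕ) + 1 + 1) / 2 - 1 = j by omega, extendZero_apply]

theorem depths_of_lt (x : SatVar J) {i : ℕ} (hi : 2 * J < i) : p.depths x i = 0 := by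
  unfold depths extendZero
  rw [if_neg (by omega)]
  split_ifs <;> first | rfl | omega

theorem bS_eq {x : SatVar J} {y : ℕ → ℝ} (h₀ : y 0 = 1 - p.B0 / p.Bmax)
    (h : ∀ j : Fin J, x.bSnext j = p.Bmax * (1 - y (2 * j + 1 + 1))) (j : Fin J) :
    p.bS x j = p.Bmax * (1 - y (2 * j)) := by
  unfold bS
  split_ifs with hj
  · rw [hj, mul_zero, h₀, sub_sub_cancel, mul_div_cancel₀ _ p.Bmax_pos.ne']
  · rw [h, show 2 * ((j : ℕ) - 1) + 1 + 1 = 2 * j by omega]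

variable {x : SatVar J}

theorem eq_mul_one_sub_iff {b d : ℝ} : b = p.Bmax * (1 - d) ↔ d = (p.Bmax - b) / p.Bmax := by
  rw [eq_div_iff p.Bmax_pos.ne']
  constructor <;> intro h <;> linarith

theorem IsFeasible.bE_eq (h : p.IsFeasible x) (j : Fin J) : x.bE j = p.Bmax * (1 - x.dE j) :=
  eq_mul_one_sub_iff.2 (h.dod_start j)

theorem IsFeasible.bSnext_eq (h : p.IsFeasible x) (j : Fin J) :
    x.bSnext j = p.Bmax * (1 - x.dHat j) :=
  eq_mul_one_sub_iff.2 (h.dod_end j)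

theorem IsFeasible.le_inc_even (h : p.IsFeasible x) (j : Fin J) :
    p.chainLo (2 * j) + p.Pc * x.tauS j / p.Bmax ≤ inc (p.depths x) (2 * j) := by
  have hbS := bS_eq (depths_zero x) (fun j => by rw [depths_even, h.bSnext_eq]) j
  have hlevel := (le_min_iff.1 (h.sunlight j)).1
  rw [h.bE_eq, hbS] at hlevel
  rw [chainLo_even, inc, depths_odd, ← add_div, div_le_iff₀ p.Bmax_pos]
  linarith

theorem IsFeasible.inc_odd (h : p.IsFeasible x) (j : Fin J) :
    inc (p.depths x) (2 * j + 1) = p.chainLo (2 * j + 1) + p.Pc * x.tauE j / p.Bmax := by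
  have hlevel := h.eclipse j
  rw [h.bE_eq, h.bSnext_eq] at hlevel
  rw [chainLo_odd, inc, depths_odd, depths_even, ← add_div, eq_div_iff p.Bmax_pos.ne']
  linarith

theorem IsFeasible.chainLo_add_le_chainHi_even (h : p.IsFeasible x) (j : Fin J) :
    p.chainLo (2 * j) + p.Pc * x.tauS j / p.Bmax ≤ p.chainHi (2 * j) :=
  (chainLo_add_le_chainHi_even_iff j _).2 ⟨(h.time_sun j).2, h.no_discharge j⟩

theorem IsFeasible.inc_odd_le_chainHi (h : p.IsFeasible x) (j : Fin J) :
    inc (p.depths x) (2 * j + 1) ≤ p.chainHi (2 * j + 1) :=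
  (h.inc_odd j).trans_le ((chainLo_add_le_chainHi_odd_iff j _).2 (h.time_ecl j).2)

theorem Pc_mul_div_Bmax_nonneg_iff {t : ℝ} : 0 ≤ p.Pc * t / p.Bmax ↔ 0 ≤ t := by
  rw [le_div_iff₀ p.Bmax_pos, zero_mul, mul_nonneg_iff_of_pos_left p.Pc_pos]

theorem IsFeasible.chainLo_le_inc (h : p.IsFeasible x) {i : ℕ} (hi : i < 2 * J) :
    p.chainLo i ≤ inc (p.depths x) i := by
  obtain ⟨j, rfl | rfl⟩ := exists_fin_of_lt_two_mul hi
  · exact (le_add_of_nonneg_right (Pc_mul_div_Bmax_nonneg_iff.2 (h.time_sun j).1)).trans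
      (h.le_inc_even j)
  · exact (le_add_of_nonneg_right (Pc_mul_div_Bmax_nonneg_iff.2 (h.time_ecl j).1)).trans
      (h.inc_odd j).ge

theorem IsFeasible.chainLo_le_chainHi (h : p.IsFeasible x) (i : ℕ) (hi : i < 2 * J) :
    p.chainLo i ≤ p.chainHi i := by
  obtain ⟨j, rfl | rfl⟩ := exists_fin_of_lt_two_mul hi
  · exact (le_add_of_nonneg_right (Pc_mul_div_Bmax_nonneg_iff.2 (h.time_sun j).1)).trans
      (h.chainLo_add_le_chainHi_even j)
  · exact (h.chainLo_le_inc hi).trans (h.inc_odd_le_chainHi j)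

/-- The chain of depths of a nonempty scheduling problem. Training times are multiplied by
`p.Pc / p.Bmax`, which turns them into increments of the depth of discharge. -/
noncomputable def toDepthChain (p : SatData J) (h : ∀ i < 2 * J, p.chainLo i ≤ p.chainHi i) :
    DepthChain where
  J := J
  a := p.a
  base := 1 - p.B0 / p.Bmax
  lo := p.chainLo
  hi := p.chainHi
  T := p.Pc * p.Tc / p.Bmax
  a_pos := p.a_pos
  lo_nonneg i hi ho := by
    obtain ⟨j, rfl | rfl⟩ := exists_fin_of_lt_two_mul hi
    · omega
    · rw [chainLo_odd]
      exact div_nonneg (p.EdE_nonneg j) p.Bmax_pos.le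
  lo_le_hi := h

/-- The time that depths `y` allow for training in sunlight period `j`, as an increment of the
depth of discharge. -/
noncomputable def sunCap (p : SatData J) (y : ℕ → ℝ) (j : Fin J) : ℝ :=
  min (inc y (2 * j)) (p.chainHi (2 * j)) - p.chainLo (2 * j)

variable {hlh : ∀ i < 2 * J, p.chainLo i ≤ p.chainHi i} {y : ℕ → ℝ}

theorem eclipseTime_toDepthChain (y : ℕ → ℝ) : (p.toDepthChain hlh).eclipseTime y =
    ∑ j : Fin J, (inc y (2 * j + 1) - p.chainLo (2 * j + 1)) :=
  Finset.sum_range _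

theorem time_toDepthChain (hy : (p.toDepthChain hlh).IsAdmissible y) :
    (p.toDepthChain hlh).time y = (p.toDepthChain hlh).eclipseTime y + ∑ j, p.sunCap y j :=
  (DepthChain.time_eq_add hy).trans (congrArg _ (Finset.sum_range _))

theorem IsFeasible.isAdmissible (h : p.IsFeasible x) :
    (p.toDepthChain hlh).IsAdmissible (p.depths x) := by
  refine ⟨depths_zero x, fun i => h.chainLo_le_inc, fun i hi hodd => ?_, fun i hi => ?_,
    fun i hi => ?_⟩ <;> obtain ⟨j, rfl | rfl⟩ := exists_fin_of_lt_two_mul (J := J) hi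
  · omega
  · exact h.inc_odd_le_chainHi j
  · exact (depths_odd x j).symm ▸ (h.dE_mem j).1
  · exact (depths_even x j).symm ▸ (h.dHat_mem j).1
  · exact (depths_odd x j).symm ▸ (h.dE_mem j).2
  · exact (depths_even x j).symm ▸ (h.dHat_mem j).2

theorem IsFeasible.tauS_le_sunCap (h : p.IsFeasible x) (j : Fin J) :
    p.Pc * x.tauS j / p.Bmax ≤ p.sunCap (p.depths x) j :=
  le_sub_iff_add_le'.2 (le_min (h.le_inc_even j) (h.chainLo_add_le_chainHi_even j))

theorem IsFeasible.T_eq (h : p.IsFeasible x) : (p.toDepthChain hlh).T =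
    (p.toDepthChain hlh).eclipseTime (p.depths x) + ∑ j, p.Pc * x.tauS j / p.Bmax := by
  simp only [eclipseTime_toDepthChain, h.inc_odd, add_sub_cancel_left]
  change p.Pc * p.Tc / p.Bmax = _
  rw [← h.total_time, Finset.sum_add_distrib, mul_add, add_div, add_comm, Finset.mul_sum,
    Finset.sum_div, Finset.mul_sum, Finset.sum_div]

theorem IsFeasible.isFeasible (h : p.IsFeasible x) :
    (p.toDepthChain hlh).IsFeasible (p.depths x) := by
  refine ⟨h.isAdmissible, ?_⟩
  rw [time_toDepthChain h.isAdmissible, h.T_eq]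
  exact add_le_add_right (Finset.sum_le_sum fun j _ => h.tauS_le_sunCap j) _

theorem IsFeasible.tauS_eq_sunCap (h : p.IsFeasible x)
    (hT : (p.toDepthChain hlh).time (p.depths x) = (p.toDepthChain hlh).T) (j : Fin J) :
    p.Pc * x.tauS j / p.Bmax = p.sunCap (p.depths x) j := by
  rw [time_toDepthChain h.isAdmissible, h.T_eq] at hT
  exact (Finset.sum_eq_sum_iff_of_le fun j _ => h.tauS_le_sunCap j).1 (add_left_cancel hT).symm j
    (Finset.mem_univ j)

/-- The schedule with depths of discharge `y` in which training in sunlight period `j` increases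
the depth of discharge by `s j`. -/
noncomputable def schedule (p : SatData J) (s : Fin J → ℝ) (y : ℕ → ℝ) : SatVar J :=
  WithLp.toLp 2 fun k => ![s k.2 * p.Bmax / p.Pc,
    (inc y (2 * k.2 + 1) - p.chainLo (2 * k.2 + 1)) * p.Bmax / p.Pc,
    p.Bmax * (1 - y (2 * k.2 + 1)), p.Bmax * (1 - y (2 * k.2 + 1 + 1)), y (2 * k.2 + 1),
    y (2 * k.2 + 1 + 1)] k.1

variable {s : Fin J → ℝ}

theorem Pc_mul_div_Bmax_eq_iff {t r : ℝ} : p.Pc * t / p.Bmax = r ↔ t = r * p.Bmax / p.Pc := by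
  rw [div_eq_iff p.Bmax_pos.ne', eq_div_iff p.Pc_pos.ne', mul_comm]

theorem tauS_schedule (j : Fin J) : p.Pc * (p.schedule s y).tauS j / p.Bmax = s j :=
  Pc_mul_div_Bmax_eq_iff.2 rfl

theorem tauE_schedule (j : Fin J) : p.Pc * (p.schedule s y).tauE j / p.Bmax =
    inc y (2 * j + 1) - p.chainLo (2 * j + 1) :=
  Pc_mul_div_Bmax_eq_iff.2 rfl

theorem total_time_schedule (hsum : (p.toDepthChain hlh).eclipseTime y + ∑ j, s j =
    (p.toDepthChain hlh).T) :
    ∑ j, ((p.schedule s y).tauS j + (p.schedule s y).tauE j) = p.Tc := by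
  replace hsum : (p.toDepthChain hlh).eclipseTime y + ∑ j, s j = p.Pc * p.Tc / p.Bmax := hsum
  rw [← Finset.sum_congr rfl fun j _ => tauS_schedule (p := p) (s := s) (y := y) j] at hsum
  simp only [eclipseTime_toDepthChain, ← tauE_schedule (s := s), ← Finset.sum_div,
    ← Finset.mul_sum] at hsum
  rw [← add_div, ← mul_add, div_left_inj' p.Bmax_pos.ne', mul_right_inj' p.Pc_pos.ne', add_comm]
    at hsum
  rw [Finset.sum_add_distrib, hsum]

theorem mul_one_sub_mem {d : ℝ} (h₀ : 0 ≤ d) (h₁ : d ≤ 1) :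
    0 ≤ p.Bmax * (1 - d) ∧ p.Bmax * (1 - d) ≤ p.Bmax :=
  ⟨mul_nonneg p.Bmax_pos.le (sub_nonneg.2 h₁),
    mul_le_of_le_one_right p.Bmax_pos.le (sub_le_self _ h₀)⟩

theorem isFeasible_schedule (hy : (p.toDepthChain hlh).IsAdmissible y) (hs₀ : ∀ j, 0 ≤ s j)
    (hs : ∀ j, s j ≤ p.sunCap y j)
    (hsum : (p.toDepthChain hlh).eclipseTime y + ∑ j, s j = (p.toDepthChain hlh).T) :
    p.IsFeasible (p.schedule s y) := by
  have hlo (i) (hi : i < 2 * J) : p.chainLo i ≤ inc y i := hy.lo i hi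
  have hhi (i) (hi : i < 2 * J) (hodd : i % 2 = 1) : inc y i ≤ p.chainHi i := hy.hi i hi hodd
  have hmem (i) (hi : i < 2 * J) := p.mul_one_sub_mem (hy.nonneg i hi) (hy.le_one i hi)
  have hcap (j : Fin J) := le_min_iff.1 (le_sub_iff_add_le'.1 (hs j))
  have hsun (j) := (chainLo_add_le_chainHi_even_iff j ((p.schedule s y).tauS j)).1
    (by rw [tauS_schedule]; exact (hcap j).2)
  have hecl (j) := (chainLo_add_le_chainHi_odd_iff j ((p.schedule s y).tauE j)).1
    (by rw [tauE_schedule, add_sub_cancel]; exact hhi _ (by omega) (by omega))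
  refine ⟨fun j => ?_, fun j => le_min ?_ (hmem _ (by omega)).2, fun j => (hsun j).2,
    fun j => eq_mul_one_sub_iff.1 rfl, fun j => eq_mul_one_sub_iff.1 rfl, total_time_schedule hsum,
    fun j => ⟨?_, (hsun j).1⟩, fun j => ⟨?_, hecl j⟩, fun j => hmem _ (by omega),
    fun j => hmem _ (by omega)⟩
  · have htime := (div_eq_iff p.Bmax_pos.ne').1 (tauE_schedule (p := p) (s := s) (y := y) j)
    rw [htime, sub_mul, chainLo_odd, div_mul_cancel₀ _ p.Bmax_pos.ne', inc]
    change p.Bmax * (1 - y (2 * j + 1 + 1)) = p.Bmax * (1 - y (2 * j + 1)) - _ - _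
    ring
  · have htime := (div_eq_iff p.Bmax_pos.ne').1 (tauS_schedule (p := p) (s := s) (y := y) j)
    have hinc := (hcap j).1
    rw [chainLo_even, ← le_sub_iff_add_le', ← mul_le_mul_iff_left₀ p.Bmax_pos, sub_mul,
      div_mul_cancel₀ _ p.Bmax_pos.ne', inc] at hinc
    rw [htime, bS_eq (y := y) hy.base fun _ => rfl]
    change p.Bmax * (1 - y (2 * j + 1)) ≤ _
    linarith
  · exact Pc_mul_div_Bmax_nonneg_iff.1 ((hs₀ j).trans_eq (tauS_schedule j).symm)
  · exact Pc_mul_div_Bmax_nonneg_iff.1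
      ((sub_nonneg.2 (hlo _ (by omega))).trans_eq (tauE_schedule j).symm)

theorem exists_isFeasible_schedule (hy : (p.toDepthChain hlh).IsFeasible y)
    (hE : (p.toDepthChain hlh).eclipseTime y ≤ (p.toDepthChain hlh).T) :
    ∃ s, p.IsFeasible (p.schedule s y) := by
  have hle := hy.2
  rw [time_toDepthChain hy.1, ← sub_le_iff_le_add'] at hle
  obtain ⟨s, hs₀, hs, hsum⟩ := exists_sum_eq_of_le_sum
    (fun j : Fin J => sub_nonneg.2 (hy.1.lo_le_min (i := 2 * j) (Nat.mul_lt_mul_of_pos_left j.2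
      two_pos))) (sub_nonneg.2 hE) hle
  exact ⟨s, isFeasible_schedule hy.1 hs₀ hs (by rw [hsum, add_sub_cancel])⟩

theorem continuous_schedule_sunCap (p : SatData J) :
    Continuous fun y => p.schedule (p.sunCap y) y := by
  refine (PiLp.continuous_toLp 2 _).comp (continuous_pi ?_)
  rintro ⟨k, j⟩
  have hsun : Continuous fun y => p.sunCap y j := by unfold sunCap inc; fun_prop
  have hecl : Continuous fun y : ℕ → ℝ => inc y (2 * j + 1) := by unfold inc; fun_prop
  fin_cases k <;> dsimp <;> fun_prop

theorem IsFeasible.eq_schedule_sunCap (h : p.IsFeasible x)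
    (hT : (p.toDepthChain hlh).time (p.depths x) = (p.toDepthChain hlh).T) :
    x = p.schedule (p.sunCap (p.depths x)) (p.depths x) := by
  ext ⟨k, j⟩
  have hecl : p.Pc * x.tauE j / p.Bmax =
      inc (p.depths x) (2 * j + 1) - p.chainLo (2 * j + 1) := by
    rw [h.inc_odd, add_sub_cancel_left]
  fin_cases k
  exacts [Pc_mul_div_Bmax_eq_iff.1 (h.tauS_eq_sunCap hT j), Pc_mul_div_Bmax_eq_iff.1 hecl,
    (h.bE_eq j).trans (by rw [← depths_odd (p := p)]; rfl),
    (h.bSnext_eq j).trans (by rw [← depths_even (p := p)]; rfl),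
    (depths_odd (p := p) x j).symm, (depths_even (p := p) x j).symm]

theorem linForm_toDepthChain (g y y' : ℕ → ℝ) : (p.toDepthChain hlh).linForm g y y' =
    ∑ j : Fin J, (g (2 * j + 1) * (y' (2 * j + 1) - y (2 * j + 1)) +
      g (2 * j + 1 + 1) * (y' (2 * j + 1 + 1) - y (2 * j + 1 + 1))) :=
  (sum_range_two_mul _ _).trans (Finset.sum_range _)

theorem surrogateGrad_odd (z x : SatVar J) (j : Fin J) :
    (p.toDepthChain hlh).surrogateGrad (p.depths z) (p.depths x) (2 * j + 1) =
      -cycleLifeSlope p.a (z.dE j) := by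
  rw [DepthChain.surrogateGrad, if_neg (by omega), depths_odd]
  rfl

theorem surrogateGrad_even (z x : SatVar J) (j : Fin J) :
    (p.toDepthChain hlh).surrogateGrad (p.depths z) (p.depths x) (2 * j + 1 + 1) =
      cycleLifeSlope p.a (x.dHat j) := by
  rw [DepthChain.surrogateGrad, if_pos (by omega), depths_even]
  rfl

theorem IsFeasible.Tc_nonneg (h : p.IsFeasible x) : 0 ≤ p.Tc := by
  rw [← h.total_time]
  exact Finset.sum_nonneg fun j _ => add_nonneg (h.time_sun j).1 (h.time_ecl j).1

theorem IsSurrogateOptimal.isSurrogateCritical {z : SatVar J} (h : p.IsSurrogateOptimal z x) :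
    (p.toDepthChain hlh).IsSurrogateCritical (p.depths z) (p.depths x) := by
  have hx : p.IsFeasible x := h.1
  refine ⟨hx.isFeasible, fun y hy => ?_⟩
  -- Shortening the eclipse training of `y` until a schedule realizes it only decreases the form.
  obtain ⟨y', hy', hE, hodd, heven⟩ :=
    hy.exists_eclipseTime_le (Pc_mul_div_Bmax_nonneg_iff.2 hx.Tc_nonneg)
  obtain ⟨s, hw⟩ := exists_isFeasible_schedule hy' hE
  refine (h.surrogateDeriv_nonneg hw).trans ?_
  rw [surrogateDeriv_apply, ← Finset.sum_sub_distrib, linForm_toDepthChain]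
  refine Finset.sum_le_sum fun j _ => ?_
  have hdHat : (p.schedule s y' - x).dHat j = y' (2 * j + 1 + 1) - x.dHat j := rfl
  have hdE : (p.schedule s y' - x).dE j = y' (2 * j + 1) - x.dE j := rfl
  have hj : (j : ℕ) < (p.toDepthChain hlh).J := j.2
  rw [hdHat, hdE, hodd j hj, surrogateGrad_odd, surrogateGrad_even, depths_odd, depths_even]
  have hle := mul_le_mul_of_nonneg_left (heven j hj)
    (cycleLifeSlope_pos p.a_pos (hx.dHat_mem j).1).le
  linarith

theorem norm_dVec_sub_le (z x : SatVar J) :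
    ‖x.dVec - z.dVec‖ ≤ (p.toDepthChain hlh).l1Dist (p.depths z) (p.depths x) := by
  have hsum : ‖x.dVec - z.dVec‖ ≤ ∑ j, |x.dE j - z.dE j| := by
    rw [EuclideanSpace.norm_eq]
    exact Real.sqrt_le_iff.2 ⟨Finset.sum_nonneg fun _ _ => abs_nonneg _,
      Finset.sum_sq_le_sq_sum_of_nonneg fun j _ => abs_nonneg _⟩
  refine hsum.trans ?_
  rw [DepthChain.l1Dist, sum_range_two_mul, Finset.sum_range]
  refine Finset.sum_le_sum fun j _ => ?_
  rw [depths_odd, depths_odd]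
  exact le_add_of_nonneg_right (abs_nonneg _)

end Chain

section InfiniteRun

variable {p : SatData J} {x : ℕ → SatVar J}

theorem isRun_depths (h₀ : p.IsFeasible (x 0))
    (hx : ∀ l, p.IsSurrogateOptimal (x l) (x (l + 1))) :
    (p.toDepthChain h₀.chainLo_le_chainHi).IsRun fun l => p.depths (x l) :=
  ⟨h₀.isFeasible, fun l => (hx l).isSurrogateCritical, fun l _ => depths_of_lt (x l)⟩

theorem tendsto_norm_dVec_sub (h₀ : p.IsFeasible (x 0))
    (hx : ∀ l, p.IsSurrogateOptimal (x l) (x (l + 1))) :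
    Tendsto (fun l => ‖(x (l + 1)).dVec - (x l).dVec‖) atTop (𝓝 0) :=
  squeeze_zero (fun _ => norm_nonneg _) (fun _ => norm_dVec_sub_le _ _)
    (isRun_depths h₀ hx).tendsto_l1Dist

theorem exists_tendsto_of_forall_pos (h₀ : p.IsFeasible (x 0))
    (hx : ∀ l, p.IsSurrogateOptimal (x l) (x (l + 1)))
    (hmove : ∀ l, 0 < ‖(x (l + 1)).dVec - (x l).dVec‖) : ∃ xbar, Tendsto x atTop (𝓝 xbar) := by
  have hfeas : ∀ l, p.IsFeasible (x l)
    | 0 => h₀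
    | l + 1 => (hx l).1
  obtain ⟨y, hy, hT⟩ := (isRun_depths h₀ hx).exists_tendsto fun l =>
    (hmove l).trans_le (norm_dVec_sub_le _ _)
  refine ⟨_, ((p.continuous_schedule_sunCap.tendsto y).comp hy).congr' ?_⟩
  filter_upwards [hT] with l hl using ((hfeas l).eq_schedule_sunCap hl).symm

end InfiniteRun

end SatData

/-! ### The accuracy of the procedure -/

namespace SatData

section Accuracy

variable (p : SatData J) {ε : ℝ}

/-- Distances to the set of stationary points, over all iterations that pass the stopping test with
tolerance `ε`. -/
def stationaryDists (ε : ℝ) : Set ℝ :=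
  {r | ∃ z x : SatVar J, z ∈ p.feasibleSet ∧ p.IsSurrogateOptimal z x ∧
    ‖x.dVec - z.dVec‖ ≤ ε ∧ r = Metric.infDist x {x | p.IsStationary x}}

/-- The accuracy that the procedure with tolerance `ε` achieves. The summand `2 * ε` makes it exceed
`ε`, and also the distance to the stationary points, so that no nearest one is needed. -/
noncomputable def accuracy (ε : ℝ) : ℝ := 2 * ε + sSup (p.stationaryDists ε)

theorem sSup_stationaryDists_nonneg : 0 ≤ sSup (p.stationaryDists ε) := by
  refine Real.sSup_nonneg ?_
  rintro r ⟨z, x, -, -, -, rfl⟩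
  exact Metric.infDist_nonneg

theorem bddAbove_stationaryDists : BddAbove (p.stationaryDists ε) := by
  refine (p.isCompact_feasibleSet.bddAbove_image
    (Metric.continuous_infDist_pt {x | p.IsStationary x}).continuousOn).mono ?_
  rintro r ⟨z, x, -, hx, -, rfl⟩
  exact ⟨x, hx.1, rfl⟩

theorem lt_accuracy (hε : 0 < ε) : ε < p.accuracy ε := by
  have := p.sSup_stationaryDists_nonneg (ε := ε)
  unfold accuracy
  linarith

theorem tendsto_sSup_stationaryDists :
    Tendsto (fun ε => sSup (p.stationaryDists ε)) (𝓝[>] 0) (𝓝 0) := by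
  refine tendsto_order.2 ⟨fun r hr => .of_forall fun ε =>
    hr.trans_le p.sSup_stationaryDists_nonneg, fun η hη => ?_⟩
  obtain ⟨ε₀, hε₀, hlt⟩ := p.exists_infDist_isStationary_lt (half_pos hη)
  filter_upwards [Ioo_mem_nhdsGT hε₀] with ε hε
  refine (Real.sSup_le ?_ (half_pos hη).le).trans_lt (half_lt_self hη)
  rintro r ⟨z, x, hz, hx, hd, rfl⟩
  exact (hlt z x hz hx (hd.trans hε.2.le)).le

theorem tendsto_accuracy : Tendsto p.accuracy (𝓝[>] 0) (𝓝 0) := by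
  have hlin : Tendsto (fun ε : ℝ => 2 * ε) (𝓝[>] 0) (𝓝 (2 * 0)) :=
    (tendsto_id.const_mul 2).mono_left nhdsWithin_le_nhds
  have hsum := hlin.add p.tendsto_sSup_stationaryDists
  rw [mul_zero, add_zero] at hsum
  exact hsum

theorem exists_norm_sub_le_accuracy (hε : 0 < ε) {z x : SatVar J} (hz : z ∈ p.feasibleSet)
    (hx : p.IsSurrogateOptimal z x) (hd : ‖x.dVec - z.dVec‖ ≤ ε) :
    ∃ xstar, p.IsStationary xstar ∧ ‖xstar - x‖ ≤ p.accuracy ε := by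
  have hle : Metric.infDist x {x | p.IsStationary x} ≤ sSup (p.stationaryDists ε) :=
    le_csSup p.bddAbove_stationaryDists ⟨z, x, hz, hx, hd, rfl⟩
  have hlt : Metric.infDist x {x | p.IsStationary x} < p.accuracy ε := by
    unfold accuracy
    linarith
  obtain ⟨y, hy, hxy⟩ := (Metric.infDist_lt_iff (exists_isStationary ⟨x, hx.1⟩)).1 hlt
  exact ⟨y, hy, (dist_eq_norm y x ▸ dist_comm x y ▸ hxy).le⟩

end Accuracy

variable {p : SatData J} {ε : ℝ} {x : ℕ → SatVar J} {N : ℕ∞}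

theorem IsRun.mem_feasibleSet (h : p.IsRun ε x N) {l : ℕ} (hl : (l : ℕ∞) ≤ N) :
    x l ∈ p.feasibleSet := by
  cases l with
  | zero => exact h.init
  | succ l => exact (h.step l (lt_of_lt_of_le (by exact_mod_cast Nat.lt_succ_self l) hl)).1

theorem IsRun.exists_last {L : ℕ} (h : p.IsRun ε x L) : ∃ k, x k ∈ p.feasibleSet ∧
    p.IsSurrogateOptimal (x k) (x L) ∧ ‖(x L).dVec - (x k).dVec‖ ≤ ε := by
  have hL : 1 ≤ L := by exact_mod_cast h.one_le
  obtain ⟨k, rfl⟩ := Nat.exists_eq_add_of_le' hL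
  have hk : (k : ℕ∞) < ((k + 1 : ℕ) : ℕ∞) := by exact_mod_cast Nat.lt_succ_self k
  exact ⟨k, h.mem_feasibleSet hk.le, h.step k hk, (h.stop_iff k hk).2 rfl⟩

theorem IsRun.isSurrogateOptimal (h : p.IsRun ε x ⊤) (l : ℕ) :
    p.IsSurrogateOptimal (x l) (x (l + 1)) :=
  h.step l (ENat.natCast_lt_top l)

theorem IsRun.lt_norm (h : p.IsRun ε x ⊤) (l : ℕ) : ε < ‖(x (l + 1)).dVec - (x l).dVec‖ := by
  by_contra! hle
  exact ENat.top_ne_natCast _ ((h.stop_iff l (ENat.natCast_lt_top l)).1 hle)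

theorem IsRun.nonpos (h : p.IsRun ε x ⊤) : ε ≤ 0 :=
  ge_of_tendsto' (tendsto_norm_dVec_sub h.init h.isSurrogateOptimal) fun l => (h.lt_norm l).le

theorem IsRun.isStationary_of_tendsto (h : p.IsRun ε x ⊤) {xbar : SatVar J}
    (hx : Tendsto x atTop (𝓝 xbar)) : p.IsStationary xbar :=
  (IsSurrogateOptimal.of_tendsto h.isSurrogateOptimal hx
    (hx.comp (tendsto_add_atTop_nat 1))).isStationary rfl

end SatData

theorem mainTheorem1 {J : ℕ} (p : SatData J) :
    ∃ δ : ℝ → ℝ, Tendsto δ (𝓝[>] 0) (𝓝 0) ∧ (∀ ε : ℝ, 0 < ε → ε < δ ε) ∧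
      ∀ ε : ℝ, 0 ≤ ε → ∀ (x : ℕ → SatVar J) (N : ℕ∞), p.IsRun ε x N →
        ∃ xbar : SatVar J, RunConvergesTo x N xbar ∧
          (ε = 0 → p.IsStationary xbar) ∧
          (0 < ε → N < ⊤ ∧ ∃ xstar : SatVar J, p.IsStationary xstar ∧ ‖xstar - xbar‖ ≤ δ ε) := by
  refine ⟨p.accuracy, p.tendsto_accuracy, fun ε => p.lt_accuracy, fun ε hε x N h => ?_⟩
  induction N using ENat.recTopCoe with
  | top =>
    obtain ⟨xbar, hx⟩ := SatData.exists_tendsto_of_forall_pos h.init h.isSurrogateOptimal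
      fun l => hε.trans_lt (h.lt_norm l)
    exact ⟨xbar, Or.inr ⟨rfl, hx⟩, fun _ => h.isStationary_of_tendsto hx,
      fun hpos => absurd h.nonpos hpos.not_ge⟩
  | coe L =>
    obtain ⟨k, hk, hopt, hd⟩ := h.exists_last
    refine ⟨x L, Or.inl ⟨L, rfl, rfl⟩, fun hzero => ?_, fun hpos => ⟨ENat.natCast_lt_top L,
      p.exists_norm_sub_le_accuracy hpos hk hopt hd⟩⟩
    rw [hzero] at hd
    exact hopt.isStationary (sub_eq_zero.1 (norm_le_zero_iff.1 hd)).symm
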